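/- **Setting.** Let $N\ge 2$ and $m$ be integers and let $r_1,\dots,r_N\in\{1,2\}$ be such that $r_j=2$ only if $2j\equiv m \pmod N$; put $M=r_1+\dots+r_N$. An $M\times M$ matrix $A$ is divided into blocks $A_{jk}$ of size $r_j\times r_k$, a column $h\in\mathbb C^M$ into blocks $h_j\in\mathbb C^{r_j}$, and block indices are read modulo $N$. For an integer $k$ let $\{k\}\in\{0,\dots,N-1\}$ be its remainder modulo $N$. Let $\omega=e^{2\pi i/N}$ and $\Omega=\operatorname{diag}(\omega^{1-j}I_{r_j})_{1\le j\le N}$. Let $K$ be the $M\times M$ matrix with $K_{jk}=0$ for $j+k\not\equiv m \pmod N$, $K_{j,m-j}=1$ if $r_j=1$, and $K_{j,m-j}=\begin{pmatrix}0&1\\1&0\end{pmatrix}$ if $r_j=2$. Let $J$ be a real $M\times M$ matrix with $KJK=J^T$ and $\Omega J\Omega^{-1}=\omega J$. On $\mathbb R^2$ put $z=(x+iy)/2$, so $\partial_z=\partial_x-i\partial_y$ and $\partial_{\bar z}=\partial_x+i\partial_y$. Let $U\subseteq\mathbb R^2$ be open; all functions are smooth on $U$. The elliptic Toda system for a real diagonal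 matrix $V$ is $$(V_zV^{-1})_{\bar z}+[J,VJ^TV^{-1}]=0,\tag{1}$$ and its Lax pair is $$\Phi_z=(\lambda J+V_zV^{-1})\Phi,\qquad \Phi_{\bar z}=\lambda^{-1}VJ^TV^{-1}\Phi.\tag{2}$$ **Data.** Let $V$ be a real diagonal solution of (1) on $U$ with $V^TKV=K$ and $\det V_{jj}=1$ whenever $2j\equiv m\pmod N$. Let $\mu\in\mathbb C$, $\mu\neq0$, $|\mu|\ne1$, and let $H$ be a column solution of (2) on $U$ with $\lambda=\mu$. If $N$ and $m$ are both even, suppose $H^TK\Omega^{N/2}H=0$. By a *family through $H$* we mean column solutions $\Phi(\cdot,\lambda)$ of (2), for $\lambda$ in a neighbourhood of $\mu$, which are jointly smooth and holomorphic in $\lambda$, with $\Phi(\cdot,\mu)=H$ and, for even $N$, $\Phi^TK\Omega^{N/2}\Phi=0$ (this is automatic if $m$ is odd); write $H'=\partial_\lambda\Phi|_{\lambda=\mu}$. If $N$ is even and $m$ is odd, suppose that such a family exists and use its $H'$ below; in the other cases $H'$ does not occur in the formulas below. For integers $a$, $k$ put, for $N$ odd, $$\alpha_a=\tfrac12\sum_{c=1}^N(-1)^{\{a+c-2\}}h_{m-c}^TK_{m-c,c}h_c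 ,$$ and for $N$ even, with $\sigma(m)=1$ for odd $m$ and $\sigma(m)=0$ for even $m$, $$\alpha_a=\tfrac1N\sum_{c=1}^N(-1)^{a+c-1}\Big(\{a+c-2\}\,h_{m-c}^TK_{m-c,c}h_c-\sigma(m)\,\mu\, h_{m-c}'^{\,T}K_{m-c,c}h_c\Big),$$ and in both cases $$\beta_a=|\mu|^2\sum_{c=1}^N\frac{(-|\mu|^2)^{\{c-a-1\}}}{1-(-1)^N|\mu|^{2N}}h_c^*V_{cc}^{-1}h_c,\qquad \gamma_a=\sum_{c=1}^N\frac{(-|\mu|^2)^{\{a+c-2\}}}{1-(-1)^N|\mu|^{2N}}h_c^*V_{cc}^{-1}h_c,$$ $$\Delta_k=|\alpha_{k-m}|^2-\beta_{k-2}\gamma_{k-m}.$$ Where $\Delta_{2+m-j}\ne0$ let $f_j$ be the $r_j\times r_j$ matrix $$f_j=I-\Delta_{2+m-j}^{-1}\Big(\bar\alpha_{2-j}h_jh_{m-j}^TK_{m-j,j}+\alpha_{2-j}K_{j,m-j}V_{m-j,m-j}^{-1}\bar h_{m-j}h_j^*V_{jj}^{-1}-\beta_{m-j}h_jh_j^*V_{jj}^{-1}-\gamma_{2-j}K_{j,m-j}V_{m-j,m-j}^{-1}\bar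 h_{m-j}h_{m-j}^TK_{m-j,j}\Big).$$ **The Darboux matrix.** For a family $\Phi$ through $H$ and $1\le j\le N$ let $\lambda_j(\lambda)=\omega^{j-1}\lambda$, $\lambda_{N+j}(\lambda)=\omega^{j-1}\bar\lambda^{-1}$, $\Phi_j=\Omega^{j-1}\Phi$, $\Phi_{N+j}=KV^{-1}\Omega^{-j+1}\bar\Phi$; let $\mu_j=\lambda_j(\mu)$, $H_j=\Phi_j|_{\lambda=\mu}$ for $1\le j\le 2N$. Let $\Gamma$ be the $2N\times2N$ matrix $\Gamma_{jk}=\lim_{\lambda\to\mu}\Phi_j(\lambda)^TK\Phi_k(\mu)/(\lambda_j(\lambda)+\mu_k)$ and, where $\Gamma$ is invertible, $$T(\lambda)=\prod_{i=1}^{2N}(\lambda+\mu_i)\Big(I-\sum_{j,k=1}^{2N}\frac{H_j(\Gamma^{-1})_{jk}H_k^TK}{\lambda+\mu_k}\Big)=\sum_{j=0}^{2N}T_j\lambda^{2N-j}.$$ **Theorem.** 1. For every family through $H$ (with the given $H'$ if $N$ is even and $m$ is odd) and every point of $U$, the limits $\Gamma_{jk}$ exist; $\Gamma$ is invertible if and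 only if $\Delta_k\neq0$ for all $k$; and in that case $T_{2N}=(\mu/\bar\mu)^N(f_j\delta_{jk})_{1\le j,k\le N}$. 2. At every point where $\Delta_{2+m-j}\ne0$: if $r_j=1$, then $f_j=\dfrac{\Delta_{1+m-j}}{\Delta_{2+m-j}}$. If $r_j=2$, write $V_{jj}=\operatorname{diag}(v_j,v_j^{-1})$ and $h_j=(h_{j1},h_{j2})^T$; then the denominators below are non-zero and $$f_j=\operatorname{diag}\left(\frac{|h_{j1}|^2v_j^{-1}-\gamma_{2-j}}{|h_{j2}|^2v_j-\gamma_{2-j}},\ \frac{|h_{j2}|^2v_j-\gamma_{2-j}}{|h_{j1}|^2v_j^{-1}-\gamma_{2-j}}\right).$$ If $2j\equiv m\pmod N$, then $\det f_j=1$. 3. If all $\Delta_k$ are non-zero on $U$ and every $f_j$ is positive definite on $U$, then $\widetilde V=(V_{jj}f_j\delta_{jk})_{1\le j,k\le N}$ is again a smooth real diagonal solution of (1) on $U$, with $\widetilde V^TK\widetilde V=K$, $\Omega\widetilde V\Omega^{-1}=\widetilde V$, and $\det\widetilde V_{jj}=1$ whenever $2j\equiv m\pmod N$. -/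

import Mathlib

open Matrix Filter Topology
open scoped ContDiff ComplexConjugate ComplexOrder

namespace EllipticToda

noncomputable section

/-- Index set of the `M` coordinates: a block number `j` modulo `N`, and a position inside the
block `j`, which has size `r j`. -/
abbrev Idx (N : ℕ) (r : ZMod N → ℕ) : Type := (j : ZMod N) × Fin (r j)

/-- `r_j × r_k` block with block indices `j`, `k`. -/
def blk {N : ℕ} {r : ZMod N → ℕ} (A : Matrix (Idx N r) (Idx N r) ℂ) (j k : ZMod N) :
    Matrix (Fin (r j)) (Fin (r k)) ℂ :=
  A.submatrix (fun a => ⟨j, a⟩) (fun b => ⟨k, b⟩)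

/-- `r_j × 1` block of a column. -/
def vblk {N : ℕ} {r : ZMod N → ℕ} (h : Idx N r → ℂ) (j : ZMod N) : Fin (r j) → ℂ :=
  fun a => h ⟨j, a⟩

/-- `ω = exp (2πi/N)`. -/
def omega (N : ℕ) : ℂ := Complex.exp (2 * Real.pi * Complex.I / N)

/-- `Ω`, block diagonal with blocks `ω ^ (1 - j) I`. -/
def Om (N : ℕ) (r : ZMod N → ℕ) : Matrix (Idx N r) (Idx N r) ℂ :=
  Matrix.diagonal fun i => omega N ^ (1 - (i.1.val : ℤ))

/-- `K`: the block `K_{jk}` vanishes unless `j + k ≡ m`; the block `K_{j,m-j}` is `1` if `r_j = 1`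
and the `2 × 2` matrix with rows `(0, 1)`, `(1, 0)` if `r_j = 2`. -/
def Kmat (N : ℕ) (r : ZMod N → ℕ) (m : ℤ) : Matrix (Idx N r) (Idx N r) ℂ :=
  Matrix.of fun i k =>
    if i.1 + k.1 = (m : ZMod N) then
      (if r i.1 = 1 then 1 else if i.2.val ≠ k.2.val then 1 else 0)
    else 0

/-! Points of the plane are pairs `(x, y)`; `z = (x + i y) / 2`, so that
`∂_z = ∂_x - i ∂_y` and `∂_z̄ = ∂_x + i ∂_y`. -/

/-- `∂f/∂z` for `z = (x + i y) / 2`. -/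
def dz (f : ℝ × ℝ → ℂ) (p : ℝ × ℝ) : ℂ :=
  fderiv ℝ f p (1, 0) - Complex.I * fderiv ℝ f p (0, 1)

/-- `∂f/∂z̄` for `z = (x + i y) / 2`. -/
def dzbar (f : ℝ × ℝ → ℂ) (p : ℝ × ℝ) : ℂ :=
  fderiv ℝ f p (1, 0) + Complex.I * fderiv ℝ f p (0, 1)

/-- Entrywise `∂_z` of a matrix function. -/
def mdz {ι : Type*} (A : ℝ × ℝ → Matrix ι ι ℂ) (p : ℝ × ℝ) : Matrix ι ι ℂ :=
  Matrix.of fun i k => dz (fun q => A q i k) p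

/-- Entrywise `∂_z̄` of a matrix function. -/
def mdzbar {ι : Type*} (A : ℝ × ℝ → Matrix ι ι ℂ) (p : ℝ × ℝ) : Matrix ι ι ℂ :=
  Matrix.of fun i k => dzbar (fun q => A q i k) p

/-- `P = V_z V⁻¹`. -/
def Pmat {ι : Type*} [Fintype ι] [DecidableEq ι] (V : ℝ × ℝ → Matrix ι ι ℂ) (p : ℝ × ℝ) :
    Matrix ι ι ℂ :=
  mdz V p * (V p)⁻¹

/-- `Q = V Jᵀ V⁻¹`. -/
def Qmat {ι : Type*} [Fintype ι] [DecidableEq ι] (J : Matrix ι ι ℂ)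
    (V : ℝ × ℝ → Matrix ι ι ℂ) (p : ℝ × ℝ) : Matrix ι ι ℂ :=
  V p * Jᵀ * (V p)⁻¹

/-- `V` is on `U` a smooth real diagonal solution of the elliptic Toda system
`(V_z V⁻¹)_z̄ + [J, V Jᵀ V⁻¹] = 0` with `Vᵀ K V = K` and `det V_jj = 1` whenever `2 j ≡ m`. -/
structure IsTodaSolution (N : ℕ) [NeZero N] (r : ZMod N → ℕ) (m : ℤ)
    (J : Matrix (Idx N r) (Idx N r) ℂ) (U : Set (ℝ × ℝ))
    (V : ℝ × ℝ → Matrix (Idx N r) (Idx N r) ℂ) : Prop where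
  smooth : ∀ i k, ContDiffOn ℝ ∞ (fun p => V p i k) U
  diag : ∀ p ∈ U, (V p).IsDiag
  real : ∀ p ∈ U, (V p).map conj = V p
  orth : ∀ p ∈ U, (V p)ᵀ * Kmat N r m * V p = Kmat N r m
  det_blk : ∀ p ∈ U, ∀ j : ZMod N, 2 * j = (m : ZMod N) → (blk (V p) j j).det = 1
  toda : ∀ p ∈ U, mdzbar (Pmat V) p + (J * Qmat J V p - Qmat J V p * J) = 0

/-- `H` is on `U` a smooth column solution of the Lax pair
`H_z = (lam J + P) H`, `H_z̄ = lam⁻¹ Q H`. -/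
structure IsLaxSolution {ι : Type*} [Fintype ι] [DecidableEq ι] (J : Matrix ι ι ℂ)
    (U : Set (ℝ × ℝ)) (V : ℝ × ℝ → Matrix ι ι ℂ) (lam : ℂ) (H : ℝ × ℝ → ι → ℂ) : Prop where
  smooth : ∀ i, ContDiffOn ℝ ∞ (fun p => H p i) U
  eq_z : ∀ p ∈ U, (fun i => dz (fun q => H q i) p) = (lam • J + Pmat V p) *ᵥ H p
  eq_zbar : ∀ p ∈ U, (fun i => dzbar (fun q => H q i) p) = lam⁻¹ • (Qmat J V p *ᵥ H p)

/-- The bilinear form `hᵀ K Ω^(N/2) h` (used for even `N` only). -/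
def constraintForm (N : ℕ) [NeZero N] (r : ZMod N → ℕ) (m : ℤ) (h : Idx N r → ℂ) : ℂ :=
  h ⬝ᵥ ((Kmat N r m * Om N r ^ (N / 2)) *ᵥ h)

/-- `Φ lam` is, for `lam` near `μ`, a column solution of the Lax pair at `lam`, depending
holomorphically on `lam` and smoothly on all variables, with `Φ μ = H` and
`∂Φ/∂lam = H'` at `lam = μ`; when `N` is even it satisfies `Φᵀ K Ω^(N/2) Φ = 0`. -/
def IsLaxFamily (N : ℕ) [NeZero N] (r : ZMod N → ℕ) (m : ℤ)
    (J : Matrix (Idx N r) (Idx N r) ℂ) (U : Set (ℝ × ℝ))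
    (V : ℝ × ℝ → Matrix (Idx N r) (Idx N r) ℂ) (μ : ℂ) (H H' : ℝ × ℝ → Idx N r → ℂ)
    (Φ : ℂ → ℝ × ℝ → Idx N r → ℂ) : Prop :=
  ∃ W : Set ℂ, IsOpen W ∧ μ ∈ W ∧
    (∀ lam ∈ W, IsLaxSolution J U V lam (Φ lam)) ∧
    (∀ p ∈ U, ∀ i, DifferentiableOn ℂ (fun lam => Φ lam p i) W) ∧
    (∀ i, ContDiffOn ℝ ∞ (fun q : ℂ × (ℝ × ℝ) => Φ q.1 q.2 i) (W ×ˢ U)) ∧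
    (Even N → ∀ lam ∈ W, ∀ p ∈ U, constraintForm N r m (Φ lam p) = 0) ∧
    (∀ p ∈ U, Φ μ p = H p) ∧
    (∀ p ∈ U, ∀ i, HasDerivAt (fun lam => Φ lam p i) (H' p i) μ)

/-! The Darboux matrix at one point of the plane. The `2N` spectral parameters are indexed by
`Fin N ⊕ Fin N`; the index `inl j` or `inr j` with `j = 0, …, N - 1` is the `(j + 1)`-st element of
the first or second group. -/

/-- `lam_j = ω^j lam` in the first group, `ω^j / conj lam` in the second. -/
def spec (N : ℕ) (lam : ℂ) : Fin N ⊕ Fin N → ℂ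
  | .inl j => omega N ^ (j : ℕ) * lam
  | .inr j => omega N ^ (j : ℕ) * (conj lam)⁻¹

/-- `Ω^j h` in the first group, `K V⁻¹ Ω^(-j) conj h` in the second. -/
def orbit (N : ℕ) [NeZero N] (r : ZMod N → ℕ) (m : ℤ) (V : Matrix (Idx N r) (Idx N r) ℂ)
    (h : Idx N r → ℂ) : Fin N ⊕ Fin N → Idx N r → ℂ
  | .inl j => (Om N r ^ (j : ℕ)) *ᵥ h
  | .inr j => (Kmat N r m * V⁻¹ * (Om N r)⁻¹ ^ (j : ℕ)) *ᵥ (fun i => conj (h i))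

/-- `G = Γ` at one point, where `V` is the value of the potential and `Φ lam` that of the family:
`Γ_{jk}` is the limit as `lam → μ` of `Φ_j(lam)ᵀ K Φ_k(μ) / (lam_j(lam) + μ_k)`. -/
def IsGamma (N : ℕ) [NeZero N] (r : ZMod N → ℕ) (m : ℤ) (μ : ℂ)
    (V : Matrix (Idx N r) (Idx N r) ℂ) (Φ : ℂ → Idx N r → ℂ)
    (G : Matrix (Fin N ⊕ Fin N) (Fin N ⊕ Fin N) ℂ) : Prop :=
  ∀ j k, Tendsto
    (fun lam => (orbit N r m V (Φ lam) j ⬝ᵥ (Kmat N r m *ᵥ orbit N r m V (Φ μ) k)) /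
      (spec N lam j + spec N μ k)) (𝓝[≠] μ) (𝓝 (G j k))

/-- The Darboux matrix
`T(lam) = ∏ (lam + μ_i) (I - ∑ H_j (Γ⁻¹)_{jk} H_kᵀ K / (lam + μ_k))`. -/
def darbouxT (N : ℕ) [NeZero N] (r : ZMod N → ℕ) (m : ℤ) (μ : ℂ)
    (V : Matrix (Idx N r) (Idx N r) ℂ) (h : Idx N r → ℂ)
    (G : Matrix (Fin N ⊕ Fin N) (Fin N ⊕ Fin N) ℂ) (lam : ℂ) : Matrix (Idx N r) (Idx N r) ℂ :=
  (∏ i, (lam + spec N μ i)) •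
    (1 - ∑ j, ∑ k, (G⁻¹ j k / (lam + spec N μ k)) •
      (Matrix.vecMulVec (orbit N r m V h j) (orbit N r m V h k) * Kmat N r m))

/-- The coefficient `T_{2N}` of `lam^0` in the polynomial `T(lam)` of degree `2N`. -/
def T2N (N : ℕ) [NeZero N] (r : ZMod N → ℕ) (m : ℤ) (μ : ℂ)
    (V : Matrix (Idx N r) (Idx N r) ℂ) (h : Idx N r → ℂ)
    (G : Matrix (Fin N ⊕ Fin N) (Fin N ⊕ Fin N) ℂ) : Matrix (Idx N r) (Idx N r) ℂ :=
  darbouxT N r m μ V h G 0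

/-! The coefficients `α`, `β`, `γ`, `Δ` and the blocks `f_j` at one point, where `V`, `h`, `h'` are
the values of `V`, `H`, `H'` there. The remainder `{k}` modulo `N` is `ZMod.val`. -/

/-- `x_{m-c}ᵀ K_{m-c,c} y_c`. -/
def pairing (N : ℕ) (r : ZMod N → ℕ) (m : ℤ) (x y : Idx N r → ℂ) (c : ZMod N) : ℂ :=
  vblk x ((m : ZMod N) - c) ⬝ᵥ (blk (Kmat N r m) ((m : ZMod N) - c) c *ᵥ vblk y c)

/-- `h_c^* V_cc⁻¹ h_c`. -/
def hermNorm {N : ℕ} {r : ZMod N → ℕ} (V : Matrix (Idx N r) (Idx N r) ℂ) (h : Idx N r → ℂ)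
    (c : ZMod N) : ℂ :=
  (fun a => conj (vblk h c a)) ⬝ᵥ ((blk V c c)⁻¹ *ᵥ vblk h c)

open Classical in
/-- `α_a`: the first formula is for odd `N`, the second one for even `N`. -/
def alpha (N : ℕ) [NeZero N] (r : ZMod N → ℕ) (m : ℤ) (μ : ℂ) (h h' : Idx N r → ℂ)
    (a : ZMod N) : ℂ :=
  if Odd N then
    (1 / 2) * ∑ c : ZMod N, (-1) ^ (a + c - 2).val * pairing N r m h h c
  else
    (1 / (N : ℂ)) * ∑ c : ZMod N, (-1) ^ (a + c - 1).val *
      (((a + c - 2).val : ℂ) * pairing N r m h h c -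
        (if Odd m then 1 else 0) * μ * pairing N r m h' h c)

/-- `β_a`; the denominator is `1 + |μ|^(2N)` for odd `N` and `1 - |μ|^(2N)` for even `N`. -/
def beta (N : ℕ) [NeZero N] (r : ZMod N → ℕ) (μ : ℂ) (V : Matrix (Idx N r) (Idx N r) ℂ)
    (h : Idx N r → ℂ) (a : ZMod N) : ℂ :=
  (‖μ‖ : ℂ) ^ 2 * ∑ c : ZMod N, (-(‖μ‖ : ℂ) ^ 2) ^ (c - a - 1).val /
    (1 - (-1) ^ N * (‖μ‖ : ℂ) ^ (2 * N)) * hermNorm V h c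

/-- `γ_a`; the denominator is as in `β_a`. -/
def gamma (N : ℕ) [NeZero N] (r : ZMod N → ℕ) (μ : ℂ) (V : Matrix (Idx N r) (Idx N r) ℂ)
    (h : Idx N r → ℂ) (a : ZMod N) : ℂ :=
  ∑ c : ZMod N, (-(‖μ‖ : ℂ) ^ 2) ^ (a + c - 2).val /
    (1 - (-1) ^ N * (‖μ‖ : ℂ) ^ (2 * N)) * hermNorm V h c

/-- `Δ_k = |α_{k-m}|² - β_{k-2} γ_{k-m}`. -/
def Delta (N : ℕ) [NeZero N] (r : ZMod N → ℕ) (m : ℤ) (μ : ℂ)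
    (V : Matrix (Idx N r) (Idx N r) ℂ) (h h' : Idx N r → ℂ) (k : ZMod N) : ℂ :=
  (‖alpha N r m μ h h' (k - m)‖ : ℂ) ^ 2 - beta N r μ V h (k - 2) * gamma N r μ V h (k - m)

/-- The block `f_j`, that is
`I - Δ_{2+m-j}⁻¹ (conj α_{2-j} h_j h_{m-j}ᵀ K_{m-j,j}
  + α_{2-j} K_{j,m-j} V_{m-j,m-j}⁻¹ conj h_{m-j} h_j^* V_jj⁻¹
  - β_{m-j} h_j h_j^* V_jj⁻¹
  - γ_{2-j} K_{j,m-j} V_{m-j,m-j}⁻¹ conj h_{m-j} h_{m-j}ᵀ K_{m-j,j})`. -/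
def fBlock (N : ℕ) [NeZero N] (r : ZMod N → ℕ) (m : ℤ) (μ : ℂ)
    (V : Matrix (Idx N r) (Idx N r) ℂ) (h h' : Idx N r → ℂ) (j : ZMod N) :
    Matrix (Fin (r j)) (Fin (r j)) ℂ :=
  let mj : ZMod N := (m : ZMod N) - j
  let u : Fin (r j) → ℂ :=
    (blk (Kmat N r m) j mj * (blk V mj mj)⁻¹) *ᵥ (fun a => conj (vblk h mj a))
  let w : Fin (r j) → ℂ := vblk h mj ᵥ* blk (Kmat N r m) mj j
  let s : Fin (r j) → ℂ := (fun a => conj (vblk h j a)) ᵥ* (blk V j j)⁻¹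
  1 - (Delta N r m μ V h h' (2 + m - j))⁻¹ •
    (conj (alpha N r m μ h h' (2 - j)) • Matrix.vecMulVec (vblk h j) w
      + alpha N r m μ h h' (2 - j) • Matrix.vecMulVec u s
      - beta N r μ V h (m - j) • Matrix.vecMulVec (vblk h j) s
      - gamma N r μ V h (2 - j) • Matrix.vecMulVec u w)

end

end EllipticToda

/-!
Darboux transformation of the elliptic Toda system. Let `X` be the matrix whose columns are the
`2N` vectors `H_s`, let `D` be the diagonal matrix of the spectral parameters `μ_s`, and put `Y =
Xᵀ K`.

*The matrix `Γ`.* All statements about `Γ` rest on its explicit form `gammaMat`: up to discrete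
Fourier transforms on both sides it is block diagonal, and the `N` blocks are the two by two
matrices with entries `α / μ`, `β / μ`, `conj μ γ`, `conj μ conj α` and with determinant `(conj μ
/ μ) Δ`. The recursions of the coefficients, `alpha_add_one`, `gamma_add_one` and `beta_eq`, are
the Fourier transform of the Sylvester equation `D Γ + Γ D = Y X` (`spec_add_mul_gammaMat`), which
determines the entries with `μ_s + μ_t ≠ 0`. The remaining entries, which occur for even `N` only,
are governed by the Fourier coefficient of `α` at frequency `N / 2`; `alternating_alpha` shows
that it is zero for even `m` and contributes the derivative of the family for odd `m`. Hence `Γ`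
is the matrix of the limits (`isGamma_gammaMat`), it is invertible exactly if no `Δ_k` vanishes
(`isUnit_gammaMat`), and since the Fourier matrices also occur in `X` and `D⁻¹ Y`, the value `R₀ =
1 - X Γ⁻¹ D⁻¹ Y` at zero of the normalized Darboux matrix is block diagonal with blocks `f_j`
(`darboux₀_eq`).

*The blocks.* The formulas for `f_j` are consequences of the recursions and of the reflections
`alpha_reflect`, `Delta_reflect`.

*The new solution.* The symmetries `Ω` and `v ↦ K V⁻¹ conj v` of the Lax pair make every `H_s` a
solution of the Lax pair at `μ_s` (`IsLaxSolution.orbit`). It follows that `Γ_z = Y J X` and `Γ_z̄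
= D⁻¹ Y Q X D⁻¹` (`gammaMat_deriv`): for the regular entries by differentiating the Sylvester
equation, for the singular ones by differentiating the Lax pair in the spectral parameter
(`IsLaxFamily.isLaxDerivative`). With `R₁ = -X Γ⁻¹ Y` a computation with matrices gives `(R₀)_z +
R₀ P = (P + [R₁, J]) R₀` and `(R₁)_z̄ + Q = R₀ Q R₀⁻¹`, as well as `R₀ᵀ K R₀ = K`
(`darboux₀_lax`). Therefore the matrices `P`, `Q` of the potential `R₀ V` are `P + [R₁, J]` and
`(R₁)_z̄ + Q`, and its Toda equation reduces to the one of `V` (`toda_of_gauge`). Positivity of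
the blocks is used for the reality of the new potential.
-/

namespace EllipticToda

/-! ### Roots of unity indexed by residues -/

section

variable {N : ℕ} [NeZero N] {r : ZMod N → ℕ} {m : ℤ}

/-- `ω ^ x` for a residue `x` modulo `N`. -/
noncomputable def ec (x : ZMod N) : ℂ := ZMod.stdAddChar x

theorem ec_add (x y : ZMod N) : ec (x + y) = ec x * ec y := AddChar.map_add_eq_mul _ x y

@[simp] theorem ec_zero : ec (0 : ZMod N) = 1 := AddChar.map_zero_eq_one _

theorem ec_neg (x : ZMod N) : ec (-x) = (ec x)⁻¹ := AddChar.map_neg_eq_inv _ x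

theorem conj_ec (x : ZMod N) : conj (ec x) = ec (-x) := (AddChar.map_neg_eq_conj _ x).symm

@[simp] theorem ec_ne_zero (x : ZMod N) : ec x ≠ 0 := by
  intro h
  have h1 : ec (x + -x) = 1 := by simp
  rw [ec_add, h, zero_mul] at h1
  exact zero_ne_one h1

theorem ec_mul_nat (k : ℕ) (x : ZMod N) : ec ((k : ZMod N) * x) = ec x ^ k := by
  rw [← nsmul_eq_mul]; exact AddChar.map_nsmul_eq_pow _ k x

theorem norm_ec (x : ZMod N) : ‖ec x‖ = 1 := AddChar.norm_apply _ x

theorem sum_ec (b : ZMod N) : ∑ x, ec (x * b) = if b = 0 then (N : ℂ) else 0 := by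
  have h := AddChar.sum_mulShift b (ZMod.isPrimitive_stdAddChar N)
  rw [ZMod.card] at h
  simpa [ec] using h

theorem omega_eq_ec : omega N = ec (1 : ZMod N) := by
  have h := ZMod.stdAddChar_coe (N := N) 1
  simp only [Int.cast_one, mul_one] at h
  rw [omega, ec, h]

theorem omega_zpow (k : ℤ) : omega N ^ k = ec (k : ZMod N) := by
  rw [omega_eq_ec, ec, ec, ← AddChar.map_zsmul_eq_zpow]; simp

theorem omega_pow (k : ℕ) : omega N ^ k = ec (k : ZMod N) := by
  simpa using omega_zpow (N := N) (k : ℤ)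

theorem sum_shift (F : ZMod N → ℂ) (a : ZMod N) : ∑ c, F (c + a) = ∑ c, F c :=
  Equiv.sum_comp (Equiv.addRight a) F

theorem sum_reflect (F : ZMod N → ℂ) (a : ZMod N) : ∑ c, F (a - c) = ∑ c, F c :=
  Equiv.sum_comp (Equiv.subLeft a) F

theorem val_succ (x : ZMod N) : (x + 1).val = if x = -1 then 0 else x.val + 1 := by
  split_ifs with h
  · simp [h]
  · rcases Nat.lt_or_ge (x.val + 1) N with h1 | h1
    · have : x + 1 = ((x.val + 1 : ℕ) : ZMod N) := by simp
      rw [this, ZMod.val_natCast_of_lt h1]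
    · exfalso
      apply h
      have h2 : x.val + 1 = N := le_antisymm (ZMod.val_lt x) h1
      have h3 : ((x.val + 1 : ℕ) : ZMod N) = 0 := by rw [h2]; simp
      push_cast at h3
      rw [ZMod.natCast_zmod_val] at h3
      exact eq_neg_of_add_eq_zero_left h3

theorem val_reflect (x : ZMod N) : x.val + (-1 - x).val = N - 1 := by
  have h1 := ZMod.val_lt x
  have : -1 - x = ((N - 1 - x.val : ℕ) : ZMod N) := by
    rw [Nat.cast_sub (by omega), Nat.cast_sub (by omega)]; simp
  rw [this, ZMod.val_natCast_of_lt (by omega)]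
  omega

/-! ### The involution of the index set behind `K` -/

theorem r_reflect (hr : ∀ j, r j = 1 ∨ (r j = 2 ∧ 2 * j = (m : ZMod N))) (j : ZMod N) :
    r ((m : ZMod N) - j) = r j := by
  rcases hr j with h | ⟨h, h2⟩
  · rcases hr (m - j) with h' | ⟨h', h2'⟩
    · rw [h, h']
    · have : (m : ZMod N) - j = j := by linear_combination h2'
      rw [this]
  · have : (m : ZMod N) - j = j := by linear_combination -h2
    rw [this]

/-- Every row of `K` has exactly one entry `1` and is zero elsewhere. -/
theorem exists_flip (hr : ∀ j, r j = 1 ∨ (r j = 2 ∧ 2 * j = (m : ZMod N))) (i : Idx N r) :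
    ∃ l : Idx N r, ∀ k, Kmat N r m i k = if k = l then 1 else 0 := by
  obtain ⟨c, a⟩ := i
  rcases hr c with h | ⟨h, h2⟩
  · have h' : r ((m : ZMod N) - c) = 1 := by rw [r_reflect hr, h]
    refine ⟨⟨m - c, ⟨0, by omega⟩⟩, ?_⟩
    rintro ⟨d, b⟩
    by_cases hd : d = (m : ZMod N) - c
    · subst hd
      have hb : b = ⟨0, by omega⟩ := by apply Fin.ext; have := b.2; simp; omega
      subst hb
      simp [Kmat, h]
    · have : c + d ≠ (m : ZMod N) := fun h3 => hd (by linear_combination h3)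
      rw [if_neg (fun h3 => hd (congrArg Sigma.fst h3))]
      simp [Kmat, this]
  · refine ⟨⟨c, ⟨1 - a.val, by omega⟩⟩, ?_⟩
    rintro ⟨d, b⟩
    by_cases hd : d = c
    · subst hd
      have ha := a.2
      have hb := b.2
      have e1 : d + d = (m : ZMod N) := by linear_combination h2
      simp only [Kmat, of_apply, e1, h]
      simp only [if_true, OfNat.ofNat_ne_one, if_false, Sigma.mk.injEq, heq_eq_eq, true_and,
        Fin.ext_iff]
      by_cases h3 : a.val = b.val
      · rw [if_neg (by omega), if_neg (by omega)]
      · rw [if_pos h3, if_pos (by omega)]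
    · have : c + d ≠ (m : ZMod N) := fun h3 => hd (by linear_combination h3 - h2)
      rw [if_neg (fun h3 => hd (congrArg Sigma.fst h3))]
      simp [Kmat, this]

/-- The involution `κ` of the index set with `K_{ik} = 1` exactly when `k = κ i`. -/
noncomputable def flip (hr : ∀ j, r j = 1 ∨ (r j = 2 ∧ 2 * j = (m : ZMod N))) (i : Idx N r) :
    Idx N r := (exists_flip hr i).choose

variable (hr : ∀ j, r j = 1 ∨ (r j = 2 ∧ 2 * j = (m : ZMod N)))

theorem Kmat_apply (i k : Idx N r) : Kmat N r m i k = if k = flip hr i then 1 else 0 :=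
  (exists_flip hr i).choose_spec k

@[simp] theorem flip_fst (i : Idx N r) : (flip hr i).1 = (m : ZMod N) - i.1 := by
  have h := Kmat_apply hr i (flip hr i)
  rw [if_pos rfl] at h
  by_contra h2
  have : i.1 + (flip hr i).1 ≠ (m : ZMod N) := fun h3 => h2 (by linear_combination h3)
  simp [Kmat, this] at h

include hr in
theorem Kmat_transpose : (Kmat N r m)ᵀ = Kmat N r m := by
  ext i k
  simp only [transpose_apply, Kmat, of_apply, add_comm k.1 i.1, ne_comm (a := k.2.val)]
  by_cases h : i.1 + k.1 = (m : ZMod N)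
  · have : r k.1 = r i.1 := by
      rw [← r_reflect hr i.1]; congr 1; linear_combination h
    simp only [this]
  · simp [h]

@[simp] theorem flip_flip (i : Idx N r) : flip hr (flip hr i) = i := by
  have h := Kmat_apply hr i (flip hr i)
  rw [if_pos rfl, ← Kmat_transpose hr, transpose_apply, Kmat_apply hr] at h
  by_contra h2
  rw [if_neg (Ne.symm h2)] at h
  exact zero_ne_one h

/-- `flip` as a permutation. -/
noncomputable def flipEquiv : Equiv.Perm (Idx N r) :=
  ⟨flip hr, flip hr, flip_flip hr, flip_flip hr⟩

theorem sum_flip (F : Idx N r → ℂ) : ∑ i, F (flip hr i) = ∑ i, F i :=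
  Equiv.sum_comp (flipEquiv hr) F

theorem Kmat_mulVec (x : Idx N r → ℂ) (i : Idx N r) : (Kmat N r m *ᵥ x) i = x (flip hr i) := by
  simp [mulVec, dotProduct, Kmat_apply hr]

theorem Kmat_mul_apply {ι : Type*} (A : Matrix (Idx N r) ι ℂ) (i : Idx N r) (k : ι) :
    (Kmat N r m * A) i k = A (flip hr i) k := by
  simp [mul_apply, Kmat_apply hr]

theorem mul_Kmat_apply {ι : Type*} (A : Matrix ι (Idx N r) ℂ) (i : ι) (k : Idx N r) :
    (A * Kmat N r m) i k = A i (flip hr k) := by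
  rw [← Kmat_transpose hr]
  simp [mul_apply, Kmat_apply hr]

include hr in
theorem Kmat_mul_self : Kmat N r m * Kmat N r m = 1 := by
  ext i k
  rw [Kmat_mul_apply hr, Kmat_apply hr, flip_flip, one_apply]
  simp [eq_comm]

/-- The bilinear form of `K` as a sum over coordinates. -/
theorem dot_Kmat (x y : Idx N r → ℂ) :
    x ⬝ᵥ (Kmat N r m *ᵥ y) = ∑ i, x (flip hr i) * y i := by
  rw [← sum_flip hr]
  simp [dotProduct, Kmat_mulVec hr]

theorem sum_idx_block (F : Idx N r → ℂ) (d : ZMod N) (h : ∀ l : Idx N r, l.1 ≠ d → F l = 0) :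
    ∑ l, F l = ∑ b : Fin (r d), F ⟨d, b⟩ := by
  rw [Fintype.sum_sigma]
  refine Finset.sum_eq_single d (fun c _ hc => ?_) (by simp)
  exact Finset.sum_eq_zero fun b _ => h ⟨c, b⟩ hc

theorem sum_block_Kmat_left (x : Idx N r → ℂ) (i : Idx N r) (d : ZMod N)
    (hd : d = (m : ZMod N) - i.1) :
    ∑ b : Fin (r d), Kmat N r m i ⟨d, b⟩ * x ⟨d, b⟩ = x (flip hr i) := by
  rw [← sum_idx_block (fun l => Kmat N r m i l * x l) d]
  · exact Kmat_mulVec hr x i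
  · intro l hl
    rw [Kmat_apply hr, if_neg, zero_mul]
    rintro rfl
    exact hl (by simp [hd])

theorem sum_block_Kmat_right (x : Idx N r → ℂ) (i : Idx N r) (d : ZMod N)
    (hd : d = (m : ZMod N) - i.1) :
    ∑ b : Fin (r d), x ⟨d, b⟩ * Kmat N r m ⟨d, b⟩ i = x (flip hr i) := by
  rw [← sum_block_Kmat_left hr x i d hd]
  refine Finset.sum_congr rfl fun b _ => ?_
  rw [mul_comm, ← Kmat_transpose hr, transpose_apply, Kmat_transpose hr]

theorem pairing_eq (x y : Idx N r → ℂ) (c : ZMod N) :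
    pairing N r m x y c = ∑ a : Fin (r c), x (flip hr ⟨c, a⟩) * y ⟨c, a⟩ := by
  rw [pairing, dotProduct_mulVec]
  simp only [dotProduct, vecMul, blk, vblk, submatrix_apply]
  refine Finset.sum_congr rfl fun a _ => ?_
  rw [sum_block_Kmat_right hr x ⟨c, a⟩ (m - c) rfl]

/-- `pairing` as a sum over all coordinates, restricted by an indicator. -/
theorem pairing_eq_ite (x y : Idx N r → ℂ) (c : ZMod N) :
    pairing N r m x y c = ∑ i : Idx N r, if i.1 = c then x (flip hr i) * y i else 0 := by
  rw [pairing_eq hr, sum_idx_block _ c (fun l hl => if_neg hl)]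
  simp

include hr in
theorem pairing_comm (x y : Idx N r → ℂ) (c : ZMod N) :
    pairing N r m x y (m - c) = pairing N r m y x c := by
  rw [pairing_eq_ite hr, pairing_eq_ite hr, ← sum_flip hr]
  refine Finset.sum_congr rfl fun i _ => ?_
  rw [flip_flip, flip_fst, mul_comm]
  have : ((m : ZMod N) - i.1 = m - c) ↔ i.1 = c := sub_right_inj
  simp only [this]

/-- A sum weighted by block numbers is a sum of pairings. -/
theorem sum_weight_pairing (w : ZMod N → ℂ) (x y : Idx N r → ℂ) :
    ∑ i : Idx N r, w i.1 * (x (flip hr i) * y i) = ∑ c, w c * pairing N r m x y c := by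
  rw [Fintype.sum_sigma]
  refine Finset.sum_congr rfl fun c _ => ?_
  rw [pairing_eq hr, Finset.mul_sum]

/-! ### The potential at one point -/

/-- The algebraic conditions on the value of a potential at one point: real, diagonal, and
orthogonal with respect to `K`. -/
structure IsPotential (N : ℕ) (r : ZMod N → ℕ) (m : ℤ) [NeZero N]
    (V : Matrix (Idx N r) (Idx N r) ℂ) : Prop where
  diag : V.IsDiag
  real : V.map conj = V
  orth : Vᵀ * Kmat N r m * V = Kmat N r m

variable {V : Matrix (Idx N r) (Idx N r) ℂ}

theorem IsPotential.conj_apply (hV : IsPotential N r m V) (i k : Idx N r) :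
    conj (V i k) = V i k := congrFun (congrFun hV.real i) k

theorem IsPotential.eq_diagonal (hV : IsPotential N r m V) : V = diagonal fun i => V i i := by
  ext i k
  by_cases h : i = k
  · subst h; simp
  · rw [diagonal_apply_ne _ h, hV.diag h]

/-- On diagonal matrices the condition `Vᵀ K V = K` says `v_i v_{κ i} = 1`. -/
theorem IsPotential.mul_flip (hV : IsPotential N r m V) (i : Idx N r) :
    V i i * V (flip hr i) (flip hr i) = 1 := by
  have h := congrFun (congrFun hV.orth i) (flip hr i)
  rw [hV.eq_diagonal, diagonal_transpose, mul_diagonal, diagonal_mul, Kmat_apply hr,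
    if_pos rfl] at h
  simpa using h

include hr in
theorem IsPotential.apply_ne_zero (hV : IsPotential N r m V) (i : Idx N r) : V i i ≠ 0 :=
  left_ne_zero_of_mul_eq_one (hV.mul_flip hr i)

theorem IsPotential.inv_eq (hV : IsPotential N r m V) :
    V⁻¹ = diagonal fun i => V (flip hr i) (flip hr i) := by
  refine inv_eq_left_inv ?_
  conv_lhs => rw [hV.eq_diagonal]
  rw [diagonal_mul_diagonal, ← diagonal_one]
  congr 1
  ext i
  simpa [mul_comm] using hV.mul_flip hr i

theorem IsPotential.blk_inv (hV : IsPotential N r m V) (c : ZMod N) :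
    (blk V c c)⁻¹ = diagonal fun a => V (flip hr ⟨c, a⟩) (flip hr ⟨c, a⟩) := by
  refine inv_eq_left_inv ?_
  have : blk V c c = diagonal fun a => V ⟨c, a⟩ ⟨c, a⟩ := by
    ext a b
    by_cases h : a = b
    · subst h; simp [blk]
    · rw [diagonal_apply_ne _ h]
      exact hV.diag (fun h2 => h (by simpa using h2))
  rw [this, diagonal_mul_diagonal, ← diagonal_one]
  congr 1
  ext i
  simpa [mul_comm] using hV.mul_flip hr ⟨c, i⟩

theorem hermNorm_eq (hV : IsPotential N r m V) (h : Idx N r → ℂ) (c : ZMod N) :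
    hermNorm V h c = ∑ a : Fin (r c),
      conj (h ⟨c, a⟩) * V (flip hr ⟨c, a⟩) (flip hr ⟨c, a⟩) * h ⟨c, a⟩ := by
  simp [hermNorm, hV.blk_inv hr, dotProduct, mulVec_diagonal, vblk, mul_assoc]

theorem sum_weight_hermNorm (hV : IsPotential N r m V) (w : ZMod N → ℂ) (h : Idx N r → ℂ) :
    ∑ i : Idx N r, w i.1 * (conj (h i) * V (flip hr i) (flip hr i) * h i) =
      ∑ c, w c * hermNorm V h c := by
  rw [Fintype.sum_sigma]
  refine Finset.sum_congr rfl fun c _ => ?_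
  rw [hermNorm_eq hr hV, Finset.mul_sum]

end

/-! ### Recursions of the coefficients -/

section

variable {N : ℕ} [NeZero N] {r : ZMod N → ℕ} {m : ℤ}

theorem sgn_add (hN : Even N) (x y : ZMod N) :
    (-1 : ℂ) ^ (x + y).val = (-1) ^ x.val * (-1) ^ y.val := by
  rw [ZMod.val_add, ← pow_add, neg_one_pow_eq_pow_mod_two,
    Nat.mod_mod_of_dvd _ (even_iff_two_dvd.1 hN), ← neg_one_pow_eq_pow_mod_two]

omit [NeZero N] in
theorem sgn_sq (x : ZMod N) : (-1 : ℂ) ^ x.val * (-1) ^ x.val = 1 := by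
  rw [← mul_pow]; simp

theorem sgn_neg (hN : Even N) (x : ZMod N) : (-1 : ℂ) ^ (-x).val = (-1) ^ x.val := by
  have h := sgn_add hN x (-x)
  simp only [add_neg_cancel, ZMod.val_zero, pow_zero] at h
  have h2 := sgn_sq x
  linear_combination -(-1) ^ x.val * h - (-1 : ℂ) ^ (-x).val * h2

theorem sgn_one (hN : Even N) : (-1 : ℂ) ^ (1 : ZMod N).val = -1 := by
  have : Fact (1 < N) := ⟨by
    rcases hN with ⟨k, hk⟩
    have := NeZero.ne N
    omega⟩
  rw [ZMod.val_one, pow_one]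

theorem sgn_intCast (hN : Even N) (k : ℤ) : (-1 : ℂ) ^ (k : ZMod N).val = (-1) ^ k := by
  rw [← zpow_natCast, ZMod.val_intCast]
  have h2 : (2 : ℤ) ∣ N := by exact_mod_cast even_iff_two_dvd.1 hN
  rcases Int.even_or_odd k with h | h
  · rw [h.neg_one_zpow, Even.neg_one_zpow]
    rw [Int.even_iff] at *
    rwa [Int.emod_emod_of_dvd _ h2]
  · rw [h.neg_one_zpow, Odd.neg_one_zpow]
    rw [Int.odd_iff] at *
    rwa [Int.emod_emod_of_dvd _ h2]

theorem ec_half (hN : Even N) (x : ZMod N) : ec (((N / 2 : ℕ) : ZMod N) * x) = (-1) ^ x.val := by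
  have h1 : ec ((N / 2 : ℕ) : ZMod N) = -1 := by
    have h := ZMod.stdAddChar_coe (N := N) ((N / 2 : ℕ) : ℤ)
    obtain ⟨k, hk⟩ := hN
    have hk2 : N / 2 = k := by omega
    have hk0 : (k : ℂ) ≠ 0 := by
      have := NeZero.ne N
      exact_mod_cast (show k ≠ 0 by omega)
    rw [hk2] at h ⊢
    have h3 : 2 * (Real.pi : ℂ) * Complex.I * ((k : ℕ) : ℤ) / N = Real.pi * Complex.I := by
      rw [hk]; push_cast; field_simp; ring
    rw [h3, Complex.exp_pi_mul_I] at h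
    simpa [ec] using h
  have h2 : ((N / 2 : ℕ) : ZMod N) * x = ((x.val : ℕ) : ZMod N) * ((N / 2 : ℕ) : ZMod N) := by
    rw [ZMod.natCast_zmod_val, mul_comm]
  rw [h2, ec_mul_nat, h1]

theorem Om_eq : Om N r = diagonal fun i : Idx N r => ec (1 - i.1) := by
  unfold Om
  congr 1
  ext i
  rw [omega_zpow]
  simp

theorem Om_pow (k : ℕ) : Om N r ^ k = diagonal fun i : Idx N r => ec ((k : ZMod N) * (1 - i.1)) :=
    by
  rw [Om_eq, diagonal_pow]
  congr 1
  ext i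
  rw [Pi.pow_apply, ec_mul_nat]

variable (hr : ∀ j, r j = 1 ∨ (r j = 2 ∧ 2 * j = (m : ZMod N)))

include hr in
theorem dot_Kmat_Om_pow (x y : Idx N r → ℂ) (k : ℕ) :
    x ⬝ᵥ ((Kmat N r m * Om N r ^ k) *ᵥ y) =
      ∑ c, ec ((k : ZMod N) * (1 - c)) * pairing N r m x y c := by
  rw [← mulVec_mulVec, dot_Kmat hr, ← sum_weight_pairing hr, Om_pow]
  refine Finset.sum_congr rfl fun i _ => ?_
  rw [mulVec_diagonal]
  ring

include hr in
/-- The alternating sum of the pairings is the constraint form up to sign. -/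
theorem dot_half (hN : Even N) (x y : Idx N r → ℂ) :
    x ⬝ᵥ ((Kmat N r m * Om N r ^ (N / 2)) *ᵥ y) =
      -∑ c : ZMod N, (-1) ^ c.val * pairing N r m x y c := by
  rw [dot_Kmat_Om_pow hr, ← Finset.sum_neg_distrib]
  refine Finset.sum_congr rfl fun c _ => ?_
  rw [ec_half hN, sub_eq_add_neg, sgn_add hN, sgn_one hN, sgn_neg hN]
  ring

include hr in
/-- The alternating sum of pairings is symmetric for even `m` and antisymmetric for odd `m`. -/
theorem alternating_symm (hN : Even N) (x y : Idx N r → ℂ) :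
    ∑ c : ZMod N, (-1) ^ c.val * pairing N r m x y c =
      (-1) ^ m * ∑ c : ZMod N, (-1) ^ c.val * pairing N r m y x c := by
  rw [← sum_reflect _ (m : ZMod N), Finset.mul_sum]
  refine Finset.sum_congr rfl fun c _ => ?_
  rw [pairing_comm hr, sub_eq_add_neg, sgn_add hN, sgn_neg hN, sgn_intCast hN]
  ring

include hr in
/-- For even `m` this is the constraint, for odd `m` it follows from antisymmetry. -/
theorem alternating_eq_zero (hN : Even N) (h : Idx N r → ℂ)
    (hc : Even m → constraintForm N r m h = 0) :
    ∑ c : ZMod N, (-1) ^ c.val * pairing N r m h h c = 0 := by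
  rcases Int.even_or_odd m with hm | hm
  · have := hc hm
    rw [constraintForm, dot_half hr hN] at this
    simpa using this
  · have := alternating_symm hr hN h h
    rw [hm.neg_one_zpow] at this
    linear_combination this / 2

variable (μ : ℂ) (h h' : Idx N r → ℂ) (V : Matrix (Idx N r) (Idx N r) ℂ)

include hr in
/-- In the sum of two consecutive values of `α` the terms cancel, except for the one where the
remainder modulo `N` jumps from `N - 1` to `0`; for even `N` an alternating sum of pairings is
left over, which vanishes. -/
theorem alpha_add_one (hc : Even N → Even m → constraintForm N r m h = 0) (a : ZMod N) :
    alpha N r m μ h h' (a + 1) + alpha N r m μ h h' a = pairing N r m h h (1 - a) := by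
  unfold alpha
  have hwrap : ∀ c : ZMod N, (a + c - 2 = -1) ↔ c = 1 - a := fun c =>
    ⟨fun h => by linear_combination h, fun h => by linear_combination h⟩
  by_cases hN : Odd N
  · rw [if_pos hN, if_pos hN, ← mul_add, ← Finset.sum_add_distrib,
      Finset.sum_eq_single (1 - a)]
    · have e1 : a + 1 + (1 - a) - 2 = (0 : ZMod N) := by ring
      have e2 : a + (1 - a) - 2 = (-1 : ZMod N) := by ring
      have e3 : (-1 : ZMod N).val = N - 1 := by
        have := val_reflect (N := N) 0
        simpa using this
      have e4 : Even (N - 1) := by rcases hN with ⟨k, hk⟩; exact ⟨k, by omega⟩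
      rw [e1, e2, e3, e4.neg_one_pow]
      simp only [ZMod.val_zero, pow_zero]
      ring
    · intro c _ hc
      have e1 : a + 1 + c - 2 = (a + c - 2) + 1 := by ring
      rw [e1, val_succ, if_neg (fun h => hc ((hwrap c).1 h)), pow_succ]
      ring
    · simp
  · have hN' : Even N := Nat.not_odd_iff_even.1 hN
    have hN0 : (N : ℂ) ≠ 0 := by exact_mod_cast NeZero.ne N
    rw [if_neg hN, if_neg hN, ← mul_add, ← Finset.sum_add_distrib]
    have key : ∀ c : ZMod N, (-1 : ℂ) ^ (a + 1 + c - 1).val *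
          (((a + 1 + c - 2).val : ℂ) * pairing N r m h h c -
            (if Odd m then 1 else 0) * μ * pairing N r m h' h c) +
        (-1 : ℂ) ^ (a + c - 1).val * (((a + c - 2).val : ℂ) * pairing N r m h h c -
            (if Odd m then 1 else 0) * μ * pairing N r m h' h c) =
        (-1) ^ a.val * ((-1) ^ c.val * pairing N r m h h c) +
          if c = 1 - a then N * pairing N r m h h c else 0 := by
      intro c
      have e1 : a + 1 + c - 2 = (a + c - 2) + 1 := by ring
      have e2 : a + 1 + c - 1 = a + c := by ring
      have e3 : (-1 : ℂ) ^ (a + c - 1).val = -((-1) ^ a.val * (-1) ^ c.val) := by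
        rw [sub_eq_add_neg, sgn_add hN', sgn_neg hN', sgn_one hN', sgn_add hN']; ring
      rw [e3, e2, e1, val_succ, sgn_add hN']
      by_cases hc : c = 1 - a
      · have h1 := (hwrap c).2 hc
        have h2 : (-1 : ZMod N).val = N - 1 := by
          simpa using val_reflect (N := N) 0
        have h3 : (-1 : ℂ) ^ a.val * (-1) ^ c.val = -1 := by
          rw [← sgn_add hN', hc]
          have : a + (1 - a) = 1 := by ring
          rw [this, sgn_one hN']
        rw [if_pos h1, if_pos hc, h1, h2, Nat.cast_sub (NeZero.one_le)]
        push_cast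
        linear_combination (-N * pairing N r m h h c) * h3
      · rw [if_neg (fun h => hc ((hwrap c).1 h)), if_neg hc]
        push_cast
        ring
    rw [Finset.sum_congr rfl fun c _ => key c, Finset.sum_add_distrib, ← Finset.mul_sum,
      alternating_eq_zero hr hN' h (hc hN')]
    simp [hN0]

include hr in
/-- The substitution `c ↦ m - c` in the sum defining `α`: it exchanges the factors of the pairings
and reflects the remainders, `{-1 - x} = N - 1 - {x}`. -/
theorem alpha_reflect (hc : Even N → Even m → constraintForm N r m h = 0) (a : ZMod N) :
    alpha N r m μ h h' (3 - a - m) = alpha N r m μ h h' a := by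
  unfold alpha
  have hv : ∀ c : ZMod N, (3 - a - m + (m - c) - 2 : ZMod N).val + (a + c - 2).val = N - 1 := by
    intro c
    have e : (3 - a - m + (m - c) - 2 : ZMod N) = -1 - (a + c - 2) := by ring
    rw [e, add_comm, val_reflect]
  by_cases hN : Odd N
  · rw [if_pos hN, if_pos hN, ← sum_reflect _ (m : ZMod N)]
    congr 1
    refine Finset.sum_congr rfl fun c _ => ?_
    rw [pairing_comm hr]
    have e4 : Even (N - 1) := by rcases hN with ⟨k, hk⟩; exact ⟨k, by omega⟩
    have e5 : (-1 : ℂ) ^ (3 - a - m + (m - c) - 2 : ZMod N).val * (-1) ^ (a + c - 2).val = 1 := by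
      rw [← pow_add, hv, e4.neg_one_pow]
    linear_combination pairing N r m h h c * ((-1) ^ (a + c - 2).val * e5 -
      (-1 : ℂ) ^ (3 - a - m + (m - c) - 2 : ZMod N).val * sgn_sq (a + c - 2))
  · have hN' : Even N := Nat.not_odd_iff_even.1 hN
    have hN0 : (N : ℂ) ≠ 0 := by exact_mod_cast NeZero.ne N
    rw [if_neg hN, if_neg hN]
    congr 1
    have sg : ∀ c : ZMod N, (-1 : ℂ) ^ (3 - a - m + c - 1 : ZMod N).val =
        (-1) ^ m * ((-1) ^ a.val * (-1) ^ c.val) := by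
      intro c
      have : (3 - a - m + c - 1 : ZMod N) = 1 + 1 + (-a + (-m + c)) := by ring
      rw [this, sgn_add hN', sgn_add hN', sgn_add hN', sgn_add hN', sgn_neg hN', sgn_neg hN',
        sgn_one hN', sgn_intCast hN']
      ring
    have sg2 : ∀ c : ZMod N, (-1 : ℂ) ^ (a + c - 1 : ZMod N).val =
        -((-1) ^ a.val * (-1) ^ c.val) := by
      intro c
      rw [sub_eq_add_neg, sgn_add hN', sgn_neg hN', sgn_one hN', sgn_add hN']; ring
    have h0 := alternating_eq_zero hr hN' h (hc hN')
    -- the part with `h` is reflected by `c ↦ m - c`, the part with `h'` occurs for odd `m` only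
    have hs1 : ∑ c : ZMod N, (-1 : ℂ) ^ (3 - a - m + c - 1 : ZMod N).val *
        (((3 - a - m + c - 2 : ZMod N).val : ℂ) * pairing N r m h h c) =
        ∑ c : ZMod N, (-1 : ℂ) ^ (a + c - 1).val * (((a + c - 2).val : ℂ) * pairing N r m h h c) :=
            by
      have : ∑ c : ZMod N, (-1 : ℂ) ^ (3 - a - m + c - 1 : ZMod N).val *
          (((3 - a - m + c - 2 : ZMod N).val : ℂ) * pairing N r m h h c) =
          ∑ c : ZMod N, ((-1 : ℂ) ^ (a + c - 1).val *
            (((a + c - 2).val : ℂ) * pairing N r m h h c) +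
            (N - 1) * (-1) ^ a.val * ((-1) ^ c.val * pairing N r m h h c)) := by
        rw [← sum_reflect _ (m : ZMod N)]
        refine Finset.sum_congr rfl fun c _ => ?_
        have e6 : ((3 - a - m + (m - c) - 2 : ZMod N).val : ℂ) = N - 1 - (a + c - 2).val := by
          have := hv c
          have h1 : ((3 - a - m + (m - c) - 2 : ZMod N).val : ℂ) + ((a + c - 2).val : ℂ) =
              ((N - 1 : ℕ) : ℂ) := by rw [← this]; push_cast; ring
          rw [Nat.cast_sub NeZero.one_le] at h1
          push_cast at h1
          linear_combination h1
        have e7 : (-1 : ℂ) ^ (3 - a - m + (m - c) - 1 : ZMod N).val = (-1) ^ a.val * (-1) ^ c.val :=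
            by
          have : (3 - a - m + (m - c) - 1 : ZMod N) = 1 + 1 + (-a + -c) := by ring
          rw [this, sgn_add hN', sgn_add hN', sgn_add hN', sgn_neg hN', sgn_neg hN', sgn_one hN']
          ring
        rw [pairing_comm hr, e6, e7, sg2]
        ring
      rw [this, Finset.sum_add_distrib, ← Finset.mul_sum, h0]
      simp
    simp only [mul_sub, Finset.sum_sub_distrib]
    rw [hs1]
    congr 1
    refine Finset.sum_congr rfl fun c _ => ?_
    rcases Int.even_or_odd m with hm | hm
    · simp [Int.not_odd_iff_even.2 hm]
    · rw [sg, sg2, hm.neg_one_zpow]; ring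

include hr in
/-- The Fourier coefficient of `α` at frequency `N / 2`, for even `N`. The recursion
`alpha_add_one` leaves this coefficient undetermined; it is where `h'` enters, and only for odd
`m`. -/
theorem alternating_alpha (hN : Even N) (hc : Even N → Even m → constraintForm N r m h = 0) :
    ∑ a : ZMod N, (-1) ^ a.val * alpha N r m μ h h' a =
      (if Odd m then 1 else 0) * μ * ∑ c : ZMod N, (-1) ^ c.val * pairing N r m h' h c := by
  have hN0 : (N : ℂ) ≠ 0 := by exact_mod_cast NeZero.ne N
  have h0 := alternating_eq_zero hr hN h (hc hN)
  unfold alpha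
  simp only [if_neg (Nat.not_odd_iff_even.2 hN)]
  have e1 : ∀ a : ZMod N, (-1 : ℂ) ^ a.val * (1 / (N : ℂ) * ∑ c : ZMod N, (-1) ^ (a + c - 1).val *
      (((a + c - 2).val : ℂ) * pairing N r m h h c -
        (if Odd m then 1 else 0) * μ * pairing N r m h' h c)) =
      ∑ c : ZMod N, (-(1 / (N : ℂ)) * (((a + (c - 2)).val : ℂ) *
        ((-1) ^ c.val * pairing N r m h h c)) +
        1 / N * ((if Odd m then 1 else 0) * μ * ((-1) ^ c.val * pairing N r m h' h c))) := by
    intro a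
    rw [Finset.mul_sum, Finset.mul_sum]
    refine Finset.sum_congr rfl fun c _ => ?_
    have e3 : (-1 : ℂ) ^ (a + c - 1).val = -((-1) ^ a.val * (-1) ^ c.val) := by
      rw [sub_eq_add_neg, sgn_add hN, sgn_neg hN, sgn_one hN, sgn_add hN]; ring
    rw [e3, add_sub_assoc]
    linear_combination (-(1 / (N : ℂ)) * (-1) ^ c.val *
        (((a + (c - 2)).val : ℂ) * pairing N r m h h c -
        (if Odd m then 1 else 0) * μ * pairing N r m h' h c)) * sgn_sq a
  rw [Finset.sum_congr rfl fun a _ => e1 a, Finset.sum_comm]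
  have e2 : ∀ c : ZMod N, ∑ a : ZMod N, (-(1 / (N : ℂ)) * (((a + (c - 2)).val : ℂ) *
        ((-1) ^ c.val * pairing N r m h h c)) +
        1 / N * ((if Odd m then 1 else 0) * μ * ((-1) ^ c.val * pairing N r m h' h c))) =
      (-(1 / (N : ℂ)) * ∑ a : ZMod N, (a.val : ℂ)) * ((-1) ^ c.val * pairing N r m h h c) +
        (if Odd m then 1 else 0) * μ * ((-1) ^ c.val * pairing N r m h' h c) := by
    intro c
    rw [Finset.sum_add_distrib, ← Finset.mul_sum, ← Finset.sum_mul,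
      sum_shift (fun a : ZMod N => (a.val : ℂ))]
    simp only [Finset.sum_const, Finset.card_univ, ZMod.card, nsmul_eq_mul]
    field_simp
  rw [Finset.sum_congr rfl fun c _ => e2 c, Finset.sum_add_distrib, ← Finset.mul_sum,
    ← Finset.mul_sum, h0]
  simp

theorem beta_eq (a : ZMod N) :
    beta N r μ V h a = (‖μ‖ : ℂ) ^ 2 * gamma N r μ V h (1 - a) := by
  unfold beta gamma
  congr 1
  refine Finset.sum_congr rfl fun c _ => ?_
  have : 1 - a + c - 2 = c - a - 1 := by ring
  rw [this]

/-- The weights of `γ` are a geometric progression along the residues, with period `N` built in by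
the denominator; the term where the remainder jumps gives the inhomogeneity. -/
theorem gamma_add_one (hμ1 : ‖μ‖ ≠ 1) (a : ZMod N) :
    gamma N r μ V h (a + 1) = -(‖μ‖ : ℂ) ^ 2 * gamma N r μ V h a + hermNorm V h (1 - a) := by
  have hD : (1 - (-1) ^ N * (‖μ‖ : ℂ) ^ (2 * N)) ≠ 0 := by
    intro h0
    have h1 : (-1) ^ N * ‖μ‖ ^ (2 * N) = (1 : ℝ) := by
      have : (-1) ^ N * (‖μ‖ : ℂ) ^ (2 * N) = 1 := by linear_combination -h0
      exact_mod_cast this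
    have h2 : ‖μ‖ ^ (2 * N) = 1 := by
      have := congrArg abs h1
      simpa [abs_mul, abs_pow] using this
    exact hμ1 ((pow_eq_one_iff_of_nonneg (norm_nonneg _) (by simp [NeZero.ne N])).1 h2)
  have hq : (1 - (-1) ^ N * (‖μ‖ : ℂ) ^ (2 * N)) = 1 - (-(‖μ‖ : ℂ) ^ 2) ^ N := by
    rw [neg_pow ((‖μ‖ : ℂ) ^ 2), pow_mul]
  rw [hq] at hD
  unfold gamma
  rw [hq]
  generalize -(‖μ‖ : ℂ) ^ 2 = q at *
  have key : ∀ c : ZMod N, q ^ (a + 1 + c - 2).val / (1 - q ^ N) * hermNorm V h c =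
      q * (q ^ (a + c - 2).val / (1 - q ^ N) * hermNorm V h c) +
        if c = 1 - a then hermNorm V h c else 0 := by
    intro c
    have hwrap : (a + c - 2 = -1) ↔ c = 1 - a :=
      ⟨fun h => by linear_combination h, fun h => by linear_combination h⟩
    have e1 : a + 1 + c - 2 = (a + c - 2) + 1 := by ring
    rw [e1, val_succ]
    by_cases hc : c = 1 - a
    · rw [if_pos (hwrap.2 hc), if_pos hc, hwrap.2 hc]
      have h2 : (-1 : ZMod N).val = N - 1 := by simpa using val_reflect (N := N) 0
      have h3 : q * q ^ (N - 1) = q ^ N := by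
        rw [← pow_succ', Nat.sub_add_cancel NeZero.one_le]
      rw [h2]
      field_simp
      linear_combination -hermNorm V h c * h3
    · rw [if_neg (fun h => hc (hwrap.1 h)), if_neg hc, pow_succ]
      ring
  rw [Finset.sum_congr rfl fun c _ => key c, Finset.sum_add_distrib, ← Finset.mul_sum]
  simp

end

/-! ### The blocks `f_j` -/

section

variable {N : ℕ} [NeZero N] {r : ZMod N → ℕ} {m : ℤ}
variable (hr : ∀ j, r j = 1 ∨ (r j = 2 ∧ 2 * j = (m : ZMod N)))
variable (μ : ℂ) (h h' : Idx N r → ℂ) {V : Matrix (Idx N r) (Idx N r) ℂ}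

theorem norm_sq_eq (z : ℂ) : (‖z‖ : ℂ) ^ 2 = conj z * z := (Complex.conj_mul' z).symm

theorem Delta_eq (k : ZMod N) : Delta N r m μ V h h' k =
    conj (alpha N r m μ h h' (k - m)) * alpha N r m μ h h' (k - m) -
      beta N r μ V h (k - 2) * gamma N r μ V h (k - m) := by
  rw [Delta, norm_sq_eq]

include hr in
theorem Delta_reflect (hc : Even N → Even m → constraintForm N r m h = 0) (k : ZMod N) :
    Delta N r m μ V h h' (3 + m - k) = Delta N r m μ V h h' k := by
  rw [Delta, Delta, beta_eq, beta_eq]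
  have e1 : (3 + m - k - m : ZMod N) = 3 - (k - m) - m := by ring
  have e2 : (1 - (3 + m - k - 2) : ZMod N) = k - m := by ring
  have e3 : (1 - (k - 2) : ZMod N) = 3 - (k - m) - m := by ring
  rw [e1, alpha_reflect hr μ h h' hc, e2, e3]
  ring

theorem hermNorm_reflect (hV : IsPotential N r m V) (c : ZMod N) :
    hermNorm V h (m - c) = ∑ a : Fin (r c),
      conj (h (flip hr ⟨c, a⟩)) * V ⟨c, a⟩ ⟨c, a⟩ * h (flip hr ⟨c, a⟩) := by
  have e : ∀ d : ZMod N, hermNorm V h d = ∑ i : Idx N r, if i.1 = d then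
      conj (h i) * V (flip hr i) (flip hr i) * h i else 0 := by
    intro d
    rw [hermNorm_eq hr hV, sum_idx_block _ d (fun l hl => if_neg hl)]
    simp
  rw [e, ← sum_flip hr]
  simp only [flip_flip, flip_fst, sub_right_inj]
  rw [sum_idx_block _ c (fun l hl => if_neg hl)]
  simp

/-- The coordinates of `f_j` in terms of the involution `κ`. -/
theorem fBlock_apply (hV : IsPotential N r m V) (j : ZMod N) (a b : Fin (r j)) :
    fBlock N r m μ V h h' j a b = (if a = b then 1 else 0) -
      (Delta N r m μ V h h' (2 + m - j))⁻¹ *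
        (conj (alpha N r m μ h h' (2 - j)) * (h ⟨j, a⟩ * h (flip hr ⟨j, b⟩))
          + alpha N r m μ h h' (2 - j) *
            (V ⟨j, a⟩ ⟨j, a⟩ * conj (h (flip hr ⟨j, a⟩)) *
              (conj (h ⟨j, b⟩) * V (flip hr ⟨j, b⟩) (flip hr ⟨j, b⟩)))
          - beta N r μ V h (m - j) *
            (h ⟨j, a⟩ * (conj (h ⟨j, b⟩) * V (flip hr ⟨j, b⟩) (flip hr ⟨j, b⟩)))
          - gamma N r μ V h (2 - j) *
            (V ⟨j, a⟩ ⟨j, a⟩ * conj (h (flip hr ⟨j, a⟩)) * h (flip hr ⟨j, b⟩))) := by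
  have hu : ((blk (Kmat N r m) j (m - j) * (blk V (m - j) (m - j))⁻¹) *ᵥ
      (fun a => conj (vblk h (m - j) a))) a = V ⟨j, a⟩ ⟨j, a⟩ * conj (h (flip hr ⟨j, a⟩)) := by
    rw [hV.blk_inv hr, ← mulVec_mulVec]
    have := sum_block_Kmat_left hr
      (fun l => V (flip hr l) (flip hr l) * conj (h l)) ⟨j, a⟩ (m - j) rfl
    rw [flip_flip] at this
    rw [← this]
    simp only [mulVec, dotProduct, blk, submatrix_apply, vblk, diagonal_apply, ite_mul, zero_mul,
      Finset.sum_ite_eq, Finset.mem_univ, if_true]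
  have hw : (vblk h (m - j) ᵥ* blk (Kmat N r m) (m - j) j) b = h (flip hr ⟨j, b⟩) :=
    sum_block_Kmat_right hr h ⟨j, b⟩ (m - j) rfl
  have hs : ((fun a => conj (vblk h j a)) ᵥ* (blk V j j)⁻¹) b =
      conj (h ⟨j, b⟩) * V (flip hr ⟨j, b⟩) (flip hr ⟨j, b⟩) := by
    rw [hV.blk_inv hr, vecMul_diagonal]; rfl
  simp only [fBlock, Matrix.sub_apply, Matrix.smul_apply, Matrix.add_apply, vecMulVec_apply,
      smul_eq_mul, hu, hw, hs,
    one_apply]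
  rfl

include hr in
/-- By the recursions, numerator and denominator are expressed by the values `α_{2-j}`, `γ_{2-j}`,
`β_{m-j}` and the two coordinates `h_j`, `h_{m-j}`. -/
theorem fBlock_of_one (hV : IsPotential N r m V) (hμ1 : ‖μ‖ ≠ 1)
    (hc : Even N → Even m → constraintForm N r m h = 0) (j : ZMod N)
    (hΔ : Delta N r m μ V h h' (2 + m - j) ≠ 0) (hj : r j = 1) :
    fBlock N r m μ V h h' j =
      (Delta N r m μ V h h' (1 + m - j) / Delta N r m μ V h h' (2 + m - j)) • 1 := by
  have hsub : ∀ a b : Fin (r j), a = b := fun a b => by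
    apply Fin.ext; have := a.2; have := b.2; omega
  ext a b
  obtain rfl := hsub a b
  rw [fBlock_apply hr μ h h' hV, if_pos rfl, Matrix.smul_apply, one_apply_eq, smul_eq_mul, mul_one,
    div_eq_inv_mul]
  have hsum : ∀ F : Fin (r j) → ℂ, ∑ x, F x = F a := fun F =>
    Fintype.sum_eq_single a fun x hx => absurd (hsub x a) hx
  have hp : pairing N r m h h j = h (flip hr ⟨j, a⟩) * h ⟨j, a⟩ := by rw [pairing_eq hr, hsum]
  have hn := hermNorm_eq hr hV h j
  have hn' := hermNorm_reflect hr h hV j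
  rw [hsum] at hn hn'
  have ha := alpha_add_one hr μ h h' hc (1 - j)
  have hg := gamma_add_one μ h V hμ1 (1 - j)
  have hg' := gamma_add_one μ h V hμ1 (1 - (m - j))
  have hb := beta_eq μ h V (m - j)
  have hb' := beta_eq μ h V (m - j - 1)
  have e1 : (1 - (1 - j) : ZMod N) = j := by ring
  have e2 : (1 - j + 1 : ZMod N) = 2 - j := by ring
  have e3 : (1 - (1 - (m - j)) : ZMod N) = m - j := by ring
  have e4 : (1 - (m - j) + 1 : ZMod N) = 1 - (m - j - 1) := by ring
  rw [e1, e2, hp] at ha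
  rw [e1, e2, hn] at hg
  rw [e3, e4, hn'] at hg'
  have hD := Delta_eq (m := m) (V := V) μ h h' (2 + m - j)
  have hD' := Delta_eq (m := m) (V := V) μ h h' (1 + m - j)
  have e5 : (2 + m - j - m : ZMod N) = 2 - j := by ring
  have e6 : (2 + m - j - 2 : ZMod N) = m - j := by ring
  have e7 : (1 + m - j - m : ZMod N) = 1 - j := by ring
  have e8 : (1 + m - j - 2 : ZMod N) = m - j - 1 := by ring
  rw [e5, e6] at hD
  rw [e7, e8] at hD'
  have hac := congrArg conj ha
  simp only [map_add, map_mul] at hac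
  have hv := hV.mul_flip hr ⟨j, a⟩
  have h1 : (1 : ℂ) = (Delta N r m μ V h h' (2 + m - j))⁻¹ * Delta N r m μ V h h' (2 + m - j) :=
    (inv_mul_cancel₀ hΔ).symm
  conv_lhs => rw [h1, ← mul_sub]
  congr 1
  rw [hD, hD', hb', hg']
  clear hD hD' h1 hΔ hp hn hn' hb' hg'
  generalize alpha N r m μ h h' (1 - j) = A' at *
  generalize alpha N r m μ h h' (2 - j) = A at *
  generalize gamma N r μ V h (2 - j) = G at *
  generalize gamma N r μ V h (1 - j) = G' at *
  generalize gamma N r μ V h (1 - (m - j)) = B' at *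
  rw [hb]
  obtain rfl : A' = h (flip hr ⟨j, a⟩) * h ⟨j, a⟩ - A := by linear_combination ha
  obtain rfl := hg
  simp only [map_sub, map_mul]
  generalize V ⟨j, a⟩ ⟨j, a⟩ = v at *
  generalize V (flip hr ⟨j, a⟩) (flip hr ⟨j, a⟩) = w at *
  generalize conj (h (flip hr ⟨j, a⟩)) = x' at *
  generalize conj (h ⟨j, a⟩) = y' at *
  generalize h (flip hr ⟨j, a⟩) = x at *
  generalize h ⟨j, a⟩ = y at *
  linear_combination (x * x' * y * y' - A * x' * y') * hv

theorem flip_two (j : ZMod N) (h2 : r j = 2) (a b : Fin (r j)) (hab : a ≠ b) :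
    flip hr ⟨j, a⟩ = ⟨j, b⟩ := by
  have hj : 2 * j = (m : ZMod N) := by
    rcases hr j with h1 | ⟨_, h1⟩
    · omega
    · exact h1
  have h1 := Kmat_apply hr ⟨j, a⟩ ⟨j, b⟩
  have e1 : j + j = (m : ZMod N) := by rw [← hj]; ring
  have e2 : a.val ≠ b.val := fun h => hab (Fin.ext h)
  by_contra hne
  rw [if_neg (Ne.symm hne)] at h1
  simp [Kmat, e1, h2, e2] at h1

include hr in
/-- For `r_j = 2` one has `2 j ≡ m`, so that the recursion and the reflection of `α` determine
`α_{2-j}`, the ones of `β` and `γ` determine `β_{m-j} + γ_{2-j}`, and `Δ_{2+m-j}` factors. -/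
theorem block_two_data (hV : IsPotential N r m V) (hμ1 : ‖μ‖ ≠ 1)
    (hc : Even N → Even m → constraintForm N r m h = 0) (j : ZMod N) (h2 : r j = 2)
    (a b : Fin (r j)) (hab : a ≠ b) :
    V ⟨j, a⟩ ⟨j, a⟩ * V ⟨j, b⟩ ⟨j, b⟩ = 1 ∧
    alpha N r m μ h h' (2 - j) = h ⟨j, a⟩ * h ⟨j, b⟩ ∧
    beta N r μ V h (m - j) = conj (h ⟨j, a⟩) * V ⟨j, b⟩ ⟨j, b⟩ * h ⟨j, a⟩ +
      conj (h ⟨j, b⟩) * V ⟨j, a⟩ ⟨j, a⟩ * h ⟨j, b⟩ - gamma N r μ V h (2 - j) ∧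
    Delta N r m μ V h h' (2 + m - j) =
      (conj (h ⟨j, a⟩) * V ⟨j, b⟩ ⟨j, b⟩ * h ⟨j, a⟩ - gamma N r μ V h (2 - j)) *
      (conj (h ⟨j, b⟩) * V ⟨j, a⟩ ⟨j, a⟩ * h ⟨j, b⟩ - gamma N r μ V h (2 - j)) := by
  have hj : 2 * j = (m : ZMod N) := by
    rcases hr j with h1 | ⟨_, h1⟩
    · omega
    · exact h1
  have fa := flip_two hr j h2 a b hab
  have fb := flip_two hr j h2 b a hab.symm
  have hsum : ∀ F : Fin (r j) → ℂ, ∑ x, F x = F a + F b := by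
    intro F
    refine Fintype.sum_eq_add a b hab fun x hx => absurd ?_ hx.2
    have := a.2; have := b.2; have := x.2
    have h3 := hx.1
    rw [ne_eq, Fin.ext_iff] at hab h3
    apply Fin.ext; omega
  have hv := hV.mul_flip hr ⟨j, a⟩
  rw [fa] at hv
  have hp := pairing_eq hr h h j
  have hn := hermNorm_eq hr hV h j
  rw [hsum, fa, fb] at hp hn
  have ha := alpha_add_one hr μ h h' hc (1 - j)
  have ha' := alpha_reflect hr μ h h' hc (2 - j)
  have hg := gamma_add_one μ h V hμ1 (1 - j)
  have hb := beta_eq μ h V (m - j)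
  have e1 : (1 - (1 - j) : ZMod N) = j := by ring
  have e2 : (1 - j + 1 : ZMod N) = 2 - j := by ring
  have e3 : (3 - (2 - j) - m : ZMod N) = 1 - j := by rw [← hj]; ring
  have e4 : (1 - (m - j) : ZMod N) = 1 - j := by rw [← hj]; ring
  rw [e1, e2, hp] at ha
  rw [e3] at ha'
  rw [e1, e2, hn] at hg
  rw [e4] at hb
  have hα : alpha N r m μ h h' (2 - j) = h ⟨j, a⟩ * h ⟨j, b⟩ := by
    rw [ha'] at ha; linear_combination ha / 2
  have hβ : beta N r μ V h (m - j) = conj (h ⟨j, a⟩) * V ⟨j, b⟩ ⟨j, b⟩ * h ⟨j, a⟩ +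
      conj (h ⟨j, b⟩) * V ⟨j, a⟩ ⟨j, a⟩ * h ⟨j, b⟩ - gamma N r μ V h (2 - j) := by
    linear_combination hb + hg
  refine ⟨hv, hα, hβ, ?_⟩
  have e5 : (2 + m - j - m : ZMod N) = 2 - j := by ring
  have e6 : (2 + m - j - 2 : ZMod N) = m - j := by ring
  rw [Delta_eq, e5, e6, hα, hβ, map_mul]
  linear_combination -(conj (h ⟨j, a⟩) * h ⟨j, a⟩ * conj (h ⟨j, b⟩) * h ⟨j, b⟩) * hv

include hr in
theorem fBlock_two_diag (hV : IsPotential N r m V) (hμ1 : ‖μ‖ ≠ 1)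
    (hc : Even N → Even m → constraintForm N r m h = 0) (j : ZMod N) (h2 : r j = 2)
    (hΔ : Delta N r m μ V h h' (2 + m - j) ≠ 0) (a b : Fin (r j)) (hab : a ≠ b) :
    fBlock N r m μ V h h' j a a =
      (conj (h ⟨j, a⟩) * V ⟨j, b⟩ ⟨j, b⟩ * h ⟨j, a⟩ - gamma N r μ V h (2 - j)) /
      (conj (h ⟨j, b⟩) * V ⟨j, a⟩ ⟨j, a⟩ * h ⟨j, b⟩ - gamma N r μ V h (2 - j)) := by
  obtain ⟨hv, hα, hβ, hD⟩ := block_two_data hr μ h h' hV hμ1 hc j h2 a b hab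
  rw [fBlock_apply hr μ h h' hV, if_pos rfl, flip_two hr j h2 a b hab, hα, hβ]
  rw [hD] at hΔ ⊢
  have hX := left_ne_zero_of_mul hΔ
  have hY := right_ne_zero_of_mul hΔ
  rw [eq_div_iff hY, map_mul]
  generalize gamma N r μ V h (2 - j) = G at *
  generalize V ⟨j, a⟩ ⟨j, a⟩ = v at *
  generalize V ⟨j, b⟩ ⟨j, b⟩ = w at *
  generalize conj (h ⟨j, a⟩) = x' at *
  generalize conj (h ⟨j, b⟩) = y' at *
  generalize h ⟨j, a⟩ = x at *
  generalize h ⟨j, b⟩ = y at *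
  field_simp
  linear_combination (x * y * x' * y') * hv

include hr in
theorem fBlock_two_off (hV : IsPotential N r m V) (hμ1 : ‖μ‖ ≠ 1)
    (hc : Even N → Even m → constraintForm N r m h = 0) (j : ZMod N) (h2 : r j = 2)
    (a b : Fin (r j)) (hab : a ≠ b) :
    fBlock N r m μ V h h' j a b = 0 := by
  obtain ⟨hv, hα, hβ, hD⟩ := block_two_data hr μ h h' hV hμ1 hc j h2 a b hab
  rw [fBlock_apply hr μ h h' hV, if_neg hab, flip_two hr j h2 a b hab,
    flip_two hr j h2 b a hab.symm, hα, hβ, map_mul]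
  generalize gamma N r μ V h (2 - j) = G at *
  generalize V ⟨j, a⟩ ⟨j, a⟩ = v at *
  generalize V ⟨j, b⟩ ⟨j, b⟩ = w at *
  generalize conj (h ⟨j, a⟩) = x' at *
  generalize conj (h ⟨j, b⟩) = y' at *
  generalize h ⟨j, a⟩ = x at *
  generalize h ⟨j, b⟩ = y at *
  linear_combination (Delta N r m μ V h h' (2 + m - j))⁻¹ * x * y' * x' * x * hv

include hr in
/-- For blocks of size one, `2 j ≡ m` makes the two values of `Δ` in `f_j` equal by reflection. -/
theorem det_fBlock (hV : IsPotential N r m V) (hμ1 : ‖μ‖ ≠ 1)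
    (hc : Even N → Even m → constraintForm N r m h = 0) (j : ZMod N)
    (hΔ : Delta N r m μ V h h' (2 + m - j) ≠ 0) (hj : 2 * j = (m : ZMod N)) :
    (fBlock N r m μ V h h' j).det = 1 := by
  rcases hr j with h1 | ⟨h2, _⟩
  · rw [fBlock_of_one hr μ h h' hV hμ1 hc j hΔ h1]
    have e1 : (1 + m - j : ZMod N) = 3 + m - (2 + m - j) := by rw [← hj]; ring
    rw [e1, Delta_reflect hr μ h h' hc, div_self hΔ]
    simp
  · set a : Fin (r j) := Fin.cast h2.symm 0
    set b : Fin (r j) := Fin.cast h2.symm 1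
    have hab : a ≠ b := by simp [a, b, Fin.ext_iff]
    obtain ⟨hv, hα, hβ, hD⟩ := block_two_data hr μ h h' hV hμ1 hc j h2 a b hab
    rw [← det_submatrix_equiv_self (finCongr h2.symm), det_fin_two]
    simp only [submatrix_apply]
    have ea : (finCongr h2.symm) 0 = a := rfl
    have eb : (finCongr h2.symm) 1 = b := rfl
    rw [ea, eb, fBlock_two_off hr μ h h' hV hμ1 hc j h2 a b hab,
      fBlock_two_diag hr μ h h' hV hμ1 hc j h2 hΔ a b hab,
      fBlock_two_diag hr μ h h' hV hμ1 hc j h2 hΔ b a hab.symm]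
    rw [hD] at hΔ
    have hX := left_ne_zero_of_mul hΔ
    have hY := right_ne_zero_of_mul hΔ
    rw [zero_mul, sub_zero, div_mul_div_comm, mul_comm, div_self (mul_ne_zero hY hX)]

include hr in
theorem fBlock_isDiag (hV : IsPotential N r m V) (hμ1 : ‖μ‖ ≠ 1)
    (hc : Even N → Even m → constraintForm N r m h = 0) (j : ZMod N) :
    (fBlock N r m μ V h h' j).IsDiag := by
  intro a b hab
  rcases hr j with h1 | ⟨h2, _⟩
  · exfalso
    apply hab
    apply Fin.ext; have := a.2; have := b.2; omega
  · exact fBlock_two_off hr μ h h' hV hμ1 hc j h2 a b hab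

end

/-! ### Fourier transform of the matrix `Γ` -/

section

variable {N : ℕ} [NeZero N] {r : ZMod N → ℕ} {m : ℤ}

/-- Two copies of the discrete Fourier matrix, with columns permuted by `φ` and `ψ`. -/
noncomputable def fourier (φ ψ : Equiv.Perm (ZMod N)) :
    Matrix (Fin N ⊕ Fin N) (Fin 2 × ZMod N) ℂ
  | .inl j, (a, i) => if a = 0 then ec (((j : ℕ) : ZMod N) * φ i) else 0
  | .inr j, (a, i) => if a = 1 then ec (((j : ℕ) : ZMod N) * ψ i) else 0

/-- The inverse of `fourier φ ψ`. -/
noncomputable def fourierInv (φ ψ : Equiv.Perm (ZMod N)) :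
    Matrix (Fin 2 × ZMod N) (Fin N ⊕ Fin N) ℂ
  | (a, i), .inl j => if a = 0 then (N : ℂ)⁻¹ * ec (-((j : ℕ) : ZMod N) * φ i) else 0
  | (a, i), .inr j => if a = 1 then (N : ℂ)⁻¹ * ec (-((j : ℕ) : ZMod N) * ψ i) else 0

theorem sum_fin_two_prod (F : Fin 2 × ZMod N → ℂ) :
    ∑ x, F x = ∑ i, F (0, i) + ∑ i, F (1, i) := by
  rw [Fintype.sum_prod_type, Fin.sum_univ_two]

theorem fourier_orthogonal (φ : Equiv.Perm (ZMod N)) (j k : Fin N) :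
    ∑ i, ec (((j : ℕ) : ZMod N) * φ i) * ((N : ℂ)⁻¹ * ec (-((k : ℕ) : ZMod N) * φ i)) =
      if j = k then 1 else 0 := by
  have hN0 : (N : ℂ) ≠ 0 := by exact_mod_cast NeZero.ne N
  have h1 : ∀ i, ec (((j : ℕ) : ZMod N) * φ i) * ((N : ℂ)⁻¹ * ec (-((k : ℕ) : ZMod N) * φ i)) =
      (N : ℂ)⁻¹ * (fun x => ec (x * (((j : ℕ) : ZMod N) - ((k : ℕ) : ZMod N)))) (φ i) := by
    intro i
    have : φ i * (((j : ℕ) : ZMod N) - ((k : ℕ) : ZMod N)) =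
      ((j : ℕ) : ZMod N) * φ i + -((k : ℕ) : ZMod N) * φ i := by ring
    simp only [this, ec_add]
    ring
  rw [Finset.sum_congr rfl fun i _ => h1 i, ← Finset.mul_sum, Equiv.sum_comp φ fun x =>
      ec (x * (((j : ℕ) : ZMod N) - ((k : ℕ) : ZMod N))), sum_ec]
  by_cases hjk : j = k
  · simp [hjk, hN0]
  · rw [if_neg hjk, if_neg, mul_zero]
    intro h2
    rw [sub_eq_zero] at h2
    have h3 := congrArg ZMod.val h2
    rw [ZMod.val_natCast_of_lt j.2, ZMod.val_natCast_of_lt k.2] at h3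
    exact hjk (Fin.ext h3)

theorem fourier_mul_inv (φ ψ : Equiv.Perm (ZMod N)) : fourier φ ψ * fourierInv φ ψ = 1 := by
  ext s t
  rw [mul_apply, sum_fin_two_prod]
  rcases s with j | j <;> rcases t with k | k
  · simp [fourier, fourierInv, one_apply, ← fourier_orthogonal φ]
  · simp [fourier, fourierInv]
  · simp [fourier, fourierInv]
  · simp [fourier, fourierInv, one_apply, ← fourier_orthogonal ψ]

theorem fourierInv_mul (φ ψ : Equiv.Perm (ZMod N)) : fourierInv φ ψ * fourier φ ψ = 1 :=
  (mul_eq_one_comm_of_card_eq _ _ ℂ (by simp [ZMod.card]; ring)).1 (fourier_mul_inv φ ψ)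

variable (N m) in
/-- The Fourier matrix acting on the rows of `Γ`. The column `(a, i)` is supported in the group
`a`, with frequency `i - m` in the first group and `i - 2` in the second. -/
noncomputable def leftF : Matrix (Fin N ⊕ Fin N) (Fin 2 × ZMod N) ℂ :=
  fourier (Equiv.subRight (m : ZMod N)) (Equiv.subRight 2)

variable (N m) in
/-- The Fourier matrix acting on the columns of `Γ`, with frequency `1 - i` in the first group and
`m - 1 - i` in the second. -/
noncomputable def rightF : Matrix (Fin N ⊕ Fin N) (Fin 2 × ZMod N) ℂ :=
  fourier (Equiv.subLeft 1) (Equiv.subLeft ((m : ZMod N) - 1))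

variable (m) in
/-- The two by two blocks of the Fourier transform of `Γ`; the determinant of the block `i` is
`(conj μ / μ) Δ_{2+m-i}`. -/
noncomputable def gBlock (μ : ℂ) (V : Matrix (Idx N r) (Idx N r) ℂ) (h h' : Idx N r → ℂ)
    (i : ZMod N) : Matrix (Fin 2) (Fin 2) ℂ :=
  !![alpha N r m μ h h' (2 - i) / μ, beta N r μ V h (m - i) / μ;
    conj μ * gamma N r μ V h (2 - i), conj μ * conj (alpha N r m μ h h' (2 - i))]

variable (m) in
/-- The matrix `Γ`, given by its Fourier transform. In this form the entries where `μ_s + μ_t = 0`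
need no separate definition. -/
noncomputable def gammaMat (μ : ℂ) (V : Matrix (Idx N r) (Idx N r) ℂ) (h h' : Idx N r → ℂ) :
    Matrix (Fin N ⊕ Fin N) (Fin N ⊕ Fin N) ℂ :=
  leftF N m * blockDiagonal (gBlock m μ V h h') * (rightF N m)ᵀ

variable (μ : ℂ) (h h' : Idx N r → ℂ) {V : Matrix (Idx N r) (Idx N r) ℂ}

theorem blockDiagonal_sandwich {ι κ : Type*} (A : Matrix ι (Fin 2 × ZMod N) ℂ)
    (B : ZMod N → Matrix (Fin 2) (Fin 2) ℂ) (C : Matrix κ (Fin 2 × ZMod N) ℂ) (s : ι) (t : κ) :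
    (A * blockDiagonal B * Cᵀ) s t = ∑ i, (A s (0, i) * B i 0 0 * C t (0, i) +
      A s (0, i) * B i 0 1 * C t (1, i) + A s (1, i) * B i 1 0 * C t (0, i) +
      A s (1, i) * B i 1 1 * C t (1, i)) := by
  simp only [mul_apply, transpose_apply, sum_fin_two_prod, blockDiagonal_apply, mul_ite, mul_zero,
    Finset.sum_ite_eq', Finset.mem_univ, if_true]
  rw [← Finset.sum_add_distrib]
  refine Finset.sum_congr rfl fun i _ => ?_
  ring

theorem gammaMat_inl_inl (j k : Fin N) : gammaMat m μ V h h' (.inl j) (.inl k) =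
    ∑ c : ZMod N, ec (((j : ℕ) : ZMod N) * (c - (m : ZMod N)) + ((k : ℕ) : ZMod N) * (1 - c)) *
      (alpha N r m μ h h' (2 - c) / μ) := by
  rw [gammaMat, blockDiagonal_sandwich]
  refine Finset.sum_congr rfl fun c _ => ?_
  simp [leftF, rightF, fourier, gBlock, ec_add]
  ring

theorem gammaMat_inl_inr (j k : Fin N) : gammaMat m μ V h h' (.inl j) (.inr k) =
    ∑ c : ZMod N, ec (((j : ℕ) : ZMod N) * (c - (m : ZMod N)) + ((k : ℕ) : ZMod N) *
        ((m : ZMod N) - 1 - c)) *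
      (beta N r μ V h (m - c) / μ) := by
  rw [gammaMat, blockDiagonal_sandwich]
  refine Finset.sum_congr rfl fun c _ => ?_
  simp [leftF, rightF, fourier, gBlock, ec_add]
  ring

theorem gammaMat_inr_inl (j k : Fin N) : gammaMat m μ V h h' (.inr j) (.inl k) =
    ∑ c : ZMod N, ec (((j : ℕ) : ZMod N) * (c - 2) + ((k : ℕ) : ZMod N) * (1 - c)) *
      (conj μ * gamma N r μ V h (2 - c)) := by
  rw [gammaMat, blockDiagonal_sandwich]
  refine Finset.sum_congr rfl fun c _ => ?_
  simp [leftF, rightF, fourier, gBlock, ec_add]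
  ring

theorem gammaMat_inr_inr (j k : Fin N) : gammaMat m μ V h h' (.inr j) (.inr k) =
    ∑ c : ZMod N, ec (((j : ℕ) : ZMod N) * (c - 2) + ((k : ℕ) : ZMod N) * ((m : ZMod N) - 1 - c)) *
      (conj μ * conj (alpha N r m μ h h' (2 - c))) := by
  rw [gammaMat, blockDiagonal_sandwich]
  refine Finset.sum_congr rfl fun c _ => ?_
  simp [leftF, rightF, fourier, gBlock, ec_add]
  ring

variable (hr : ∀ j, r j = 1 ∨ (r j = 2 ∧ 2 * j = (m : ZMod N)))

include hr in
theorem gammaMat_symm (hμ0 : μ ≠ 0) (hc : Even N → Even m → constraintForm N r m h = 0)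
    (s t : Fin N ⊕ Fin N) : gammaMat m μ V h h' s t = gammaMat m μ V h h' t s := by
  have ha : ∀ c : ZMod N, alpha N r m μ h h' (2 - (m + 1 - c)) = alpha N r m μ h h' (2 - c) := by
    intro c
    rw [← alpha_reflect hr μ h h' hc (2 - c)]
    congr 1; ring
  have hb : ∀ c : ZMod N, conj μ * gamma N r μ V h (2 - (m + 1 - c)) =
      beta N r μ V h (m - c) / μ := by
    intro c
    rw [beta_eq, norm_sq_eq]
    have e : (2 - (m + 1 - c) : ZMod N) = 1 - (m - c) := by ring
    rw [e]; field_simp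
  have h12 : ∀ j k : Fin N, gammaMat m μ V h h' (.inl j) (.inr k) =
      gammaMat m μ V h h' (.inr k) (.inl j) := by
    intro j k
    rw [gammaMat_inl_inr, gammaMat_inr_inl]
    conv_rhs => rw [← sum_reflect _ ((m : ZMod N) + 1)]
    refine Finset.sum_congr rfl fun c _ => ?_
    rw [hb]
    congr 2; ring
  rcases s with j | j <;> rcases t with k | k
  · rw [gammaMat_inl_inl, gammaMat_inl_inl]
    conv_lhs => rw [← sum_reflect _ ((m : ZMod N) + 1)]
    refine Finset.sum_congr rfl fun c _ => ?_
    rw [ha]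
    congr 2; ring
  · exact h12 j k
  · exact (h12 k j).symm
  · rw [gammaMat_inr_inr, gammaMat_inr_inr]
    conv_lhs => rw [← sum_reflect _ ((m : ZMod N) + 1)]
    refine Finset.sum_congr rfl fun c _ => ?_
    rw [ha]
    congr 2; ring

include hr in
/-- The second group of spectral parameters is the image of the first one under the antilinear
symmetry `lam ↦ 1 / conj lam` of the Lax pair. -/
theorem gammaMat_inr_inr_eq_conj (hμ0 : μ ≠ 0)
    (hc : Even N → Even m → constraintForm N r m h = 0) (j k : Fin N) :
    gammaMat m μ V h h' (.inr j) (.inr k) =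
      conj μ ^ 2 * ec (-((j : ℕ) : ZMod N) - ((k : ℕ) : ZMod N)) *
        conj (gammaMat m μ V h h' (.inl j) (.inl k)) := by
  have hμc : conj μ ≠ 0 := by simpa using hμ0
  rw [gammaMat_symm μ h h' hr hμ0 hc, gammaMat_inr_inr, gammaMat_inl_inl, map_sum, Finset.mul_sum]
  refine Finset.sum_congr rfl fun c _ => ?_
  have e : ((k : ℕ) : ZMod N) * (c - 2) + ((j : ℕ) : ZMod N) * ((m : ZMod N) - 1 - c) =
    (-((j : ℕ) : ZMod N) - ((k : ℕ) : ZMod N)) +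
      -(((j : ℕ) : ZMod N) * (c - (m : ZMod N)) + ((k : ℕ) : ZMod N) * (1 - c)) := by ring
  rw [e, ec_add, map_mul, conj_ec, map_div₀]
  field_simp

theorem spec_inl (j : Fin N) : spec N μ (.inl j) = ec ((j : ℕ) : ZMod N) * μ := by
  rw [spec, omega_pow]

theorem spec_inr (j : Fin N) : spec N μ (.inr j) = ec ((j : ℕ) : ZMod N) * (conj μ)⁻¹ := by
  rw [spec, omega_pow]

theorem orbit_inl (j : Fin N) (i : Idx N r) :
    orbit N r m V h (.inl j) i = ec (((j : ℕ) : ZMod N) * (1 - i.1)) * h i := by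
  rw [orbit, Om_pow, mulVec_diagonal]

theorem Om_inv : (Om N r)⁻¹ = diagonal fun i : Idx N r => ec (-(1 - i.1)) := by
  refine inv_eq_left_inv ?_
  rw [Om_eq, diagonal_mul_diagonal, ← diagonal_one]
  congr 1
  ext i
  rw [← ec_add]; simp

theorem Om_inv_pow (k : ℕ) :
    (Om N r)⁻¹ ^ k = diagonal fun i : Idx N r => ec (-((k : ZMod N) * (1 - i.1))) := by
  rw [Om_inv, diagonal_pow]
  congr 1
  ext i
  rw [Pi.pow_apply, ← ec_mul_nat, mul_neg]

theorem orbit_inr (hV : IsPotential N r m V) (j : Fin N) (i : Idx N r) :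
    orbit N r m V h (.inr j) i = ec (((j : ℕ) : ZMod N) * ((m : ZMod N) - 1 - i.1)) *
      (V i i * conj (h (flip hr i))) := by
  rw [orbit, Om_inv_pow, ← mulVec_mulVec, ← mulVec_mulVec, Kmat_mulVec hr, hV.inv_eq hr,
    mulVec_diagonal, mulVec_diagonal, flip_flip, flip_fst]
  have e : -(((j : ℕ) : ZMod N) * (1 - ((m : ZMod N) - i.1))) =
      ((j : ℕ) : ZMod N) * ((m : ZMod N) - 1 - i.1) := by ring
  rw [e]; ring

include hr in
theorem dot_orbit_inl_inl (x y : Idx N r → ℂ) (j k : Fin N) :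
    orbit N r m V x (.inl j) ⬝ᵥ (Kmat N r m *ᵥ orbit N r m V y (.inl k)) =
      ∑ c : ZMod N, ec (((j : ℕ) : ZMod N) * (1 - (m : ZMod N) + c) + ((k : ℕ) : ZMod N) *
          (1 - c)) *
        pairing N r m x y c := by
  rw [dot_Kmat hr, ← sum_weight_pairing hr]
  refine Finset.sum_congr rfl fun i _ => ?_
  have e : (1 - (m - i.1) : ZMod N) = 1 - m + i.1 := by ring
  rw [orbit_inl, orbit_inl, flip_fst, ec_add, e]
  ring

include hr in
theorem dot_orbit_inl_inr (hV : IsPotential N r m V) (x : Idx N r → ℂ) (j k : Fin N) :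
    orbit N r m V x (.inl j) ⬝ᵥ (Kmat N r m *ᵥ orbit N r m V x (.inr k)) =
      ∑ c : ZMod N, ec (((j : ℕ) : ZMod N) * (1 - c) + ((k : ℕ) : ZMod N) * (c - 1)) *
        hermNorm V x c := by
  rw [dot_Kmat hr, ← sum_weight_hermNorm hr hV, ← sum_flip hr]
  refine Finset.sum_congr rfl fun i _ => ?_
  have e : (m - 1 - (m - i.1) : ZMod N) = i.1 - 1 := by ring
  rw [orbit_inl, orbit_inr _ hr hV, flip_flip, flip_fst, ec_add, e]
  ring

include hr in
theorem dot_orbit_symm (x y : Idx N r → ℂ) (s t : Fin N ⊕ Fin N) :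
    orbit N r m V x s ⬝ᵥ (Kmat N r m *ᵥ orbit N r m V y t) =
      orbit N r m V y t ⬝ᵥ (Kmat N r m *ᵥ orbit N r m V x s) := by
  rw [dotProduct_comm, ← vecMul_transpose, Kmat_transpose hr, dotProduct_mulVec]

include hr in
theorem dot_orbit_inr_inr (hV : IsPotential N r m V) (x y : Idx N r → ℂ) (j k : Fin N) :
    orbit N r m V x (.inr j) ⬝ᵥ (Kmat N r m *ᵥ orbit N r m V y (.inr k)) =
      conj (orbit N r m V x (.inl j) ⬝ᵥ (Kmat N r m *ᵥ orbit N r m V y (.inl k))) := by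
  rw [dot_Kmat hr, dot_Kmat hr, map_sum, ← sum_flip hr]
  refine Finset.sum_congr rfl fun i _ => ?_
  rw [flip_flip, orbit_inr _ hr hV, orbit_inr _ hr hV, orbit_inl, orbit_inl, flip_flip]
  simp only [map_mul, conj_ec, flip_fst]
  have e1 : ((j : ℕ) : ZMod N) * ((m : ZMod N) - 1 - i.1) =
      -(((j : ℕ) : ZMod N) * (1 - ((m : ZMod N) - i.1))) := by ring
  have e2 : ((k : ℕ) : ZMod N) * ((m : ZMod N) - 1 - ((m : ZMod N) - i.1)) =
      -(((k : ℕ) : ZMod N) * (1 - i.1)) := by ring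
  rw [e1, e2]
  linear_combination (ec (-(((j : ℕ) : ZMod N) * (1 - ((m : ZMod N) - i.1)))) *
    ec (-(((k : ℕ) : ZMod N) * (1 - i.1))) * conj (x (flip hr i)) * conj (y i)) * hV.mul_flip hr i

include hr in
/-- The linear (Sylvester) equation `(μ_s + μ_t) Γ_{st} = H_sᵀ K H_t`. Under the Fourier transform
it becomes the recursions of `α`, `β` and `γ`. -/
theorem spec_add_mul_gammaMat (hV : IsPotential N r m V) (hμ0 : μ ≠ 0) (hμ1 : ‖μ‖ ≠ 1)
    (hc : Even N → Even m → constraintForm N r m h = 0) (s t : Fin N ⊕ Fin N) :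
    (spec N μ s + spec N μ t) * gammaMat m μ V h h' s t =
      orbit N r m V h s ⬝ᵥ (Kmat N r m *ᵥ orbit N r m V h t) := by
  have hμc : conj μ ≠ 0 := by simpa using hμ0
  have h11 : ∀ j k : Fin N, (spec N μ (.inl j) + spec N μ (.inl k)) *
      gammaMat m μ V h h' (.inl j) (.inl k) =
      orbit N r m V h (.inl j) ⬝ᵥ (Kmat N r m *ᵥ orbit N r m V h (.inl k)) := by
    intro j k
    have e1 : ∀ c : ZMod N, ec (((j : ℕ) : ZMod N) * (1 - (m : ZMod N) + c) + ((k : ℕ) : ZMod N) *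
        (1 - c)) *
        pairing N r m h h c =
        ec (((j : ℕ) : ZMod N) * (1 - (m : ZMod N) + c) + ((k : ℕ) : ZMod N) * (1 - c)) *
          alpha N r m μ h h' (2 - c) +
        (fun c => ec (((j : ℕ) : ZMod N) * (c - (m : ZMod N)) + ((k : ℕ) : ZMod N) * (2 - c)) *
          alpha N r m μ h h' (2 - c)) (c + 1) := by
      intro c
      have := alpha_add_one hr μ h h' hc (1 - c)
      have e2 : (1 - (1 - c) : ZMod N) = c := by ring
      have e3 : (1 - c + 1 : ZMod N) = 2 - c := by ring
      have e4 : (c + 1 - (m : ZMod N) : ZMod N) = 1 - m + c := by ring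
      have e5 : (2 - (c + 1) : ZMod N) = 1 - c := by ring
      rw [e2, e3] at this
      rw [← this]
      simp only [e4, e5]
      ring
    rw [dot_orbit_inl_inl hr, Finset.sum_congr rfl fun c _ => e1 c, Finset.sum_add_distrib,
      sum_shift (fun c => ec (((j : ℕ) : ZMod N) * (c - (m : ZMod N)) + ((k : ℕ) : ZMod N) *
          (2 - c)) *
          alpha N r m μ h h' (2 - c)), ← Finset.sum_add_distrib, gammaMat_inl_inl, Finset.mul_sum]
    refine Finset.sum_congr rfl fun c _ => ?_
    have e6 : ((j : ℕ) : ZMod N) * (1 - (m : ZMod N) + c) + ((k : ℕ) : ZMod N) * (1 - c) =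
      ((j : ℕ) : ZMod N) + (((j : ℕ) : ZMod N) * (c - (m : ZMod N)) + ((k : ℕ) : ZMod N) *
          (1 - c)) := by ring
    have e7 : ((j : ℕ) : ZMod N) * (c - (m : ZMod N)) + ((k : ℕ) : ZMod N) * (2 - c) =
      ((k : ℕ) : ZMod N) + (((j : ℕ) : ZMod N) * (c - (m : ZMod N)) + ((k : ℕ) : ZMod N) *
          (1 - c)) := by ring
    rw [e6, e7, ec_add ((j : ℕ) : ZMod N), ec_add ((k : ℕ) : ZMod N), spec_inl, spec_inl]
    field_simp
  have h12 : ∀ j k : Fin N, (spec N μ (.inl j) + spec N μ (.inr k)) *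
      gammaMat m μ V h h' (.inl j) (.inr k) =
      orbit N r m V h (.inl j) ⬝ᵥ (Kmat N r m *ᵥ orbit N r m V h (.inr k)) := by
    intro j k
    have e1 : ∀ c : ZMod N, ec (((j : ℕ) : ZMod N) * (1 - c) + ((k : ℕ) : ZMod N) * (c - 1)) *
        hermNorm V h c =
        ec (((j : ℕ) : ZMod N) * (1 - c) + ((k : ℕ) : ZMod N) * (c - 1)) * beta N r μ V h c +
        (fun c => ec (((j : ℕ) : ZMod N) * (-c) + ((k : ℕ) : ZMod N) * c) *
          (beta N r μ V h c / (μ * conj μ))) (c + -1) := by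
      intro c
      have hg := gamma_add_one μ h V hμ1 (1 - c)
      have hb := beta_eq μ h V c
      have hb' := beta_eq μ h V (c + -1)
      have e2 : (1 - (1 - c) : ZMod N) = c := by ring
      have e3 : (1 - (c + -1) : ZMod N) = 1 - c + 1 := by ring
      rw [e3] at hb'
      rw [e2] at hg
      rw [hg, norm_sq_eq] at hb'
      rw [norm_sq_eq] at hb
      have e4 : (-(c + -1) : ZMod N) = 1 - c := by ring
      have e5 : (c + -1 : ZMod N) = c - 1 := by ring
      simp only [e4]
      rw [hb', hb, e5]
      field_simp
      ring
    rw [dot_orbit_inl_inr hr hV, Finset.sum_congr rfl fun c _ => e1 c, Finset.sum_add_distrib,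
      sum_shift (fun c => ec (((j : ℕ) : ZMod N) * (-c) + ((k : ℕ) : ZMod N) * c) *
          (beta N r μ V h c / (μ * conj μ))), ← Finset.sum_add_distrib, gammaMat_inl_inr,
      ← sum_reflect _ (m : ZMod N), Finset.mul_sum]
    refine Finset.sum_congr rfl fun c _ => ?_
    have e6 : ((j : ℕ) : ZMod N) * (1 - c) + ((k : ℕ) : ZMod N) * (c - 1) = ((j : ℕ) : ZMod N) +
      (((j : ℕ) : ZMod N) * ((m : ZMod N) - c - (m : ZMod N)) + ((k : ℕ) : ZMod N) *
          ((m : ZMod N) - 1 - ((m : ZMod N) - c))) := by ring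
    have e7 : ((j : ℕ) : ZMod N) * (-c) + ((k : ℕ) : ZMod N) * c = ((k : ℕ) : ZMod N) +
      (((j : ℕ) : ZMod N) * ((m : ZMod N) - c - (m : ZMod N)) + ((k : ℕ) : ZMod N) *
          ((m : ZMod N) - 1 - ((m : ZMod N) - c))) := by ring
    rw [e6, e7, ec_add ((j : ℕ) : ZMod N), ec_add ((k : ℕ) : ZMod N), spec_inl, spec_inr,
      sub_sub_cancel]
    field_simp
  rcases s with j | j <;> rcases t with k | k
  · exact h11 j k
  · exact h12 j k
  · rw [add_comm, gammaMat_symm μ h h' hr hμ0 hc, h12, dot_orbit_symm hr]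
  · rw [dot_orbit_inr_inr hr hV, ← h11, gammaMat_inr_inr_eq_conj μ h h' hr hμ0 hc]
    simp only [map_mul, map_add, spec_inl, spec_inr, conj_ec, sub_eq_add_neg, ec_add, ec_neg]
    have hj := ec_ne_zero ((j : ℕ) : ZMod N)
    have hk := ec_ne_zero ((k : ℕ) : ZMod N)
    field_simp
    ring

end

/-! ### The singular entries of `Γ` -/

section

variable {N : ℕ} [NeZero N] {r : ZMod N → ℕ} {m : ℤ}
variable (μ : ℂ) (h h' : Idx N r → ℂ) {V : Matrix (Idx N r) (Idx N r) ℂ}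
variable (hr : ∀ j, r j = 1 ∨ (r j = 2 ∧ 2 * j = (m : ZMod N)))

theorem ec_sub_of_add_eq_zero {x y : ZMod N} (hxy : ec x + ec y = 0) : ec (y - x) = -1 := by
  rw [sub_eq_add_neg, ec_add, ec_neg, eq_neg_of_add_eq_zero_right hxy, neg_mul,
    mul_inv_cancel₀ (ec_ne_zero x)]

theorem even_of_ec_add_eq_zero {x y : ZMod N} (hxy : ec x + ec y = 0) : Even N := by
  have h1 := ec_mul_nat N (y - x)
  rw [ec_sub_of_add_eq_zero hxy, ZMod.natCast_self, zero_mul, ec_zero] at h1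
  by_contra h2
  rw [(Nat.not_even_iff_odd.1 h2).neg_one_pow] at h1
  norm_num at h1

theorem ec_mul_of_add_eq_zero {x y : ZMod N} (hxy : ec x + ec y = 0) (c : ZMod N) :
    ec ((y - x) * c) = (-1) ^ c.val := by
  have h2 : (y - x) * c = ((c.val : ℕ) : ZMod N) * (y - x) := by
    rw [ZMod.natCast_zmod_val, mul_comm]
  rw [h2, ec_mul_nat, ec_sub_of_add_eq_zero hxy]

include hr in
/-- Where the factor `μ_j + μ_k` vanishes, the pairing of the two orbits is an alternating sum. -/
theorem dot_orbit_singular (x y : Idx N r → ℂ) (j k : Fin N)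
    (hjk : ec ((j : ℕ) : ZMod N) + ec ((k : ℕ) : ZMod N) = 0) :
    orbit N r m V x (.inl j) ⬝ᵥ (Kmat N r m *ᵥ orbit N r m V y (.inl k)) =
      -(ec ((j : ℕ) : ZMod N) * ec (((j : ℕ) : ZMod N) * (1 - (m : ZMod N)))) *
        ∑ c : ZMod N, (-1) ^ c.val * pairing N r m x y c := by
  have hN := even_of_ec_add_eq_zero hjk
  rw [dot_orbit_inl_inl hr, Finset.mul_sum]
  set a := ((j : ℕ) : ZMod N)
  set b := ((k : ℕ) : ZMod N)
  refine Finset.sum_congr rfl fun c _ => ?_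
  have hs : (-1 : ℂ) ^ (1 - c).val = -(-1) ^ c.val := by
    rw [sub_eq_add_neg, sgn_add hN, sgn_neg hN, sgn_one hN]; ring
  have e : a * (1 - m + c) + b * (1 - c) = (a + a * (1 - m)) + (b - a) * (1 - c) := by ring
  rw [e, ec_add, ec_add, ec_mul_of_add_eq_zero hjk, hs]
  ring

include hr in
/-- Where the factor `μ_j + μ_k` vanishes, the entry of `Γ` is a value of the form `h'ᵀ K Ω^(N/2)
h`. -/
theorem gammaMat_singular (hμ0 : μ ≠ 0) (hc : Even N → Even m → constraintForm N r m h = 0)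
    (j k : Fin N) (hjk : ec ((j : ℕ) : ZMod N) + ec ((k : ℕ) : ZMod N) = 0) :
    gammaMat m μ V h h' (.inl j) (.inl k) =
      (if Odd m then 1 else 0) * (ec (-((j : ℕ) : ZMod N)) *
        (orbit N r m V h' (.inl j) ⬝ᵥ (Kmat N r m *ᵥ orbit N r m V h (.inl k)))) := by
  have hN := even_of_ec_add_eq_zero hjk
  rw [gammaMat_inl_inl, dot_orbit_singular hr _ _ j k hjk]
  set x := ((j : ℕ) : ZMod N)
  set y := ((k : ℕ) : ZMod N)
  have e1 : ∀ c : ZMod N, ec (x * (c - (m : ZMod N)) + y * (1 - c)) *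
      (alpha N r m μ h h' (2 - c) / μ) = -(ec (x * (1 - (m : ZMod N))) / μ) *
        (fun a : ZMod N => (-1) ^ a.val * alpha N r m μ h h' a) (2 - c) := by
    intro c
    have e : x * (c - m) + y * (1 - c) = x * (1 - m) + (y - x) * (1 - c) := by ring
    have e' : (2 - c : ZMod N) = 1 + (1 - c) := by ring
    have e3 : (-1 : ℂ) ^ (2 - c).val = -(-1) ^ (1 - c).val := by
      rw [e', sgn_add hN, sgn_one hN]; ring
    rw [e, ec_add, ec_mul_of_add_eq_zero hjk]
    simp only [e3]
    ring
  rw [Finset.sum_congr rfl fun c _ => e1 c, ← Finset.mul_sum,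
    sum_reflect (fun a : ZMod N => (-1) ^ a.val * alpha N r m μ h h' a),
    alternating_alpha hr μ h h' hN hc, ec_neg]
  have := ec_ne_zero x
  field_simp

/-! ### Invertibility of `Γ` and the value of the Darboux matrix at zero -/

theorem det_gBlock (hμ0 : μ ≠ 0) (i : ZMod N) : (gBlock m μ V h h' i).det =
    conj μ / μ * Delta N r m μ V h h' (2 + m - i) := by
  have e1 : (2 + m - i - m : ZMod N) = 2 - i := by ring
  have e2 : (2 + m - i - 2 : ZMod N) = m - i := by ring
  rw [gBlock, det_fin_two_of, Delta_eq, e1, e2]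
  field_simp

/-- The determinant of `Γ` is, up to non-zero factors, the product of the `Δ_k`. -/
theorem isUnit_gammaMat (hμ0 : μ ≠ 0) :
    IsUnit (gammaMat m μ V h h') ↔ ∀ k, Delta N r m μ V h h' k ≠ 0 := by
  have hμc : conj μ ≠ 0 := by simpa using hμ0
  have h1 : IsUnit (gammaMat m μ V h h') ↔ IsUnit (blockDiagonal (gBlock m μ V h h')) := by
    set B := blockDiagonal (gBlock m μ V h h')
    have hL : leftF N m * fourierInv (Equiv.subRight (m : ZMod N)) (Equiv.subRight 2) = 1 :=
      fourier_mul_inv _ _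
    have hL' : fourierInv (Equiv.subRight (m : ZMod N)) (Equiv.subRight 2) * leftF N m = 1 :=
      fourierInv_mul _ _
    have hR : rightF N m * fourierInv (Equiv.subLeft 1) (Equiv.subLeft ((m : ZMod N) - 1)) = 1 :=
      fourier_mul_inv _ _
    have hR' : fourierInv (Equiv.subLeft 1) (Equiv.subLeft ((m : ZMod N) - 1)) * rightF N m = 1 :=
      fourierInv_mul _ _
    have hG : gammaMat m μ V h h' = leftF N m * B * (rightF N m)ᵀ := rfl
    set L : Matrix (Fin N ⊕ Fin N) (Fin 2 × ZMod N) ℂ := leftF N m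
    set R : Matrix (Fin N ⊕ Fin N) (Fin 2 × ZMod N) ℂ := rightF N m
    generalize fourierInv (N := N) (Equiv.subRight (m : ZMod N)) (Equiv.subRight 2) = L' at hL hL'
    generalize fourierInv (N := N) (Equiv.subLeft 1) (Equiv.subLeft ((m : ZMod N) - 1)) = R'
      at hR hR'
    have hRt : Rᵀ * R'ᵀ = 1 := by rw [← transpose_mul, hR', transpose_one]
    have hRt' : R'ᵀ * Rᵀ = 1 := by rw [← transpose_mul, hR, transpose_one]
    rw [hG]
    constructor
    · intro hu
      have h2 := mul_nonsing_inv _ ((isUnit_iff_isUnit_det _).1 hu)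
      set A := (L * B * Rᵀ)⁻¹
      refine IsUnit.of_mul_eq_one (Rᵀ * (A * L)) ?_
      calc B * (Rᵀ * (A * L)) = (L' * L) * (B * (Rᵀ * (A * L))) := by rw [hL', Matrix.one_mul]
        _ = L' * (L * B * Rᵀ * A) * L := by simp only [Matrix.mul_assoc]
        _ = 1 := by rw [h2, Matrix.mul_one, hL']
    · intro hu
      have h2 := mul_nonsing_inv _ ((isUnit_iff_isUnit_det _).1 hu)
      refine IsUnit.of_mul_eq_one (R'ᵀ * (B⁻¹ * L')) ?_
      calc L * B * Rᵀ * (R'ᵀ * (B⁻¹ * L')) = L * (B * ((Rᵀ * R'ᵀ) * (B⁻¹ * L'))) := by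
            simp only [Matrix.mul_assoc]
        _ = L * (B * B⁻¹) * L' := by rw [hRt, Matrix.one_mul]; simp only [Matrix.mul_assoc]
        _ = 1 := by rw [h2, Matrix.mul_one, hL]
  rw [h1, isUnit_iff_isUnit_det, det_blockDiagonal, isUnit_iff_ne_zero, Finset.prod_ne_zero_iff]
  constructor
  · intro h2 k h3
    refine h2 (2 + m - k) (Finset.mem_univ _) ?_
    rw [det_gBlock μ h h' hμ0, sub_sub_cancel, h3, mul_zero]
  · intro h2 i _
    rw [det_gBlock μ h h' hμ0]
    exact mul_ne_zero (div_ne_zero hμc hμ0) (h2 _)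

variable (m) in
/-- The inverse of `gBlock`. -/
noncomputable def gBlockInv (V : Matrix (Idx N r) (Idx N r) ℂ) (i : ZMod N) :
    Matrix (Fin 2) (Fin 2) ℂ :=
  (Delta N r m μ V h h' (2 + m - i))⁻¹ •
    !![μ * conj (alpha N r m μ h h' (2 - i)), -(beta N r μ V h (m - i) / conj μ);
      -(μ * gamma N r μ V h (2 - i)), alpha N r m μ h h' (2 - i) / conj μ]

theorem gBlock_mul_inv (hμ0 : μ ≠ 0) (hΔ : ∀ k, Delta N r m μ V h h' k ≠ 0) (i : ZMod N) :
    gBlock m μ V h h' i * gBlockInv m μ h h' V i = 1 := by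
  have hμc : conj μ ≠ 0 := by simpa using hμ0
  have hD := hΔ (2 + m - i)
  have e1 : (2 + m - i - m : ZMod N) = 2 - i := by ring
  have e2 : (2 + m - i - 2 : ZMod N) = m - i := by ring
  have hE := Delta_eq (m := m) (V := V) μ h h' (2 + m - i)
  rw [e1, e2] at hE
  rw [gBlock, gBlockInv]
  ext a b
  fin_cases a <;> fin_cases b <;> simp [mul_apply, Fin.sum_univ_two] <;> field_simp <;>
    (try rw [hE]) <;> ring

variable (m) in
/-- The matrix whose columns are the `2N` vectors `H_s`. -/
noncomputable def orbitMat (V : Matrix (Idx N r) (Idx N r) ℂ) (h : Idx N r → ℂ) :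
    Matrix (Idx N r) (Fin N ⊕ Fin N) ℂ :=
  of fun i s => orbit N r m V h s i

variable (N) in
/-- The diagonal matrix of the spectral parameters. -/
noncomputable def specMat (μ : ℂ) : Matrix (Fin N ⊕ Fin N) (Fin N ⊕ Fin N) ℂ :=
  diagonal (spec N μ)

variable (N) in
/-- The inverse of `specMat`. -/
noncomputable def specInv (μ : ℂ) : Matrix (Fin N ⊕ Fin N) (Fin N ⊕ Fin N) ℂ :=
  diagonal fun s => (spec N μ s)⁻¹

/-- The value at `lam = 0` of the Darboux matrix, normalized to be `1` at infinity. -/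
noncomputable def darboux₀ (N : ℕ) [NeZero N] (r : ZMod N → ℕ) (m : ℤ) (μ : ℂ)
    (V : Matrix (Idx N r) (Idx N r) ℂ) (h : Idx N r → ℂ)
    (G : Matrix (Fin N ⊕ Fin N) (Fin N ⊕ Fin N) ℂ) : Matrix (Idx N r) (Idx N r) ℂ :=
  1 - orbitMat m V h * G⁻¹ * specInv N μ * ((orbitMat m V h)ᵀ * Kmat N r m)

theorem spec_ne_zero (hμ0 : μ ≠ 0) (s : Fin N ⊕ Fin N) : spec N μ s ≠ 0 := by
  have hμc : conj μ ≠ 0 := by simpa using hμ0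
  rcases s with j | j
  · rw [spec_inl]; exact mul_ne_zero (ec_ne_zero _) hμ0
  · rw [spec_inr]; exact mul_ne_zero (ec_ne_zero _) (inv_ne_zero hμc)

include hr in
/-- The matrix of the columns `H_s` factors through the Fourier matrix on the right of `Γ`, with a
factor supported on the blocks. -/
theorem orbitMat_eq_right (hV : IsPotential N r m V) : ∃ X : Matrix (Idx N r) (Fin 2 × ZMod N) ℂ,
    orbitMat m V h = X * (rightF N m)ᵀ ∧ ∀ i c, X i (0, c) = (if i.1 = c then h i else 0) ∧
      X i (1, c) = if i.1 = c then V i i * conj (h (flip hr i)) else 0 := by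
  refine ⟨of fun i x => if i.1 = x.2 then
    (if x.1 = 0 then h i else V i i * conj (h (flip hr i))) else 0, ?_, fun i c => by simp⟩
  ext i s
  rw [mul_apply, sum_fin_two_prod]
  rcases s with j | j
  · simp [orbitMat, orbit_inl, rightF, fourier, mul_comm]
  · simp [orbitMat, orbit_inr _ hr hV, rightF, fourier, mul_comm]

include hr in
/-- The rows `H_sᵀ / μ_s` factor through the Fourier matrix on the left of `Γ`. -/
theorem orbitMat_eq_left (hV : IsPotential N r m V) : ∃ Y : Matrix (Idx N r) (Fin 2 × ZMod N) ℂ,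
    specInv N μ * (orbitMat m V h)ᵀ = leftF N m * Yᵀ ∧
      ∀ i c, Y i (0, c) = (if i.1 = m - c then h i / μ else 0) ∧
      Y i (1, c) = if i.1 = m - c then conj μ * (V i i * conj (h (flip hr i))) else 0 := by
  refine ⟨of fun i x => if i.1 = m - x.2 then
    (if x.1 = 0 then h i / μ else conj μ * (V i i * conj (h (flip hr i)))) else 0, ?_,
    fun i c => by simp⟩
  ext s i
  rw [specInv, diagonal_mul, mul_apply, sum_fin_two_prod]
  have e : ∀ c : ZMod N, (i.1 = m - c) ↔ (c = m - i.1) := fun c =>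
    ⟨fun h => by rw [h]; ring, fun h => by rw [h]; ring⟩
  rcases s with j | j
  · have e1 : ec (((j : ℕ) : ZMod N) * (1 - i.1)) =
        ec ((j : ℕ) : ZMod N) * ec (-(((j : ℕ) : ZMod N) * i.1)) := by
      rw [← ec_add]; congr 1; ring
    have := ec_ne_zero ((j : ℕ) : ZMod N)
    simp only [orbitMat, orbit_inl, leftF, fourier, e, spec_inl, e1, transpose_apply, of_apply,
      Equiv.subRight_apply]
    simp
    field_simp
  · have e1 : ((j : ℕ) : ZMod N) * (m - i.1 - 2) =
      -((j : ℕ) : ZMod N) + ((j : ℕ) : ZMod N) * (m - 1 - i.1) := by ring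
    simp [orbitMat, orbit_inr _ hr hV, leftF, fourier, e, spec_inr, e1, ec_add, ec_neg]
    ring

include hr in
/-- The two Fourier matrices in `Γ⁻¹` cancel against those in `orbitMat_eq_right` and
`orbitMat_eq_left`; what is left is a two by two matrix for each block. -/
theorem darboux₀_eq (hV : IsPotential N r m V) (hμ0 : μ ≠ 0)
    (hΔ : ∀ k, Delta N r m μ V h h' k ≠ 0) :
    darboux₀ N r m μ V h (gammaMat m μ V h h') =
      blockDiagonal' fun j => fBlock N r m μ V h h' j := by
  have hμc : conj μ ≠ 0 := by simpa using hμ0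
  obtain ⟨X, hX, hXe⟩ := orbitMat_eq_right h hr hV
  obtain ⟨Y, hY, hYe⟩ := orbitMat_eq_left μ h hr hV
  have hinv : (gammaMat m μ V h h')⁻¹ =
      (fourierInv (Equiv.subLeft 1) (Equiv.subLeft ((m : ZMod N) - 1)))ᵀ *
        blockDiagonal (gBlockInv m μ h h' V) *
        fourierInv (Equiv.subRight (m : ZMod N)) (Equiv.subRight 2) := by
    refine inv_eq_right_inv ?_
    have hR' := congrArg transpose
      (fourierInv_mul (N := N) (Equiv.subLeft 1) (Equiv.subLeft ((m : ZMod N) - 1)))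
    rw [transpose_mul, transpose_one] at hR'
    have hB : blockDiagonal (gBlock m μ V h h') * blockDiagonal (gBlockInv m μ h h' V) = 1 := by
      rw [← blockDiagonal_mul, ← blockDiagonal_one]
      congr 1
      ext1 i
      exact gBlock_mul_inv μ h h' hμ0 hΔ i
    have hL := fourier_mul_inv (N := N) (Equiv.subRight (m : ZMod N)) (Equiv.subRight 2)
    rw [gammaMat, leftF, rightF]
    generalize fourierInv (N := N) (Equiv.subRight (m : ZMod N)) (Equiv.subRight 2) = L' at *
    generalize fourierInv (N := N) (Equiv.subLeft 1) (Equiv.subLeft ((m : ZMod N) - 1)) = R' at *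
    generalize fourier (N := N) (Equiv.subRight (m : ZMod N)) (Equiv.subRight 2) = L at *
    generalize (fourier (N := N) (Equiv.subLeft 1) (Equiv.subLeft ((m : ZMod N) - 1)))ᵀ = R at *
    calc L * blockDiagonal (gBlock m μ V h h') * R *
          (R'ᵀ * blockDiagonal (gBlockInv m μ h h' V) * L')
        = L * (blockDiagonal (gBlock m μ V h h') * ((R * R'ᵀ) *
          (blockDiagonal (gBlockInv m μ h h' V) * L'))) := by simp only [Matrix.mul_assoc]
      _ = L * ((blockDiagonal (gBlock m μ V h h') * blockDiagonal (gBlockInv m μ h h' V)) * L') :=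
          by
          rw [hR', Matrix.one_mul, Matrix.mul_assoc]
      _ = 1 := by rw [hB, Matrix.one_mul, hL]
  have hprod : orbitMat m V h * (gammaMat m μ V h h')⁻¹ * specInv N μ *
      ((orbitMat m V h)ᵀ * Kmat N r m) =
      X * blockDiagonal (gBlockInv m μ h h' V) * Yᵀ * Kmat N r m := by
    have hR' : (rightF N m)ᵀ *
        (fourierInv (Equiv.subLeft 1) (Equiv.subLeft ((m : ZMod N) - 1)))ᵀ = 1 := by
      rw [← transpose_mul, rightF, fourierInv_mul, transpose_one]
    have hL' : fourierInv (Equiv.subRight (m : ZMod N)) (Equiv.subRight 2) * leftF N m = 1 :=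
      fourierInv_mul _ _
    calc orbitMat m V h * (gammaMat m μ V h h')⁻¹ * specInv N μ *
          ((orbitMat m V h)ᵀ * Kmat N r m)
        = orbitMat m V h * (gammaMat m μ V h h')⁻¹ * (specInv N μ * (orbitMat m V h)ᵀ) *
          Kmat N r m := by simp only [Matrix.mul_assoc]
      _ = X * (((rightF N m)ᵀ *
          (fourierInv (Equiv.subLeft 1) (Equiv.subLeft ((m : ZMod N) - 1)))ᵀ) *
          (blockDiagonal (gBlockInv m μ h h' V) *
          ((fourierInv (Equiv.subRight (m : ZMod N)) (Equiv.subRight 2) * leftF N m) *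
            (Yᵀ * Kmat N r m)))) := by
          rw [hinv, hY, hX]; simp only [Matrix.mul_assoc]
      _ = _ := by rw [hR', hL', Matrix.one_mul, Matrix.one_mul]; simp only [Matrix.mul_assoc]
  rw [darboux₀, hprod]
  ext ⟨c, a⟩ ⟨d, b⟩
  rw [Matrix.sub_apply, mul_Kmat_apply hr, blockDiagonal_sandwich]
  simp only [fun i c => (hXe i c).1, fun i c => (hXe i c).2, fun i c => (hYe i c).1,
    fun i c => (hYe i c).2, flip_fst, flip_flip, sub_right_inj]
  rw [Finset.sum_eq_single c (fun x _ hx => by simp [Ne.symm hx]) (by simp)]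
  by_cases hcd : c = d
  · subst hcd
    rw [blockDiagonal'_apply_eq, fBlock_apply hr μ h h' hV]
    simp only [if_true, gBlockInv, Matrix.smul_apply, of_apply, cons_val', cons_val_zero,
      cons_val_one, cons_val_fin_one, smul_eq_mul]
    have e1 : (1 : Matrix (Idx N r) (Idx N r) ℂ) ⟨c, a⟩ ⟨c, b⟩ = if a = b then 1 else 0 := by
      simp [one_apply]
    rw [e1]
    field_simp
    ring
  · rw [blockDiagonal'_apply_ne _ _ _ hcd]
    have : (⟨c, a⟩ : Idx N r) ≠ ⟨d, b⟩ := fun h2 => hcd (congrArg Sigma.fst h2)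
    simp [Ne.symm hcd, this]

theorem prod_spec : ∏ s, spec N μ s = (μ / conj μ) ^ N := by
  have h1 : ∏ j : Fin N, ec ((j : ℕ) : ZMod N) = ∏ x : ZMod N, ec x := by
    refine Fintype.prod_bijective (fun j : Fin N => ((j : ℕ) : ZMod N)) ?_ _ _ fun _ => rfl
    rw [Fintype.bijective_iff_injective_and_card]
    refine ⟨fun j k hjk => ?_, by simp [ZMod.card]⟩
    have h3 := congrArg ZMod.val hjk
    simp only [ZMod.val_natCast_of_lt j.2, ZMod.val_natCast_of_lt k.2] at h3
    exact Fin.ext h3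
  have h2 : (∏ x : ZMod N, ec x) * ∏ x : ZMod N, ec x = 1 := by
    conv_lhs =>
      enter [2]
      rw [← Equiv.prod_comp (Equiv.neg (ZMod N))]
    rw [← Finset.prod_mul_distrib]
    refine Finset.prod_eq_one fun x _ => ?_
    rw [Equiv.neg_apply, ← ec_add, add_neg_cancel, ec_zero]
  rw [Fintype.prod_sum_type]
  simp only [spec_inl, spec_inr, Finset.prod_mul_distrib, Finset.prod_const, Finset.card_univ,
    Fintype.card_fin, h1]
  rw [div_eq_mul_inv, mul_pow]
  linear_combination (μ ^ N * (conj μ)⁻¹ ^ N) * h2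

/-- The scalar is the product of all spectral parameters: the product of all `N`-th roots of unity
occurs twice, and its square is `1`. -/
theorem T2N_eq (G : Matrix (Fin N ⊕ Fin N) (Fin N ⊕ Fin N) ℂ) :
    T2N N r m μ V h G = (μ / conj μ) ^ N • darboux₀ N r m μ V h G := by
  rw [T2N, darbouxT, darboux₀]
  simp only [zero_add]
  rw [prod_spec μ]
  congr 2
  have : orbitMat m V h * G⁻¹ * specInv N μ * ((orbitMat m V h)ᵀ * Kmat N r m) =
      (orbitMat m V h * G⁻¹ * specInv N μ * (orbitMat m V h)ᵀ) * Kmat N r m := by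
    simp only [Matrix.mul_assoc]
  rw [this]
  simp only [← Matrix.smul_mul]
  rw [Finset.sum_congr rfl fun j _ => (Finset.sum_mul Finset.univ _ (Kmat N r m)).symm,
    ← Finset.sum_mul]
  congr 1
  ext i k
  simp only [Matrix.sum_apply, Matrix.smul_apply, vecMulVec_apply, smul_eq_mul, mul_apply,
    transpose_apply, specInv, diagonal_apply, mul_ite, mul_zero, Finset.sum_ite_eq',
    Finset.mem_univ, if_true, Finset.sum_mul]
  rw [Finset.sum_comm]
  refine Finset.sum_congr rfl fun t _ => Finset.sum_congr rfl fun s _ => ?_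
  simp only [orbitMat, of_apply]
  ring

end

/-! ### The limits defining `Γ` -/

section

variable {N : ℕ} [NeZero N] {r : ZMod N → ℕ} {m : ℤ}
variable (μ : ℂ) (h h' : Idx N r → ℂ) {V : Matrix (Idx N r) (Idx N r) ℂ}
variable (hr : ∀ j, r j = 1 ∨ (r j = 2 ∧ 2 * j = (m : ZMod N)))

theorem spec_inl_add_inr_ne_zero (hμ0 : μ ≠ 0) (hμ1 : ‖μ‖ ≠ 1) (j k : Fin N) :
    spec N μ (.inl j) + spec N μ (.inr k) ≠ 0 := by
  intro h0
  rw [spec_inl, spec_inr] at h0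
  have h1 := congrArg norm (eq_neg_of_add_eq_zero_left h0)
  have hp : 0 < ‖μ‖ := norm_pos_iff.2 hμ0
  rw [norm_neg, norm_mul, norm_mul, norm_ec, norm_ec, one_mul, one_mul, norm_inv,
    RCLike.norm_conj] at h1
  have h2 : ‖μ‖ * ‖μ‖ = 1 := by
    nth_rw 1 [h1]; exact inv_mul_cancel₀ hp.ne'
  exact hμ1 (by nlinarith)

theorem spec_inl_add_inl_eq_zero (hμ0 : μ ≠ 0) (j k : Fin N) :
    spec N μ (.inl j) + spec N μ (.inl k) = 0 ↔
      ec ((j : ℕ) : ZMod N) + ec ((k : ℕ) : ZMod N) = 0 := by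
  rw [spec_inl, spec_inl, ← add_mul, mul_eq_zero, or_iff_left hμ0]

theorem spec_inr_add_inr_eq_zero (hμ0 : μ ≠ 0) (j k : Fin N) :
    spec N μ (.inr j) + spec N μ (.inr k) = 0 ↔
      ec ((j : ℕ) : ZMod N) + ec ((k : ℕ) : ZMod N) = 0 := by
  have hμc : conj μ ≠ 0 := by simpa using hμ0
  rw [spec_inr, spec_inr, ← add_mul, mul_eq_zero, or_iff_left (inv_ne_zero hμc)]

omit [NeZero N] in
theorem continuousAt_spec (hμ0 : μ ≠ 0) (s : Fin N ⊕ Fin N) :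
    ContinuousAt (fun lam => spec N lam s) μ := by
  have hμc : conj μ ≠ 0 := by simpa using hμ0
  rcases s with j | j
  · simp only [spec]; fun_prop
  · simp only [spec]
    exact continuousAt_const.mul ((Complex.continuous_conj.continuousAt).inv₀ hμc)

include hr in
theorem continuousAt_orbit (hV : IsPotential N r m V) (Φ : ℂ → Idx N r → ℂ)
    (hΦ : ∀ i, ContinuousAt (fun lam => Φ lam i) μ) (s : Fin N ⊕ Fin N) (i : Idx N r) :
    ContinuousAt (fun lam => orbit N r m V (Φ lam) s i) μ := by
  rcases s with j | j
  · simp only [orbit_inl]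
    exact continuousAt_const.mul (hΦ i)
  · simp only [orbit_inr _ hr hV]
    exact continuousAt_const.mul (continuousAt_const.mul
      (Complex.continuous_conj.continuousAt.comp (hΦ (flip hr i))))

include hr in
/-- For even `m` the derivative of the constraint along a family kills the singular entries of
`Γ`. -/
theorem alternating_deriv_eq_zero (hN : Even N) (hm : Even m) (Φ : ℂ → Idx N r → ℂ)
    (hΦ : ∀ i, HasDerivAt (fun lam => Φ lam i) (h' i) μ)
    (hc : ∀ᶠ lam in 𝓝 μ, constraintForm N r m (Φ lam) = 0) :
    ∑ c : ZMod N, (-1) ^ c.val * pairing N r m h' (Φ μ) c = 0 := by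
  have h1 : HasDerivAt (fun lam => ∑ c : ZMod N, (-1) ^ c.val * pairing N r m (Φ lam) (Φ lam) c)
      (∑ c : ZMod N, (-1) ^ c.val * (pairing N r m h' (Φ μ) c + pairing N r m (Φ μ) h' c)) μ := by
    refine HasDerivAt.fun_sum fun c _ => HasDerivAt.const_mul _ ?_
    simp only [pairing_eq hr]
    rw [← Finset.sum_add_distrib]
    exact HasDerivAt.fun_sum fun a _ => (hΦ _).mul (hΦ _)
  have h2 : (fun lam => ∑ c : ZMod N, (-1) ^ c.val * pairing N r m (Φ lam) (Φ lam) c) =ᶠ[𝓝 μ]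
      fun _ => 0 := by
    filter_upwards [hc] with lam hlam
    rw [constraintForm, dot_half hr hN] at hlam
    simpa using hlam
  have h3 := h1.unique ((hasDerivAt_const μ (0 : ℂ)).congr_of_eventuallyEq h2)
  simp only [mul_add, Finset.sum_add_distrib] at h3
  have h4 := alternating_symm hr hN (Φ μ) h'
  rw [hm.neg_one_zpow, one_mul] at h4
  rw [h4] at h3
  linear_combination h3 / 2

include hr in
/-- The matrix `gammaMat` consists of the limits defining `Γ`. Where `μ_s + μ_t ≠ 0` the quotient
is continuous and the Sylvester equation gives its value; otherwise it is a difference quotient,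
and the limit is a derivative. -/
theorem isGamma_gammaMat (hV : IsPotential N r m V) (hμ0 : μ ≠ 0) (hμ1 : ‖μ‖ ≠ 1)
    (Φ : ℂ → Idx N r → ℂ) (hΦ : ∀ i, HasDerivAt (fun lam => Φ lam i) (h' i) μ)
    (hc : Even N → ∀ᶠ lam in 𝓝 μ, constraintForm N r m (Φ lam) = 0) :
    IsGamma N r m μ V Φ (gammaMat m μ V (Φ μ) h') := by
  have hμc : conj μ ≠ 0 := by simpa using hμ0
  have hcμ : Even N → Even m → constraintForm N r m (Φ μ) = 0 := fun hN _ => (hc hN).self_of_nhds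
  have hsyl := spec_add_mul_gammaMat μ (Φ μ) h' hr hV hμ0 hμ1 hcμ
  have hreg : ∀ s t, spec N μ s + spec N μ t ≠ 0 → Tendsto
      (fun lam => (orbit N r m V (Φ lam) s ⬝ᵥ (Kmat N r m *ᵥ orbit N r m V (Φ μ) t)) /
        (spec N lam s + spec N μ t)) (𝓝[≠] μ) (𝓝 (gammaMat m μ V (Φ μ) h' s t)) := by
    intro s t hst
    rw [eq_div_of_mul_eq hst ((mul_comm _ _).trans (hsyl s t))]
    refine Tendsto.mono_left ?_ nhdsWithin_le_nhds
    refine ContinuousAt.div ?_ ((continuousAt_spec μ hμ0 s).add continuousAt_const) hst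
    simp only [dot_Kmat hr]
    exact tendsto_finsetSum _ fun i _ => (continuousAt_orbit μ hr hV Φ
      (fun i => (hΦ i).continuousAt) s _).mul continuousAt_const
  have hsing : ∀ j k : Fin N, ec ((j : ℕ) : ZMod N) + ec ((k : ℕ) : ZMod N) = 0 → Tendsto
      (fun lam => (orbit N r m V (Φ lam) (.inl j) ⬝ᵥ
          (Kmat N r m *ᵥ orbit N r m V (Φ μ) (.inl k))) /
        (spec N lam (.inl j) + spec N μ (.inl k))) (𝓝[≠] μ)
        (𝓝 (gammaMat m μ V (Φ μ) h' (.inl j) (.inl k))) := by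
    intro j k hjk
    have hN := even_of_ec_add_eq_zero hjk
    have hd : HasDerivAt (fun lam => orbit N r m V (Φ lam) (.inl j) ⬝ᵥ
        (Kmat N r m *ᵥ orbit N r m V (Φ μ) (.inl k)))
        (orbit N r m V h' (.inl j) ⬝ᵥ (Kmat N r m *ᵥ orbit N r m V (Φ μ) (.inl k))) μ := by
      simp only [dot_Kmat hr, orbit_inl]
      exact HasDerivAt.fun_sum fun i _ => ((hΦ _).const_mul _).mul_const _
    have h0 : orbit N r m V (Φ μ) (.inl j) ⬝ᵥ (Kmat N r m *ᵥ orbit N r m V (Φ μ) (.inl k)) = 0 := by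
      rw [dot_orbit_singular hr _ _ j k hjk, alternating_eq_zero hr hN _ (hcμ hN), mul_zero]
    have hval : gammaMat m μ V (Φ μ) h' (.inl j) (.inl k) = ec (-((j : ℕ) : ZMod N)) *
        (orbit N r m V h' (.inl j) ⬝ᵥ (Kmat N r m *ᵥ orbit N r m V (Φ μ) (.inl k))) := by
      rw [gammaMat_singular μ _ h' hr hμ0 hcμ j k hjk]
      rcases Int.even_or_odd m with hm | hm
      · rw [dot_orbit_singular hr _ _ j k hjk,
          alternating_deriv_eq_zero μ h' hr hN hm Φ hΦ (hc hN)]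
        simp
      · rw [if_pos hm, one_mul]
    rw [hval]
    refine ((hasDerivAt_iff_tendsto_slope.1 hd).const_mul (ec (-((j : ℕ) : ZMod N)))).congr' ?_
    filter_upwards [self_mem_nhdsWithin] with lam hlam
    have hl : lam - μ ≠ 0 := sub_ne_zero.2 hlam
    have hj := ec_ne_zero ((j : ℕ) : ZMod N)
    rw [slope_def_field, h0, sub_zero, spec_inl, spec_inl, eq_neg_of_add_eq_zero_right hjk, ec_neg]
    have e : ec ((j : ℕ) : ZMod N) * lam + -ec ((j : ℕ) : ZMod N) * μ =
      ec ((j : ℕ) : ZMod N) * (lam - μ) := by ring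
    rw [e]
    field_simp
  intro s t
  by_cases hst : spec N μ s + spec N μ t = 0
  · rcases s with j | j <;> rcases t with k | k
    · exact hsing j k ((spec_inl_add_inl_eq_zero μ hμ0 j k).1 hst)
    · exact absurd hst (spec_inl_add_inr_ne_zero μ hμ0 hμ1 j k)
    · rw [add_comm] at hst
      exact absurd hst (spec_inl_add_inr_ne_zero μ hμ0 hμ1 k j)
    · -- the second group is obtained from the first one by complex conjugation
      have hjk := (spec_inr_add_inr_eq_zero μ hμ0 j k).1 hst
      have h1 := (Complex.continuous_conj.tendsto _).comp (hsing j k hjk)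
      have h2 : Tendsto (fun lam : ℂ => conj lam) (𝓝[≠] μ) (𝓝 (conj μ)) :=
        (Complex.continuous_conj.tendsto μ).mono_left nhdsWithin_le_nhds
      have h3 := (h2.mul_const (conj μ * ec (-((j : ℕ) : ZMod N) - ((k : ℕ) : ZMod N)))).mul h1
      rw [gammaMat_inr_inr_eq_conj μ (Φ μ) h' hr hμ0 hcμ]
      have e : conj μ * (conj μ * ec (-((j : ℕ) : ZMod N) - ((k : ℕ) : ZMod N))) =
        conj μ ^ 2 * ec (-((j : ℕ) : ZMod N) - ((k : ℕ) : ZMod N)) := by ring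
      rw [e] at h3
      refine h3.congr' ?_
      have hne : ∀ᶠ lam in 𝓝[≠] μ, lam ≠ 0 :=
        (eventually_ne_nhds hμ0).filter_mono nhdsWithin_le_nhds
      filter_upwards [self_mem_nhdsWithin, hne] with lam hlam hlam0
      have hl : conj lam - conj μ ≠ 0 := by
        rw [← map_sub]; exact (map_ne_zero _).2 (sub_ne_zero.2 hlam)
      have hl0 : conj lam ≠ 0 := by simpa using hlam0
      have hj := ec_ne_zero ((j : ℕ) : ZMod N)
      have hk := eq_neg_of_add_eq_zero_right hjk
      simp only [Function.comp_apply]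
      rw [dot_orbit_inr_inr hr hV, spec_inl, spec_inl, spec_inr, spec_inr, sub_eq_add_neg, ec_add,
        ec_neg, ec_neg, hk, map_div₀]
      simp only [map_add, map_mul, map_neg, conj_ec, ec_neg]
      generalize conj (orbit N r m V (Φ lam) (.inl j) ⬝ᵥ
        (Kmat N r m *ᵥ orbit N r m V (Φ μ) (.inl k))) = z
      generalize conj lam = l at *
      generalize conj μ = n at *
      generalize ec ((j : ℕ) : ZMod N) = x at *
      have e1 : x⁻¹ * l + -x⁻¹ * n = x⁻¹ * (l - n) := by ring
      have e2 : x * l⁻¹ + -x * n⁻¹ = -x * (l - n) * (l⁻¹ * n⁻¹) := by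
        field_simp; ring
      rw [e1, e2]
      field_simp
  · exact hreg s t hst

end

/-! ### Calculus of `∂_z` and `∂_z̄` -/

section

/-- The complex combination `∂_x + ε ∂_y` of the partial derivatives; `ε = -i` gives `∂_z` and `ε
= i` gives `∂_z̄`. -/
noncomputable def cd (ε : ℂ) (f : ℝ × ℝ → ℂ) (p : ℝ × ℝ) : ℂ :=
  fderiv ℝ f p (1, 0) + ε * fderiv ℝ f p (0, 1)

theorem dz_eq_cd (f : ℝ × ℝ → ℂ) (p : ℝ × ℝ) : dz f p = cd (-Complex.I) f p := by
  rw [dz, cd, sub_eq_add_neg, neg_mul]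

theorem dzbar_eq_cd (f : ℝ × ℝ → ℂ) (p : ℝ × ℝ) : dzbar f p = cd Complex.I f p := rfl

theorem cd_congr {U : Set (ℝ × ℝ)} (hU : IsOpen U) {f g : ℝ × ℝ → ℂ} (hfg : ∀ p ∈ U, f p = g p)
    (ε : ℂ) {p : ℝ × ℝ} (hp : p ∈ U) : cd ε f p = cd ε g p := by
  have : f =ᶠ[𝓝 p] g := Filter.eventually_of_mem (hU.mem_nhds hp) hfg
  rw [cd, cd, this.fderiv_eq]

@[simp] theorem cd_const (ε c : ℂ) (p : ℝ × ℝ) : cd ε (fun _ => c) p = 0 := by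
  simp [cd]

theorem cd_add (ε : ℂ) {f g : ℝ × ℝ → ℂ} {p : ℝ × ℝ} (hf : DifferentiableAt ℝ f p)
    (hg : DifferentiableAt ℝ g p) : cd ε (fun q => f q + g q) p = cd ε f p + cd ε g p := by
  have : fderiv ℝ (fun q => f q + g q) p = fderiv ℝ f p + fderiv ℝ g p := fderiv_fun_add hf hg
  rw [cd, cd, cd, this]
  simp only [_root_.add_apply]
  ring

theorem cd_mul (ε : ℂ) {f g : ℝ × ℝ → ℂ} {p : ℝ × ℝ} (hf : DifferentiableAt ℝ f p)
    (hg : DifferentiableAt ℝ g p) :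
    cd ε (fun q => f q * g q) p = cd ε f p * g p + f p * cd ε g p := by
  have : fderiv ℝ (fun q => f q * g q) p = f p • fderiv ℝ g p + g p • fderiv ℝ f p :=
    fderiv_fun_mul hf hg
  rw [cd, cd, cd, this]
  simp only [_root_.add_apply, _root_.smul_apply, smul_eq_mul]
  ring

theorem cd_const_mul (ε c : ℂ) {f : ℝ × ℝ → ℂ} {p : ℝ × ℝ} (hf : DifferentiableAt ℝ f p) :
    cd ε (fun q => c * f q) p = c * cd ε f p := by
  rw [cd_mul ε (differentiableAt_const c) hf, cd_const, zero_mul, zero_add]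

theorem cd_sum (ε : ℂ) {ι : Type*} (s : Finset ι) {f : ι → ℝ × ℝ → ℂ} {p : ℝ × ℝ}
    (hf : ∀ i ∈ s, DifferentiableAt ℝ (f i) p) :
    cd ε (fun q => ∑ i ∈ s, f i q) p = ∑ i ∈ s, cd ε (f i) p := by
  have : fderiv ℝ (fun q => ∑ i ∈ s, f i q) p = ∑ i ∈ s, fderiv ℝ (f i) p := fderiv_fun_sum hf
  simp only [cd, this, _root_.sum_apply, Finset.sum_add_distrib, Finset.mul_sum]

theorem cd_conj (ε : ℂ) {f : ℝ × ℝ → ℂ} {p : ℝ × ℝ} (hf : DifferentiableAt ℝ f p) :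
    cd ε (fun q => conj (f q)) p = conj (cd (conj ε) f p) := by
  have h : HasFDerivAt (fun q => conj (f q))
      ((Complex.conjCLE : ℂ →L[ℝ] ℂ).comp (fderiv ℝ f p)) p :=
    (Complex.conjCLE : ℂ →L[ℝ] ℂ).hasFDerivAt.comp p hf.hasFDerivAt
  rw [cd, cd, h.fderiv]
  simp

/-- Entrywise `∂_x + ε ∂_y` of a matrix function. -/
noncomputable def mcd {ι κ : Type*} (ε : ℂ) (A : ℝ × ℝ → Matrix ι κ ℂ) (p : ℝ × ℝ) :
    Matrix ι κ ℂ :=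
  of fun i k => cd ε (fun q => A q i k) p

/-- Entrywise smoothness of a matrix function on `U`. -/
def MSmooth {ι κ : Type*} (U : Set (ℝ × ℝ)) (A : ℝ × ℝ → Matrix ι κ ℂ) : Prop :=
  ∀ i k, ContDiffOn ℝ ∞ (fun p => A p i k) U

variable {ι κ τ : Type*} {U : Set (ℝ × ℝ)} {A : ℝ × ℝ → Matrix ι κ ℂ}

theorem mdz_eq_mcd (B : ℝ × ℝ → Matrix ι ι ℂ) (p : ℝ × ℝ) : mdz B p = mcd (-Complex.I) B p := by
  ext i k; exact dz_eq_cd _ _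

theorem mdzbar_eq_mcd (B : ℝ × ℝ → Matrix ι ι ℂ) (p : ℝ × ℝ) : mdzbar B p = mcd Complex.I B p := rfl

theorem mcd_congr (hU : IsOpen U) {B : ℝ × ℝ → Matrix ι κ ℂ} (hAB : ∀ p ∈ U, A p = B p) (ε : ℂ)
    {p : ℝ × ℝ} (hp : p ∈ U) : mcd ε A p = mcd ε B p := by
  ext i k
  exact cd_congr hU (fun q hq => by rw [hAB q hq]) ε hp

theorem MSmooth.congr {B : ℝ × ℝ → Matrix ι κ ℂ} (hA : MSmooth U A) (hAB : ∀ p ∈ U, B p = A p) :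
    MSmooth U B := fun i k => (hA i k).congr fun p hp => by rw [hAB p hp]

theorem ContDiffOn.differentiableAt_of_isOpen {f : ℝ × ℝ → ℂ} (hf : ContDiffOn ℝ ∞ f U)
    (hU : IsOpen U) {p : ℝ × ℝ} (hp : p ∈ U) : DifferentiableAt ℝ f p :=
  (hf.contDiffAt (hU.mem_nhds hp)).differentiableAt (by simp)

theorem MSmooth.differentiableAt (hA : MSmooth U A) (hU : IsOpen U) {p : ℝ × ℝ} (hp : p ∈ U)
    (i : ι) (k : κ) : DifferentiableAt ℝ (fun q => A q i k) p :=
  ContDiffOn.differentiableAt_of_isOpen (hA i k) hU hp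

theorem MSmooth.const (B : Matrix ι κ ℂ) : MSmooth U fun _ => B := fun _ _ => contDiffOn_const

theorem MSmooth.transpose (hA : MSmooth U A) : MSmooth U fun p => (A p)ᵀ := fun i k => hA k i

theorem MSmooth.sub {B : ℝ × ℝ → Matrix ι κ ℂ} (hA : MSmooth U A) (hB : MSmooth U B) :
    MSmooth U fun p => A p - B p := fun i k => (hA i k).sub (hB i k)

theorem MSmooth.mul [Fintype κ] {B : ℝ × ℝ → Matrix κ τ ℂ} (hA : MSmooth U A) (hB : MSmooth U B) :
    MSmooth U fun p => A p * B p := fun i k => by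
  simp only [mul_apply]
  exact ContDiffOn.sum fun l _ => (hA i l).mul (hB l k)

theorem contDiffOn_cd (hU : IsOpen U) {f : ℝ × ℝ → ℂ} (hf : ContDiffOn ℝ ∞ f U) (ε : ℂ) :
    ContDiffOn ℝ ∞ (cd ε f) U := by
  have h : ContDiffOn ℝ ∞ (fderiv ℝ f) U := hf.fderiv_of_isOpen hU (by simp)
  exact (h.clm_apply contDiffOn_const).add
    (contDiffOn_const.mul (h.clm_apply contDiffOn_const))

theorem MSmooth.mcd (hU : IsOpen U) (hA : MSmooth U A) (ε : ℂ) :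
    MSmooth U (EllipticToda.mcd ε A) := fun i k => contDiffOn_cd hU (hA i k) ε

theorem mcd_const (ε : ℂ) (B : Matrix ι κ ℂ) (p : ℝ × ℝ) : mcd ε (fun _ => B) p = 0 := by
  ext i k; exact cd_const _ _ _

theorem mcd_transpose (ε : ℂ) (p : ℝ × ℝ) : mcd ε (fun q => (A q)ᵀ) p = (mcd ε A p)ᵀ := rfl

section

variable (hU : IsOpen U) {p : ℝ × ℝ} (hp : p ∈ U) (hA : MSmooth U A) (ε : ℂ)
include hU hp hA

theorem mcd_add {B : ℝ × ℝ → Matrix ι κ ℂ} (hB : MSmooth U B) :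
    mcd ε (fun q => A q + B q) p = mcd ε A p + mcd ε B p := by
  ext i k
  exact cd_add ε (hA.differentiableAt hU hp i k) (hB.differentiableAt hU hp i k)

theorem mcd_mul [Fintype κ] {B : ℝ × ℝ → Matrix κ τ ℂ} (hB : MSmooth U B) :
    mcd ε (fun q => A q * B q) p = mcd ε A p * B p + A p * mcd ε B p := by
  ext i k
  simp only [mcd, mul_apply, of_apply, Matrix.add_apply]
  rw [cd_sum, ← Finset.sum_add_distrib]
  · exact Finset.sum_congr rfl fun l _ =>
      cd_mul ε (hA.differentiableAt hU hp i l) (hB.differentiableAt hU hp l k)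
  · exact fun l _ => (hA.differentiableAt hU hp i l).mul (hB.differentiableAt hU hp l k)

theorem mcd_mul_const [Fintype κ] (B : Matrix κ τ ℂ) :
    mcd ε (fun q => A q * B) p = mcd ε A p * B := by
  rw [mcd_mul hU hp hA ε (MSmooth.const B), mcd_const, Matrix.mul_zero, add_zero]

theorem mcd_const_mul [Fintype ι] (B : Matrix τ ι ℂ) :
    mcd ε (fun q => B * A q) p = B * mcd ε A p := by
  rw [mcd_mul hU hp (MSmooth.const B) ε hA, mcd_const, Matrix.zero_mul, zero_add]

theorem mcd_sub {B : ℝ × ℝ → Matrix ι κ ℂ} (hB : MSmooth U B) :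
    mcd ε (fun q => A q - B q) p = mcd ε A p - mcd ε B p := by
  have h1 : MSmooth U fun q => A q - B q := hA.sub hB
  have h2 := mcd_add hU hp h1 ε hB
  have h3 : mcd ε (fun q => A q - B q + B q) p = mcd ε A p := by
    congr 1; ext q; simp
  rw [h3] at h2
  exact (sub_eq_of_eq_add h2).symm

end

theorem MSmooth.inv [Fintype ι] [DecidableEq ι] {B : ℝ × ℝ → Matrix ι ι ℂ} (hB : MSmooth U B)
    (hu : ∀ p ∈ U, IsUnit (B p)) : MSmooth U fun p => (B p)⁻¹ := by
  have hdet : ∀ C : ℝ × ℝ → Matrix ι ι ℂ, MSmooth U C → ContDiffOn ℝ ∞ (fun p => (C p).det) U := by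
    intro C hC
    simp only [det_apply]
    exact ContDiffOn.sum fun σ _ => (contDiffOn_prod fun i _ => hC _ _).const_smul _
  intro i k
  simp only [inv_def, Ring.inverse_eq_inv', Matrix.smul_apply, smul_eq_mul, adjugate_apply]
  refine (ContDiffOn.inv (hdet B hB) fun p hp => ?_).mul (hdet _ fun a b => ?_)
  · exact ((isUnit_iff_isUnit_det _).1 (hu p hp)).ne_zero
  · simp only [updateRow_apply]
    split_ifs
    · exact contDiffOn_const
    · exact hB a b

theorem mcd_inv [Fintype ι] [DecidableEq ι] {B : ℝ × ℝ → Matrix ι ι ℂ} (hU : IsOpen U)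
    {p : ℝ × ℝ} (hp : p ∈ U) (hB : MSmooth U B) (hu : ∀ p ∈ U, IsUnit (B p)) (ε : ℂ) :
    mcd ε (fun q => (B q)⁻¹) p = -((B p)⁻¹ * mcd ε B p * (B p)⁻¹) := by
  have hd : ∀ q ∈ U, IsUnit (B q).det := fun q hq => (isUnit_iff_isUnit_det _).1 (hu q hq)
  have h1 : mcd ε (fun q => B q * (B q)⁻¹) p = 0 := by
    rw [mcd_congr hU (B := fun _ => 1) (fun q hq => mul_nonsing_inv _ (hd q hq)) ε hp, mcd_const]
  rw [mcd_mul hU hp hB ε (hB.inv hu)] at h1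
  have h2 := congrArg ((B p)⁻¹ * ·) (eq_neg_of_add_eq_zero_right h1)
  simp only [← Matrix.mul_assoc, nonsing_inv_mul _ (hd p hp), Matrix.one_mul] at h2
  rw [h2, Matrix.mul_neg, Matrix.mul_assoc]

end

/-! ### Symmetries of the Lax pair -/

section

variable {N : ℕ} [NeZero N] {r : ZMod N → ℕ} {m : ℤ}
variable {J : Matrix (Idx N r) (Idx N r) ℂ} {U : Set (ℝ × ℝ)}
  {V : ℝ × ℝ → Matrix (Idx N r) (Idx N r) ℂ} {μ : ℂ} {H H' : ℝ × ℝ → Idx N r → ℂ}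
variable (hr : ∀ j, r j = 1 ∨ (r j = 2 ∧ 2 * j = (m : ZMod N)))

theorem ec_eq_one {x : ZMod N} (hx : ec x = 1) : x = 0 := by
  apply ZMod.injective_stdAddChar (N := N)
  rw [AddChar.map_zero_eq_one]
  exact hx

/-- The conditions on the constant matrix `J` of the Toda system. -/
structure IsTodaMatrix (N : ℕ) [NeZero N] (r : ZMod N → ℕ) (m : ℤ)
    (J : Matrix (Idx N r) (Idx N r) ℂ) : Prop where
  real : J.map conj = J
  reflect : Kmat N r m * J * Kmat N r m = Jᵀ
  grade : Om N r * J * (Om N r)⁻¹ = omega N • J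

theorem IsTodaMatrix.conj_apply (hJ : IsTodaMatrix N r m J) (i k : Idx N r) :
    conj (J i k) = J i k := congrFun (congrFun hJ.real i) k

theorem IsTodaMatrix.flip_apply (hJ : IsTodaMatrix N r m J) (i k : Idx N r) :
    J (flip hr i) (flip hr k) = J k i := by
  have h := congrFun (congrFun hJ.reflect i) k
  rwa [mul_Kmat_apply hr, Kmat_mul_apply hr] at h

/-- The matrix `J` raises the block number by one. -/
theorem IsTodaMatrix.eq_zero (hJ : IsTodaMatrix N r m J) (i k : Idx N r) (hk : k.1 ≠ i.1 + 1) :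
    J i k = 0 := by
  have h := congrFun (congrFun hJ.grade i) k
  rw [Om_inv, Om_eq, mul_diagonal, diagonal_mul, Matrix.smul_apply, smul_eq_mul, omega_eq_ec] at h
  by_contra h0
  apply hk
  have e : ec (1 - i.1) * J i k * ec (-(1 - k.1)) =
      ec (1 : ZMod N) * (ec (k.1 - i.1 - 1) * J i k) := by
    have : ec (1 : ZMod N) * (ec (k.1 - i.1 - 1) * J i k) =
        (ec (1 : ZMod N) * ec (k.1 - i.1 - 1)) * J i k := by ring
    rw [this, mul_right_comm, ← ec_add, ← ec_add]
    congr 2; ring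
  rw [e] at h
  have h2 := mul_left_cancel₀ (ec_ne_zero 1) h
  have h3 := ec_eq_one (mul_right_cancel₀ h0 (h2.trans (one_mul _).symm))
  linear_combination h3

theorem IsTodaSolution.isPotential (hV : IsTodaSolution N r m J U V) {p : ℝ × ℝ} (hp : p ∈ U) :
    IsPotential N r m (V p) := ⟨hV.diag p hp, hV.real p hp, hV.orth p hp⟩

theorem Qmat_apply {W : ℝ × ℝ → Matrix (Idx N r) (Idx N r) ℂ} {p : ℝ × ℝ}
    (hW : IsPotential N r m (W p)) (i k : Idx N r) :
    Qmat J W p i k = W p i i * J k i * W p (flip hr k) (flip hr k) := by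
  rw [Qmat, hW.inv_eq hr, mul_diagonal]
  congr 1
  conv_lhs => rw [hW.eq_diagonal]
  rw [diagonal_mul, transpose_apply]

include hr in
theorem Pmat_apply_ne (hU : IsOpen U) (hV : IsTodaSolution N r m J U V) {p : ℝ × ℝ} (hp : p ∈ U)
    {i k : Idx N r} (hik : i ≠ k) : Pmat V p i k = 0 := by
  rw [Pmat, (hV.isPotential hp).inv_eq hr, mul_diagonal, mdz_eq_mcd]
  have : mcd (-Complex.I) V p i k = 0 := by
    rw [mcd, of_apply, cd_congr hU (g := fun _ => 0) (fun q hq => hV.diag q hq hik) _ hp, cd_const]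
  rw [this, zero_mul]

theorem Pmat_apply_self (hV : IsTodaSolution N r m J U V) {p : ℝ × ℝ} (hp : p ∈ U)
    (i : Idx N r) : Pmat V p i i =
      cd (-Complex.I) (fun q => V q i i) p * V p (flip hr i) (flip hr i) := by
  rw [Pmat, (hV.isPotential hp).inv_eq hr, mul_diagonal, mdz_eq_mcd]
  rfl

/-- The derivative of `v_i v_{κ i} = 1`. -/
theorem cd_V_flip (hU : IsOpen U) (hV : IsTodaSolution N r m J U V) {p : ℝ × ℝ} (hp : p ∈ U)
    (ε : ℂ) (i : Idx N r) :
    cd ε (fun q => V q i i) p * V p (flip hr i) (flip hr i) +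
      V p i i * cd ε (fun q => V q (flip hr i) (flip hr i)) p = 0 := by
  have hd : ∀ i, DifferentiableAt ℝ (fun q => V q i i) p := fun i =>
    ContDiffOn.differentiableAt_of_isOpen (hV.smooth i i) hU hp
  rw [← cd_mul ε (hd _) (hd _), cd_congr hU (g := fun _ => 1)
    (fun q hq => (hV.isPotential hq).mul_flip hr i) ε hp, cd_const]

/-- The action of `Ω ^ x` on columns. -/
noncomputable def rot (x : ZMod N) (v : Idx N r → ℂ) : Idx N r → ℂ :=
  fun i => ec (x * (1 - i.1)) * v i

/-- The antilinear map `v ↦ K V⁻¹ conj v` on columns. -/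
noncomputable def dual (W : Matrix (Idx N r) (Idx N r) ℂ) (v : Idx N r → ℂ) : Idx N r → ℂ :=
  fun i => W i i * conj (v (flip hr i))

theorem orbit_inl_eq_rot (W : Matrix (Idx N r) (Idx N r) ℂ) (v : Idx N r → ℂ) (j : Fin N) :
    orbit N r m W v (.inl j) = rot ((j : ℕ) : ZMod N) v := by
  ext i; rw [orbit_inl, rot]

theorem orbit_inr_eq_dual {W : Matrix (Idx N r) (Idx N r) ℂ} (hW : IsPotential N r m W)
    (v : Idx N r → ℂ) (j : Fin N) :
    orbit N r m W v (.inr j) = dual hr W (rot ((j : ℕ) : ZMod N) v) := by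
  ext i
  rw [orbit_inr _ hr hW, dual, rot, map_mul, conj_ec, flip_fst]
  have e : ((j : ℕ) : ZMod N) * (m - 1 - i.1) = -(((j : ℕ) : ZMod N) * (1 - (m - i.1))) := by ring
  rw [e]; ring

theorem rot_mulVec_J (hJ : IsTodaMatrix N r m J) (x : ZMod N) (v : Idx N r → ℂ) :
    rot x (J *ᵥ v) = ec x • (J *ᵥ rot x v) := by
  ext i
  simp only [rot, mulVec, dotProduct, Pi.smul_apply, smul_eq_mul, Finset.mul_sum]
  refine Finset.sum_congr rfl fun k _ => ?_
  by_cases hk : k.1 = i.1 + 1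
  · have e : ec (x * (1 - i.1)) = ec x * ec (x * (1 - k.1)) := by
      rw [← ec_add, hk]; congr 1; ring
    rw [e]; ring
  · rw [hJ.eq_zero i k hk]; ring

include hr in
theorem rot_mulVec_Q (hJ : IsTodaMatrix N r m J) {p : ℝ × ℝ} (hV : IsPotential N r m (V p))
    (x : ZMod N) (v : Idx N r → ℂ) :
    rot x (Qmat J V p *ᵥ v) = ec (-x) • (Qmat J V p *ᵥ rot x v) := by
  ext i
  simp only [rot, mulVec, dotProduct, Pi.smul_apply, smul_eq_mul, Finset.mul_sum]
  refine Finset.sum_congr rfl fun k _ => ?_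
  by_cases hk : i.1 = k.1 + 1
  · have e : ec (x * (1 - i.1)) = ec (-x) * ec (x * (1 - k.1)) := by
      rw [← ec_add, hk]; congr 1; ring
    rw [e]; ring
  · rw [Qmat_apply hr hV, hJ.eq_zero k i hk]; ring

include hr in
theorem Pmat_mulVec (hU : IsOpen U) (hV : IsTodaSolution N r m J U V) {p : ℝ × ℝ} (hp : p ∈ U)
    (v : Idx N r → ℂ) (i : Idx N r) : (Pmat V p *ᵥ v) i = Pmat V p i i * v i := by
  rw [mulVec, dotProduct]
  exact Finset.sum_eq_single i
    (fun k _ hk => by rw [Pmat_apply_ne hr hU hV hp (Ne.symm hk), zero_mul]) (by simp)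

include hr in
theorem rot_mulVec_P (hU : IsOpen U) (hV : IsTodaSolution N r m J U V) {p : ℝ × ℝ} (hp : p ∈ U)
    (x : ZMod N) (v : Idx N r → ℂ) : rot x (Pmat V p *ᵥ v) = Pmat V p *ᵥ rot x v := by
  ext i
  rw [rot, Pmat_mulVec hr hU hV hp, Pmat_mulVec hr hU hV hp, rot]
  ring

theorem dual_mulVec_Q (hJ : IsTodaMatrix N r m J) {p : ℝ × ℝ} (hV : IsPotential N r m (V p))
    (v : Idx N r → ℂ) : dual hr (V p) (Qmat J V p *ᵥ v) = J *ᵥ dual hr (V p) v := by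
  ext i
  simp only [dual, mulVec, dotProduct, map_sum, map_mul, Finset.mul_sum]
  rw [← sum_flip hr]
  refine Finset.sum_congr rfl fun k _ => ?_
  rw [Qmat_apply hr hV, flip_flip, hJ.flip_apply hr]
  simp only [map_mul, hV.conj_apply, hJ.conj_apply]
  linear_combination (J i k * V p k k * conj (v (flip hr k))) * hV.mul_flip hr i

theorem dual_mulVec_J (hJ : IsTodaMatrix N r m J) {p : ℝ × ℝ} (hV : IsPotential N r m (V p))
    (v : Idx N r → ℂ) : dual hr (V p) (J *ᵥ v) = Qmat J V p *ᵥ dual hr (V p) v := by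
  ext i
  simp only [dual, mulVec, dotProduct, map_sum, map_mul, Finset.mul_sum]
  rw [← sum_flip hr]
  refine Finset.sum_congr rfl fun k _ => ?_
  rw [Qmat_apply hr hV, hJ.flip_apply hr, hJ.conj_apply]
  linear_combination (-V p i i * J k i * conj (v (flip hr k))) * hV.mul_flip hr k

theorem dot_dual {W : Matrix (Idx N r) (Idx N r) ℂ} (hW : IsPotential N r m W)
    (x y : Idx N r → ℂ) : dual hr W x ⬝ᵥ (Kmat N r m *ᵥ dual hr W y) =
      conj (x ⬝ᵥ (Kmat N r m *ᵥ y)) := by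
  rw [dot_Kmat hr, dot_Kmat hr, map_sum, ← sum_flip hr]
  refine Finset.sum_congr rfl fun i _ => ?_
  simp only [dual, flip_flip, map_mul]
  linear_combination (conj (x (flip hr i)) * conj (y i)) * hW.mul_flip hr i

theorem IsLaxSolution.differentiableAt (hH : IsLaxSolution J U V μ H) (hU : IsOpen U)
    {p : ℝ × ℝ} (hp : p ∈ U) (i : Idx N r) : DifferentiableAt ℝ (fun q => H q i) p :=
  ContDiffOn.differentiableAt_of_isOpen (hH.smooth i) hU hp

theorem IsLaxSolution.congr (hU : IsOpen U) {G : ℝ × ℝ → Idx N r → ℂ}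
    (hH : IsLaxSolution J U V μ H) (hG : ∀ p ∈ U, G p = H p) : IsLaxSolution J U V μ G where
  smooth i := (hH.smooth i).congr fun p hp => by rw [hG p hp]
  eq_z p hp := by
    rw [hG p hp, ← hH.eq_z p hp]
    ext i
    rw [dz_eq_cd, dz_eq_cd]
    exact cd_congr hU (fun q hq => by rw [hG q hq]) _ hp
  eq_zbar p hp := by
    rw [hG p hp, ← hH.eq_zbar p hp]
    ext i
    exact cd_congr hU (fun q hq => by rw [hG q hq]) _ hp

include hr in
/-- The rotation `Ω ^ x` maps solutions at `lam` to solutions at `ω ^ x lam`. -/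
theorem IsLaxSolution.rot (hJ : IsTodaMatrix N r m J) (hU : IsOpen U)
    (hV : IsTodaSolution N r m J U V) (hH : IsLaxSolution J U V μ H) (x : ZMod N) :
    IsLaxSolution J U V (ec x * μ) (fun p => rot x (H p)) where
  smooth i := contDiffOn_const.mul (hH.smooth i)
  eq_z p hp := by
    have e : (fun i => dz (fun q => EllipticToda.rot x (H q) i) p) =
        EllipticToda.rot x (fun i => dz (fun q => H q i) p) := by
      ext i
      rw [dz_eq_cd, EllipticToda.rot, dz_eq_cd]
      exact cd_const_mul _ _ (hH.differentiableAt hU hp i)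
    rw [e, hH.eq_z p hp, Matrix.add_mulVec, Matrix.add_mulVec, ← rot_mulVec_P hr hU hV hp,
      smul_mulVec, smul_mulVec, mul_smul, smul_comm, ← rot_mulVec_J hJ]
    ext i
    simp only [EllipticToda.rot, Pi.add_apply, Pi.smul_apply, smul_eq_mul]
    ring
  eq_zbar p hp := by
    have e : (fun i => dzbar (fun q => EllipticToda.rot x (H q) i) p) =
        EllipticToda.rot x (fun i => dzbar (fun q => H q i) p) := by
      ext i
      exact cd_const_mul _ _ (hH.differentiableAt hU hp i)
    rw [e, hH.eq_zbar p hp, mul_inv, ← ec_neg, mul_smul, smul_comm,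
      ← rot_mulVec_Q hr hJ (hV.isPotential hp)]
    ext i
    simp only [EllipticToda.rot, Pi.smul_apply, smul_eq_mul]
    ring

/-- The map `v ↦ K V⁻¹ conj v` maps solutions at `lam` to solutions at `1 / conj lam`. -/
theorem IsLaxSolution.dual (hJ : IsTodaMatrix N r m J) (hU : IsOpen U)
    (hV : IsTodaSolution N r m J U V) (hH : IsLaxSolution J U V μ H) :
    IsLaxSolution J U V (conj μ)⁻¹ (fun p => dual hr (V p) (H p)) where
  smooth i := (hV.smooth i i).mul
    (Complex.conjCLE.contDiff.comp_contDiffOn (hH.smooth (flip hr i)))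
  eq_z p hp := by
    have hP := hV.isPotential hp
    have hd : ∀ i, DifferentiableAt ℝ (fun q => conj (H q i)) p := fun i =>
      Complex.conjCLE.differentiableAt.comp p (hH.differentiableAt hU hp i)
    have hdV : ∀ i, DifferentiableAt ℝ (fun q => V q i i) p := fun i =>
      ContDiffOn.differentiableAt_of_isOpen (hV.smooth i i) hU hp
    have hz := hH.eq_zbar p hp
    rw [Matrix.add_mulVec, smul_mulVec, ← dual_mulVec_Q hr hJ hP]
    ext i
    have hzi := congrFun hz (flip hr i)
    rw [dzbar_eq_cd, Pi.smul_apply, smul_eq_mul] at hzi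
    have hc : conj (-Complex.I) = Complex.I := by simp
    rw [dz_eq_cd, Pi.add_apply, Pmat_mulVec hr hU hV hp, Pmat_apply_self hr hV hp]
    simp only [EllipticToda.dual, Pi.smul_apply, smul_eq_mul]
    rw [cd_mul _ (hdV i) (hd _), cd_conj _ (hH.differentiableAt hU hp _), hc, hzi, map_mul,
        map_inv₀]
    linear_combination (-cd (-Complex.I) (fun q => V q i i) p * conj (H p (flip hr i))) *
      hP.mul_flip hr i
  eq_zbar p hp := by
    have hP := hV.isPotential hp
    have hd : ∀ i, DifferentiableAt ℝ (fun q => conj (H q i)) p := fun i =>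
      Complex.conjCLE.differentiableAt.comp p (hH.differentiableAt hU hp i)
    have hdV : ∀ i, DifferentiableAt ℝ (fun q => V q i i) p := fun i =>
      ContDiffOn.differentiableAt_of_isOpen (hV.smooth i i) hU hp
    have hz := hH.eq_z p hp
    rw [inv_inv, ← dual_mulVec_J hr hJ hP]
    ext i
    have hzi := congrFun hz (flip hr i)
    rw [dz_eq_cd, Matrix.add_mulVec, Pi.add_apply, smul_mulVec, Pi.smul_apply, smul_eq_mul,
      Pmat_mulVec hr hU hV hp, Pmat_apply_self hr hV hp, flip_flip] at hzi
    have hc : conj Complex.I = -Complex.I := by simp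
    have hcV : conj (cd (-Complex.I) (fun q => V q (flip hr i) (flip hr i)) p) =
        cd Complex.I (fun q => V q (flip hr i) (flip hr i)) p := by
      rw [← hc, ← cd_conj _ (hdV _)]
      exact cd_congr hU (fun q hq => (hV.isPotential hq).conj_apply _ _) _ hp
    rw [dzbar_eq_cd]
    simp only [EllipticToda.dual, Pi.smul_apply, smul_eq_mul]
    rw [cd_mul _ (hdV i) (hd _), cd_conj _ (hH.differentiableAt hU hp _), hc, hzi]
    simp only [map_add, map_mul, hcV, hP.conj_apply]
    have h1 := cd_V_flip hr hU hV hp Complex.I i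
    linear_combination (V p i i * conj (H p (flip hr i))) * h1 -
      (cd Complex.I (fun q => V q i i) p * conj (H p (flip hr i))) * hP.mul_flip hr i

include hr in
/-- All the columns `H_s` are solutions of the Lax pair. -/
theorem IsLaxSolution.orbit (hJ : IsTodaMatrix N r m J) (hU : IsOpen U)
    (hV : IsTodaSolution N r m J U V) (hH : IsLaxSolution J U V μ H) (s : Fin N ⊕ Fin N) :
    IsLaxSolution J U V (spec N μ s) (fun p => orbit N r m (V p) (H p) s) := by
  rcases s with j | j
  · rw [spec_inl]
    exact (hH.rot hr hJ hU hV _).congr hU fun p _ => orbit_inl_eq_rot _ _ _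
  · have h := (hH.rot hr hJ hU hV ((j : ℕ) : ZMod N)).dual hr hJ hU hV
    have e : (conj (ec ((j : ℕ) : ZMod N) * μ))⁻¹ = spec N μ (.inr j) := by
      rw [spec_inr, map_mul, conj_ec, mul_inv, ec_neg, inv_inv]
    rw [e] at h
    exact h.congr hU fun p hp => orbit_inr_eq_dual hr (hV.isPotential hp) _ _

end

/-! ### Derivatives of `Γ` -/

section

variable {N : ℕ} [NeZero N] {r : ZMod N → ℕ} {m : ℤ}
variable {J : Matrix (Idx N r) (Idx N r) ℂ} {U : Set (ℝ × ℝ)}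
  {V : ℝ × ℝ → Matrix (Idx N r) (Idx N r) ℂ} {μ : ℂ} {H H' : ℝ × ℝ → Idx N r → ℂ}
variable (hr : ∀ j, r j = 1 ∨ (r j = 2 ∧ 2 * j = (m : ZMod N)))

section algebra

include hr

/-- `J` is symmetric with respect to the form of `K`. -/
theorem IsTodaMatrix.transpose_mul_Kmat (hJ : IsTodaMatrix N r m J) :
    Jᵀ * Kmat N r m = Kmat N r m * J := by
  rw [← hJ.reflect, Matrix.mul_assoc, Kmat_mul_self hr, Matrix.mul_one]

/-- `Q` is symmetric with respect to the form of `K`. -/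
theorem Qmat_transpose_mul_Kmat (hJ : IsTodaMatrix N r m J) {p : ℝ × ℝ}
    (hV : IsPotential N r m (V p)) :
    (Qmat J V p)ᵀ * Kmat N r m = Kmat N r m * Qmat J V p := by
  ext i k
  rw [mul_Kmat_apply hr, Kmat_mul_apply hr, transpose_apply, Qmat_apply hr hV, Qmat_apply hr hV,
    ← hJ.flip_apply hr, flip_flip]
  ring

/-- `P` is skew with respect to the form of `K`. -/
theorem Pmat_transpose_mul_Kmat (hU : IsOpen U) (hV : IsTodaSolution N r m J U V) {p : ℝ × ℝ}
    (hp : p ∈ U) : (Pmat V p)ᵀ * Kmat N r m = -(Kmat N r m * Pmat V p) := by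
  ext i k
  rw [mul_Kmat_apply hr, Matrix.neg_apply, Kmat_mul_apply hr, transpose_apply]
  by_cases hik : flip hr k = i
  · subst hik
    rw [flip_flip, Pmat_apply_self hr hV hp, Pmat_apply_self hr hV hp, flip_flip]
    have := cd_V_flip hr hU hV hp (-Complex.I) k
    linear_combination this
  · rw [Pmat_apply_ne hr hU hV hp hik, Pmat_apply_ne hr hU hV hp, neg_zero]
    intro h
    exact hik (by rw [← h, flip_flip])

end algebra

theorem mulVec_dot (A : Matrix (Idx N r) (Idx N r) ℂ) (a w : Idx N r → ℂ) :
    (A *ᵥ a) ⬝ᵥ w = a ⬝ᵥ (Aᵀ *ᵥ w) := by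
  rw [← vecMul_transpose, ← dotProduct_mulVec]

/-- `∂_lam Φ` at `lam = μ` for a family `Φ` of solutions of the Lax pair: the equations obtained
by differentiating the Lax pair in `lam`. -/
structure IsLaxDerivative (J : Matrix (Idx N r) (Idx N r) ℂ) (U : Set (ℝ × ℝ))
    (V : ℝ × ℝ → Matrix (Idx N r) (Idx N r) ℂ) (μ : ℂ) (H H' : ℝ × ℝ → Idx N r → ℂ) : Prop where
  smooth : ∀ i, ContDiffOn ℝ ∞ (fun p => H' p i) U
  eq_z : ∀ p ∈ U, (fun i => dz (fun q => H' q i) p) =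
    (μ • J + Pmat V p) *ᵥ H' p + J *ᵥ H p
  eq_zbar : ∀ p ∈ U, (fun i => dzbar (fun q => H' q i) p) =
    μ⁻¹ • (Qmat J V p *ᵥ H' p) - μ⁻¹ ^ 2 • (Qmat J V p *ᵥ H p)

theorem cd_dot_Kmat {a b : ℝ × ℝ → Idx N r → ℂ} {p : ℝ × ℝ} (ε : ℂ)
    (ha : ∀ i, DifferentiableAt ℝ (fun q => a q i) p)
    (hb : ∀ i, DifferentiableAt ℝ (fun q => b q i) p) :
    cd ε (fun q => a q ⬝ᵥ (Kmat N r m *ᵥ b q)) p =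
      (fun i => cd ε (fun q => a q i) p) ⬝ᵥ (Kmat N r m *ᵥ b p) +
        a p ⬝ᵥ (Kmat N r m *ᵥ fun i => cd ε (fun q => b q i) p) := by
  have hb' : ∀ i, DifferentiableAt ℝ (fun q => (Kmat N r m *ᵥ b q) i) p := fun i => by
    simp only [mulVec, dotProduct]
    exact DifferentiableAt.fun_sum fun k _ => (differentiableAt_const _).mul (hb k)
  simp only [dotProduct]
  rw [cd_sum ε _ fun i _ => (ha i).fun_mul (hb' i), ← Finset.sum_add_distrib]
  refine Finset.sum_congr rfl fun i _ => ?_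
  rw [cd_mul ε (ha i) (hb' i)]
  congr 2
  simp only [mulVec, dotProduct]
  rw [cd_sum ε _ fun k _ => (differentiableAt_const _).fun_mul (hb k)]
  exact Finset.sum_congr rfl fun k _ => cd_const_mul ε _ (hb k)

section lax

variable (hJ : IsTodaMatrix N r m J) (hU : IsOpen U) (hV : IsTodaSolution N r m J U V)
  (hH : IsLaxSolution J U V μ H)

include hr hJ hU hV hH

theorem smooth_orbitMat : MSmooth U fun p => orbitMat m (V p) (H p) :=
  fun i s => (hH.orbit hr hJ hU hV s).smooth i

variable {p : ℝ × ℝ} (hp : p ∈ U)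
include hp

theorem mcd_orbitMat_z : mcd (-Complex.I) (fun p => orbitMat m (V p) (H p)) p =
    J * orbitMat m (V p) (H p) * specMat N μ + Pmat V p * orbitMat m (V p) (H p) := by
  ext i s
  have h := congrFun ((hH.orbit hr hJ hU hV s).eq_z p hp) i
  rw [dz_eq_cd] at h
  rw [mcd, of_apply, Matrix.add_apply, specMat, mul_diagonal]
  refine h.trans ?_
  rw [Matrix.add_mulVec, smul_mulVec, Pi.add_apply, Pi.smul_apply, smul_eq_mul, mul_comm]
  rfl

theorem mcd_orbitMat_zbar : mcd Complex.I (fun p => orbitMat m (V p) (H p)) p =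
    Qmat J V p * orbitMat m (V p) (H p) * specInv N μ := by
  ext i s
  have h := congrFun ((hH.orbit hr hJ hU hV s).eq_zbar p hp) i
  rw [dzbar_eq_cd] at h
  rw [mcd, of_apply, specInv, mul_diagonal]
  refine h.trans ?_
  rw [Pi.smul_apply, smul_eq_mul, mul_comm]
  rfl

/-- In the derivative of the Gram matrix `Xᵀ K X` the terms with `P` cancel. -/
theorem mcd_gram_z :
    mcd (-Complex.I) (fun p => (orbitMat m (V p) (H p))ᵀ * Kmat N r m * orbitMat m (V p) (H p)) p =
      specMat N μ * ((orbitMat m (V p) (H p))ᵀ * (Kmat N r m * J) * orbitMat m (V p) (H p)) +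
      ((orbitMat m (V p) (H p))ᵀ * (Kmat N r m * J) * orbitMat m (V p) (H p)) * specMat N μ := by
  have hs := smooth_orbitMat hr hJ hU hV hH
  rw [mcd_mul hU hp (hs.transpose.mul (MSmooth.const _)) _ hs, mcd_mul_const hU hp hs.transpose,
    mcd_transpose, mcd_orbitMat_z hr hJ hU hV hH hp]
  have hP := Pmat_transpose_mul_Kmat hr hU hV hp
  have hJt := hJ.transpose_mul_Kmat hr
  have hD : (specMat N μ)ᵀ = specMat N μ := diagonal_transpose _
  generalize orbitMat m (V p) (H p) = X at *
  generalize Pmat V p = P at *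
  generalize specMat N μ = D at *
  generalize Kmat N r m = K at *
  rw [transpose_add, transpose_mul, transpose_mul, transpose_mul, hD]
  calc (D * (Xᵀ * Jᵀ) + Xᵀ * Pᵀ) * K * X + Xᵀ * K * (J * X * D + P * X)
      = D * (Xᵀ * ((Jᵀ * K) * X)) + Xᵀ * ((Pᵀ * K) * X) + Xᵀ * (K * (J * (X * D))) +
        Xᵀ * (K * (P * X)) := by
        simp only [Matrix.add_mul, Matrix.mul_add, Matrix.mul_assoc]
        abel
    _ = _ := by
      rw [hP, hJt]
      simp only [Matrix.mul_assoc, Matrix.mul_neg, Matrix.neg_mul]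
      abel

theorem mcd_gram_zbar :
    mcd Complex.I (fun p => (orbitMat m (V p) (H p))ᵀ * Kmat N r m * orbitMat m (V p) (H p)) p =
      specInv N μ *
        ((orbitMat m (V p) (H p))ᵀ * (Kmat N r m * Qmat J V p) * orbitMat m (V p) (H p)) +
      ((orbitMat m (V p) (H p))ᵀ * (Kmat N r m * Qmat J V p) * orbitMat m (V p) (H p)) *
        specInv N μ := by
  have hs := smooth_orbitMat hr hJ hU hV hH
  rw [mcd_mul hU hp (hs.transpose.mul (MSmooth.const _)) _ hs, mcd_mul_const hU hp hs.transpose,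
    mcd_transpose, mcd_orbitMat_zbar hr hJ hU hV hH hp]
  have hQ := Qmat_transpose_mul_Kmat hr hJ (hV.isPotential hp)
  have hD : (specInv N μ)ᵀ = specInv N μ := diagonal_transpose _
  generalize orbitMat m (V p) (H p) = X at *
  generalize Qmat J V p = Q at *
  generalize specInv N μ = D at *
  generalize Kmat N r m = K at *
  rw [transpose_mul, transpose_mul, hD]
  calc D * (Xᵀ * Qᵀ) * K * X + Xᵀ * K * (Q * X * D)
      = D * (Xᵀ * ((Qᵀ * K) * X)) + Xᵀ * (K * (Q * (X * D))) := by
        simp only [Matrix.mul_assoc]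
    _ = _ := by
      rw [hQ]
      simp only [Matrix.mul_assoc]

end lax

theorem gram_apply (W : Matrix (Idx N r) (Idx N r) ℂ) (A : Matrix (Idx N r) (Idx N r) ℂ)
    (v : Idx N r → ℂ) (s t : Fin N ⊕ Fin N) :
    ((orbitMat m W v)ᵀ * (Kmat N r m * A) * orbitMat m W v) s t =
      orbit N r m W v s ⬝ᵥ (Kmat N r m *ᵥ (A *ᵥ orbit N r m W v t)) := by
  rw [Matrix.mul_assoc, Matrix.mul_assoc]
  rfl

include hr in
/-- For even `m` the forms `K J` and `K Q` vanish on singular pairs of orbits. -/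
theorem dot_singular_eq_zero (hm : Even m) (A : Matrix (Idx N r) (Idx N r) ℂ)
    (hA : Aᵀ * Kmat N r m = Kmat N r m * A) (c : ZMod N → ℂ)
    (hrot : ∀ x v, A *ᵥ rot x v = c x • rot x (A *ᵥ v)) (j k : Fin N)
    (hjk : ec ((j : ℕ) : ZMod N) + ec ((k : ℕ) : ZMod N) = 0)
    (hcc : c ((k : ℕ) : ZMod N) = -c ((j : ℕ) : ZMod N)) (v : Idx N r → ℂ) :
    rot ((j : ℕ) : ZMod N) v ⬝ᵥ (Kmat N r m *ᵥ (A *ᵥ rot ((k : ℕ) : ZMod N) v)) = 0 := by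
  have hN := even_of_ec_add_eq_zero hjk
  have hsymm : rot ((j : ℕ) : ZMod N) v ⬝ᵥ (Kmat N r m *ᵥ (A *ᵥ rot ((k : ℕ) : ZMod N) v)) =
      rot ((k : ℕ) : ZMod N) v ⬝ᵥ (Kmat N r m *ᵥ (A *ᵥ rot ((j : ℕ) : ZMod N) v)) := by
    rw [mulVec_mulVec, ← hA, ← mulVec_mulVec, ← mulVec_dot, dotProduct_comm, ← vecMul_transpose,
      Kmat_transpose hr, ← dotProduct_mulVec]
  have h1 := dot_orbit_singular (m := m) (V := 0) hr v (A *ᵥ v) j k hjk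
  have h2 := dot_orbit_singular (m := m) (V := 0) hr v (A *ᵥ v) k j (by rw [add_comm]; exact hjk)
  rw [orbit_inl_eq_rot, orbit_inl_eq_rot] at h1 h2
  have e : ec (((k : ℕ) : ZMod N) * (1 - (m : ZMod N))) =
      -ec (((j : ℕ) : ZMod N) * (1 - (m : ZMod N))) := by
    have : ((k : ℕ) : ZMod N) * (1 - (m : ZMod N)) = ((j : ℕ) : ZMod N) * (1 - (m : ZMod N)) +
      (((k : ℕ) : ZMod N) - ((j : ℕ) : ZMod N)) * (1 - (m : ZMod N)) := by ring
    rw [this, ec_add, ec_mul_of_add_eq_zero hjk, sub_eq_add_neg, sgn_add hN, sgn_neg hN, sgn_one hN,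
      sgn_intCast hN, hm.neg_one_zpow]
    ring
  rw [hrot, mulVec_smul, dotProduct_smul, smul_eq_mul] at hsymm ⊢
  rw [hrot, mulVec_smul, dotProduct_smul, smul_eq_mul] at hsymm
  rw [h1, h2, hcc, e, eq_neg_of_add_eq_zero_right hjk] at hsymm
  rw [h1, hcc]
  linear_combination hsymm / 2

section deriv

variable (hJ : IsTodaMatrix N r m J) (hU : IsOpen U) (hV : IsTodaSolution N r m J U V)
  (hμ0 : μ ≠ 0) (hμ1 : ‖μ‖ ≠ 1) (hH : IsLaxSolution J U V μ H)
  (hc : Even N → Even m → ∀ p ∈ U, constraintForm N r m (H p) = 0)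
  (hH' : Even N → Odd m → IsLaxDerivative J U V μ H H')

include hr hJ hU hV hμ0 hH hc hH'

/-- The derivatives of the singular entries in the first group. The Sylvester equation says
nothing about them; for even `m` the entries vanish, for odd `m` they are `ω^(-j) (Ω^j h')ᵀ K Ω^k
h`, and the equations for `h'` apply. -/
theorem cd_gammaMat_singular (j k : Fin N)
    (hjk : ec ((j : ℕ) : ZMod N) + ec ((k : ℕ) : ZMod N) = 0) :
    ContDiffOn ℝ ∞ (fun p => gammaMat m μ (V p) (H p) (H' p) (.inl j) (.inl k)) U ∧ ∀ p ∈ U,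
      cd (-Complex.I) (fun p => gammaMat m μ (V p) (H p) (H' p) (.inl j) (.inl k)) p =
        rot ((j : ℕ) : ZMod N) (H p) ⬝ᵥ
          (Kmat N r m *ᵥ (J *ᵥ rot ((k : ℕ) : ZMod N) (H p))) ∧
      cd Complex.I (fun p => gammaMat m μ (V p) (H p) (H' p) (.inl j) (.inl k)) p =
        (spec N μ (.inl j))⁻¹ * (spec N μ (.inl k))⁻¹ * (rot ((j : ℕ) : ZMod N) (H p) ⬝ᵥ
          (Kmat N r m *ᵥ (Qmat J V p *ᵥ rot ((k : ℕ) : ZMod N) (H p)))) := by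
  have hN := even_of_ec_add_eq_zero hjk
  have hval : ∀ p ∈ U, gammaMat m μ (V p) (H p) (H' p) (.inl j) (.inl k) =
      (if Odd m then 1 else 0) * (ec (-((j : ℕ) : ZMod N)) *
        (rot ((j : ℕ) : ZMod N) (H' p) ⬝ᵥ (Kmat N r m *ᵥ rot ((k : ℕ) : ZMod N) (H p)))) := by
    intro p hp
    rw [gammaMat_singular μ _ _ hr hμ0 (fun h1 h2 => hc h1 h2 p hp) j k hjk, orbit_inl_eq_rot,
      orbit_inl_eq_rot]
  rcases Int.even_or_odd m with hm | hm
  · simp only [if_neg (Int.not_odd_iff_even.2 hm), zero_mul] at hval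
    refine ⟨contDiffOn_const.congr hval, fun p hp => ?_⟩
    have hP := hV.isPotential hp
    rw [cd_congr hU hval _ hp, cd_congr hU hval _ hp, cd_const, cd_const]
    have e1 := dot_singular_eq_zero hr hm J (hJ.transpose_mul_Kmat hr) (fun x => ec (-x))
      (fun x v => by rw [rot_mulVec_J hJ, smul_smul, ← ec_add]; simp) j k hjk
      (by simp only [ec_neg]; rw [eq_neg_of_add_eq_zero_right hjk, inv_neg]) (H p)
    have e2 := dot_singular_eq_zero hr hm (Qmat J V p) (Qmat_transpose_mul_Kmat hr hJ hP)
      (fun x => ec x) (fun x v => by rw [rot_mulVec_Q hr hJ hP, smul_smul, ← ec_add]; simp) j k hjk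
      (eq_neg_of_add_eq_zero_right hjk) (H p)
    rw [e1, e2, mul_zero]
    exact ⟨rfl, rfl⟩
  · have hL := hH' hN hm
    simp only [if_pos hm, one_mul] at hval
    set x := ((j : ℕ) : ZMod N)
    set y := ((k : ℕ) : ZMod N)
    have hy := hH.rot hr hJ hU hV y
    have hxs : ∀ i, ContDiffOn ℝ ∞ (fun p => rot x (H' p) i) U := fun i =>
      contDiffOn_const.mul (hL.smooth i)
    have hdot : ContDiffOn ℝ ∞ (fun p => rot x (H' p) ⬝ᵥ (Kmat N r m *ᵥ rot y (H p))) U := by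
      simp only [dot_Kmat hr]
      exact ContDiffOn.sum fun i _ => (hxs _).mul (hy.smooth _)
    refine ⟨(contDiffOn_const.mul hdot).congr hval, fun p hp => ?_⟩
    have hP := hV.isPotential hp
    have hxd : ∀ i, DifferentiableAt ℝ (fun p => rot x (H' p) i) p := fun i =>
      ContDiffOn.differentiableAt_of_isOpen (hxs i) hU hp
    have hder : ∀ ε, (fun i => cd ε (fun q => rot x (H' q) i) p) =
        rot x (fun i => cd ε (fun q => H' q i) p) := by
      intro ε
      ext i
      exact cd_const_mul _ _ (ContDiffOn.differentiableAt_of_isOpen (hL.smooth i) hU hp)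
    have hyx : ec y = -ec x := eq_neg_of_add_eq_zero_right hjk
    have hx0 := ec_ne_zero x
    rw [cd_congr hU hval _ hp, cd_congr hU hval _ hp,
      cd_const_mul _ _ (ContDiffOn.differentiableAt_of_isOpen hdot hU hp),
      cd_const_mul _ _ (ContDiffOn.differentiableAt_of_isOpen hdot hU hp),
      cd_dot_Kmat _ hxd (hy.differentiableAt hU hp), cd_dot_Kmat _ hxd (hy.differentiableAt hU hp),
      hder, hder]
    constructor
    · have e1 := hL.eq_z p hp
      have e2 := hy.eq_z p hp
      simp only [dz_eq_cd] at e1 e2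
      have e3 : rot x ((μ • J + Pmat V p) *ᵥ H' p + J *ᵥ H p) =
          (ec x * μ) • (J *ᵥ rot x (H' p)) + Pmat V p *ᵥ rot x (H' p) +
            ec x • (J *ᵥ rot x (H p)) := by
        rw [← rot_mulVec_P hr hU hV hp, mul_comm (ec x) μ, mul_smul, ← rot_mulVec_J hJ,
          ← rot_mulVec_J hJ, Matrix.add_mulVec, smul_mulVec]
        ext i
        simp only [rot, Pi.add_apply, Pi.smul_apply, smul_eq_mul]
        ring
      have hPd : (Pmat V p *ᵥ rot x (H' p)) ⬝ᵥ (Kmat N r m *ᵥ rot y (H p)) =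
          -(rot x (H' p) ⬝ᵥ (Kmat N r m *ᵥ (Pmat V p *ᵥ rot y (H p)))) := by
        rw [mulVec_dot, mulVec_mulVec, Pmat_transpose_mul_Kmat hr hU hV hp, neg_mulVec,
          dotProduct_neg, mulVec_mulVec]
      have hJd : ∀ a b : Idx N r → ℂ, (J *ᵥ a) ⬝ᵥ (Kmat N r m *ᵥ b) =
          a ⬝ᵥ (Kmat N r m *ᵥ (J *ᵥ b)) := by
        intro a b
        rw [mulVec_dot, mulVec_mulVec, hJ.transpose_mul_Kmat hr, mulVec_mulVec]
      rw [e1, e2, e3, Matrix.add_mulVec, smul_mulVec, mulVec_add, mulVec_smul, add_dotProduct,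
        add_dotProduct, smul_dotProduct, smul_dotProduct, dotProduct_add, dotProduct_smul, hPd,
        hJd, hJd, hyx, ec_neg]
      simp only [smul_eq_mul]
      field_simp
      ring
    · have e1 := hL.eq_zbar p hp
      have e2 := hy.eq_zbar p hp
      simp only [dzbar_eq_cd] at e1 e2
      have e3 : rot x (μ⁻¹ • (Qmat J V p *ᵥ H' p) - μ⁻¹ ^ 2 • (Qmat J V p *ᵥ H p)) =
          (μ⁻¹ * ec (-x)) • (Qmat J V p *ᵥ rot x (H' p)) -
            (μ⁻¹ ^ 2 * ec (-x)) • (Qmat J V p *ᵥ rot x (H p)) := by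
        rw [mul_smul, mul_smul, ← rot_mulVec_Q hr hJ hP, ← rot_mulVec_Q hr hJ hP]
        ext i
        simp only [rot, Pi.sub_apply, Pi.smul_apply, smul_eq_mul]
        ring
      have hQd : ∀ a b : Idx N r → ℂ, (Qmat J V p *ᵥ a) ⬝ᵥ (Kmat N r m *ᵥ b) =
          a ⬝ᵥ (Kmat N r m *ᵥ (Qmat J V p *ᵥ b)) := by
        intro a b
        rw [mulVec_dot, mulVec_mulVec, Qmat_transpose_mul_Kmat hr hJ hP, mulVec_mulVec]
      rw [e1, e2, e3, mulVec_smul, sub_dotProduct, smul_dotProduct, smul_dotProduct,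
        dotProduct_smul, hQd, hQd, spec_inl, spec_inl, hyx, ec_neg]
      simp only [smul_eq_mul]
      field_simp
      ring

include hμ1

/-- The derivatives `Γ_z = Xᵀ K J X` and `Γ_z̄ = D⁻¹ Xᵀ K Q X D⁻¹`, for the matrix `X` of the
columns `H_s` and the diagonal matrix `D` of the spectral parameters. -/
theorem gammaMat_deriv : MSmooth U (fun p => gammaMat m μ (V p) (H p) (H' p)) ∧ ∀ p ∈ U,
    mcd (-Complex.I) (fun p => gammaMat m μ (V p) (H p) (H' p)) p =
      (orbitMat m (V p) (H p))ᵀ * (Kmat N r m * J) * orbitMat m (V p) (H p) ∧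
    mcd Complex.I (fun p => gammaMat m μ (V p) (H p) (H' p)) p = specInv N μ *
      ((orbitMat m (V p) (H p))ᵀ * (Kmat N r m * Qmat J V p) * orbitMat m (V p) (H p)) *
      specInv N μ := by
  have hμc : conj μ ≠ 0 := by simpa using hμ0
  have hs := smooth_orbitMat hr hJ hU hV hH
  have hgs : MSmooth U
      fun p => (orbitMat m (V p) (H p))ᵀ * Kmat N r m * orbitMat m (V p) (H p) :=
    (hs.transpose.mul (MSmooth.const _)).mul hs
  have key : ∀ s t, ContDiffOn ℝ ∞ (fun p => gammaMat m μ (V p) (H p) (H' p) s t) U ∧ ∀ p ∈ U,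
      cd (-Complex.I) (fun p => gammaMat m μ (V p) (H p) (H' p) s t) p =
        orbit N r m (V p) (H p) s ⬝ᵥ (Kmat N r m *ᵥ (J *ᵥ orbit N r m (V p) (H p) t)) ∧
      cd Complex.I (fun p => gammaMat m μ (V p) (H p) (H' p) s t) p =
        (spec N μ s)⁻¹ * (spec N μ t)⁻¹ * (orbit N r m (V p) (H p) s ⬝ᵥ
          (Kmat N r m *ᵥ (Qmat J V p *ᵥ orbit N r m (V p) (H p) t))) := by
    intro s t
    by_cases hst : spec N μ s + spec N μ t = 0
    · rcases s with j | j <;> rcases t with k | k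
      · have h1 := cd_gammaMat_singular hr hJ hU hV hμ0 hH hc hH' j k
          ((spec_inl_add_inl_eq_zero μ hμ0 j k).1 hst)
        simp only [orbit_inl_eq_rot]
        exact h1
      · exact absurd hst (spec_inl_add_inr_ne_zero μ hμ0 hμ1 j k)
      · rw [add_comm] at hst
        exact absurd hst (spec_inl_add_inr_ne_zero μ hμ0 hμ1 k j)
      · -- the second group is obtained from the first one by the antilinear symmetry
        obtain ⟨h1, h2⟩ := cd_gammaMat_singular hr hJ hU hV hμ0 hH hc hH' j k
          ((spec_inr_add_inr_eq_zero μ hμ0 j k).1 hst)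
        have hval : ∀ p ∈ U, gammaMat m μ (V p) (H p) (H' p) (.inr j) (.inr k) =
            conj μ ^ 2 * ec (-((j : ℕ) : ZMod N) - ((k : ℕ) : ZMod N)) *
            conj (gammaMat m μ (V p) (H p) (H' p) (.inl j) (.inl k)) := fun p hp =>
          gammaMat_inr_inr_eq_conj μ _ _ hr hμ0 (fun a b => hc a b p hp) j k
        have hcs : ContDiffOn ℝ ∞
            (fun p => conj (gammaMat m μ (V p) (H p) (H' p) (.inl j) (.inl k))) U :=
          Complex.conjCLE.contDiff.comp_contDiffOn h1
        refine ⟨(contDiffOn_const.mul hcs).congr hval, fun p hp => ?_⟩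
        obtain ⟨h3, h4⟩ := h2 p hp
        have hP := hV.isPotential hp
        have hd := ContDiffOn.differentiableAt_of_isOpen h1 hU hp
        have hcd := ContDiffOn.differentiableAt_of_isOpen hcs hU hp
        have i1 : conj (-Complex.I) = Complex.I := by simp
        have i2 : conj Complex.I = -Complex.I := by simp
        rw [cd_congr hU hval _ hp, cd_congr hU hval _ hp, cd_const_mul _ _ hcd,
          cd_const_mul _ _ hcd, cd_conj _ hd, cd_conj _ hd, i1, i2, h3, h4,
          orbit_inr_eq_dual hr hP, orbit_inr_eq_dual hr hP, ← dual_mulVec_Q hr hJ hP,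
          ← dual_mulVec_J hr hJ hP, dot_dual hr hP, dot_dual hr hP, spec_inl, spec_inl, spec_inr,
          spec_inr, sub_eq_add_neg, ec_add, ec_neg, ec_neg]
        simp only [map_mul, map_inv₀, conj_ec, ec_neg]
        have hj := ec_ne_zero ((j : ℕ) : ZMod N)
        have hk := ec_ne_zero ((k : ℕ) : ZMod N)
        constructor
        · field_simp
        · field_simp
    · have hval : ∀ p ∈ U, gammaMat m μ (V p) (H p) (H' p) s t = (spec N μ s + spec N μ t)⁻¹ *
          ((orbitMat m (V p) (H p))ᵀ * Kmat N r m * orbitMat m (V p) (H p)) s t := by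
        intro p hp
        have := spec_add_mul_gammaMat μ (H p) (H' p) hr (hV.isPotential hp) hμ0 hμ1
          (fun a b => hc a b p hp) s t
        have e : ((orbitMat m (V p) (H p))ᵀ * Kmat N r m * orbitMat m (V p) (H p)) s t =
            orbit N r m (V p) (H p) s ⬝ᵥ (Kmat N r m *ᵥ orbit N r m (V p) (H p) t) := by
          rw [Matrix.mul_assoc]; rfl
        rw [e, ← this]
        field_simp
      refine ⟨(contDiffOn_const.mul (hgs s t)).congr hval, fun p hp => ?_⟩
      have hd := hgs.differentiableAt hU hp s t
      have g1 := congrFun (congrFun (mcd_gram_z hr hJ hU hV hH hp) s) t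
      have g2 := congrFun (congrFun (mcd_gram_zbar hr hJ hU hV hH hp) s) t
      rw [mcd, of_apply, Matrix.add_apply, specMat, diagonal_mul, mul_diagonal, gram_apply] at g1
      rw [mcd, of_apply, Matrix.add_apply, specInv, diagonal_mul, mul_diagonal, gram_apply] at g2
      rw [cd_congr hU hval _ hp, cd_congr hU hval _ hp, cd_const_mul _ _ hd, cd_const_mul _ _ hd,
        g1, g2]
      have h1 := spec_ne_zero (N := N) μ hμ0 s
      have h2 := spec_ne_zero (N := N) μ hμ0 t
      constructor
      · field_simp
      · field_simp
        ring
  refine ⟨fun s t => (key s t).1, fun p hp => ⟨?_, ?_⟩⟩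
  · ext s t
    rw [gram_apply]
    exact ((key s t).2 p hp).1
  · ext s t
    rw [specInv, mul_diagonal, diagonal_mul, gram_apply]
    refine ((key s t).2 p hp).2.trans ?_
    ring

end deriv

end

/-! ### The derivative of a family of solutions in the spectral parameter -/

section

section

variable {W : Set ℂ} {U : Set (ℝ × ℝ)} {F : ℂ × (ℝ × ℝ) → ℂ} {g : ℝ × ℝ → ℂ} {μ : ℂ}
  (hW : IsOpen W) (hμ : μ ∈ W) (hU : IsOpen U) (hF : ContDiffOn ℝ ∞ F (W ×ˢ U))
  (hg : ∀ p ∈ U, HasDerivAt (fun lam => F (lam, p)) (g p) μ)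

include hW hμ hU hF hg

theorem hasDerivAt_eq_fderiv {p : ℝ × ℝ} (hp : p ∈ U) : g p = fderiv ℝ F (μ, p) (1, 0) := by
  have hd : DifferentiableAt ℝ F (μ, p) :=
    (hF.contDiffAt ((hW.prod hU).mem_nhds ⟨hμ, hp⟩)).differentiableAt (by simp)
  have h1 : HasFDerivAt (fun lam => F (lam, p))
      ((fderiv ℝ F (μ, p)).comp (ContinuousLinearMap.inl ℝ ℂ (ℝ × ℝ))) μ :=
    hd.hasFDerivAt.comp μ (hasFDerivAt_prodMk_left μ p)
  have h2 := congrArg (fun L : ℂ →L[ℝ] ℂ => L 1)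
    (h1.unique ((hg p hp).hasFDerivAt.restrictScalars ℝ))
  simpa using h2.symm

theorem contDiffOn_param_deriv : ContDiffOn ℝ ∞ g U := by
  have h : ContDiffOn ℝ ∞ (fun q => fderiv ℝ F q (1, 0)) (W ×ˢ U) :=
    (hF.fderiv_of_isOpen (hW.prod hU) (by simp)).clm_apply contDiffOn_const
  refine (h.comp (g := fun q => fderiv ℝ F q (1, 0)) (f := fun p : ℝ × ℝ => (μ, p))
    (contDiffOn_const.prodMk contDiffOn_id) fun p hp => ⟨hμ, hp⟩).congr fun p hp => ?_
  exact hasDerivAt_eq_fderiv hW hμ hU hF hg hp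

/-- The derivative in the spectral parameter commutes with `∂_x + ε ∂_y`. -/
theorem cd_param_deriv (ε : ℂ) {p : ℝ × ℝ} (hp : p ∈ U) {c : ℂ}
    (hc : HasDerivAt (fun lam => cd ε (fun q => F (lam, q)) p) c μ) : cd ε g p = c := by
  have hop := hW.prod hU
  have hcd : ∀ lam ∈ W, ∀ q ∈ U, ContDiffAt ℝ ∞ F (lam, q) := fun lam hl q hq =>
    hF.contDiffAt (hop.mem_nhds ⟨hl, hq⟩)
  have hS : IsSymmSndFDerivAt ℝ F (μ, p) := (hcd μ hμ p hp).isSymmSndFDerivAt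
    (by simpa using (ENat.LEInfty.out : (2 : WithTop ℕ∞) ≤ ∞))
  have hDF : DifferentiableAt ℝ (fderiv ℝ F) (μ, p) :=
    ((hcd μ hμ p hp).fderiv_right (m := 1) (by norm_cast)).differentiableAt (by simp)
  -- the spatial derivatives of `g`
  have h1 : ∀ w, fderiv ℝ g p w = fderiv ℝ (fderiv ℝ F) (μ, p) (0, w) (1, 0) := by
    intro w
    have e : g =ᶠ[𝓝 p] fun q => fderiv ℝ F (μ, q) (1, 0) :=
      Filter.eventually_of_mem (hU.mem_nhds hp) fun q hq => hasDerivAt_eq_fderiv hW hμ hU hF hg hq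
    have h : HasFDerivAt (fun q => fderiv ℝ F (μ, q))
        ((fderiv ℝ (fderiv ℝ F) (μ, p)).comp (ContinuousLinearMap.inr ℝ ℂ (ℝ × ℝ))) p :=
      hDF.hasFDerivAt.comp p (hasFDerivAt_prodMk_right μ p)
    rw [e.fderiv_eq, (h.clm_apply (hasFDerivAt_const _ _)).fderiv]
    simp
  -- the spatial derivatives of `F` are partial derivatives of the function of all variables
  have h2 : ∀ lam ∈ W, ∀ w, fderiv ℝ (fun q => F (lam, q)) p w = fderiv ℝ F (lam, p) (0, w) := by
    intro lam hl w
    have h : HasFDerivAt (fun q => F (lam, q))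
        ((fderiv ℝ F (lam, p)).comp (ContinuousLinearMap.inr ℝ ℂ (ℝ × ℝ))) p :=
      ((hcd lam hl p hp).differentiableAt (by simp)).hasFDerivAt.comp p
        (hasFDerivAt_prodMk_right lam p)
    rw [h.fderiv]
    simp
  have h3 : ∀ w, HasFDerivAt (fun lam => fderiv ℝ F (lam, p) (0, w))
      (((fderiv ℝ (fderiv ℝ F) (μ, p)).comp (ContinuousLinearMap.inl ℝ ℂ (ℝ × ℝ))).flip (0, w))
      μ := by
    intro w
    have h : HasFDerivAt (fun lam => fderiv ℝ F (lam, p))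
        ((fderiv ℝ (fderiv ℝ F) (μ, p)).comp (ContinuousLinearMap.inl ℝ ℂ (ℝ × ℝ))) μ :=
      hDF.hasFDerivAt.comp μ (hasFDerivAt_prodMk_left μ p)
    refine (h.clm_apply (hasFDerivAt_const _ _)).congr_fderiv ?_
    ext
    simp
  have h4 := (h3 (1, 0)).add ((h3 (0, 1)).const_smul ε)
  have h5 := (hc.hasFDerivAt.restrictScalars ℝ).congr_of_eventuallyEq
    (f₁ := fun lam => fderiv ℝ F (lam, p) (0, (1, 0)) + ε • fderiv ℝ F (lam, p) (0, (0, 1)))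
    (Filter.eventually_of_mem (hW.mem_nhds hμ) fun lam hl => by
      simp only [cd, h2 lam hl, smul_eq_mul])
  have h6 := congrArg (fun L : ℂ →L[ℝ] ℂ => L 1) (h4.unique h5)
  rw [cd, h1, h1, hS.eq (0, (1, 0)), hS.eq (0, (0, 1))]
  simpa using h6

end

variable {N : ℕ} [NeZero N] {r : ZMod N → ℕ} {m : ℤ}
variable {J : Matrix (Idx N r) (Idx N r) ℂ} {U : Set (ℝ × ℝ)}
  {V : ℝ × ℝ → Matrix (Idx N r) (Idx N r) ℂ} {μ : ℂ} {H H' : ℝ × ℝ → Idx N r → ℂ}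
  {Φ : ℂ → ℝ × ℝ → Idx N r → ℂ}

theorem hasDerivAt_mulVec (A : Matrix (Idx N r) (Idx N r) ℂ) {v : ℂ → Idx N r → ℂ}
    {v' : Idx N r → ℂ} (hv : ∀ i, HasDerivAt (fun lam => v lam i) (v' i) μ) (i : Idx N r) :
    HasDerivAt (fun lam => (A *ᵥ v lam) i) ((A *ᵥ v') i) μ := by
  simp only [mulVec, dotProduct]
  exact HasDerivAt.fun_sum fun k _ => (hv k).const_mul _

theorem IsLaxFamily.isLaxDerivative (hU : IsOpen U) (hμ0 : μ ≠ 0)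
    (hΦ : IsLaxFamily N r m J U V μ H H' Φ) : IsLaxDerivative J U V μ H H' := by
  obtain ⟨W, hW, hμ, hlax, -, hsm, -, hval, hder⟩ := hΦ
  have hg : ∀ i, ∀ p ∈ U, HasDerivAt (fun lam => Φ lam p i) (H' p i) μ := fun i p hp =>
    hder p hp i
  refine ⟨fun i => contDiffOn_param_deriv hW hμ hU (hsm i) (hg i), fun p hp => ?_,
    fun p hp => ?_⟩
  · ext i
    rw [dz_eq_cd]
    refine cd_param_deriv hW hμ hU (hsm i) (hg i) _ hp ?_
    have h1 := ((hasDerivAt_id μ).mul (hasDerivAt_mulVec J (fun k => hg k p hp) i)).add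
      (hasDerivAt_mulVec (Pmat V p) (fun k => hg k p hp) i)
    refine (h1.congr_of_eventuallyEq (Filter.eventually_of_mem (hW.mem_nhds hμ) fun lam hl => ?_)
      ).congr_deriv ?_
    · have h := congrFun ((hlax lam hl).eq_z p hp) i
      rw [dz_eq_cd, Matrix.add_mulVec, smul_mulVec] at h
      exact h
    · rw [Matrix.add_mulVec, smul_mulVec, ← hval p hp]
      simp only [id, Pi.add_apply, Pi.smul_apply, smul_eq_mul]
      ring
  · ext i
    refine cd_param_deriv hW hμ hU (hsm i) (hg i) _ hp ?_
    have h1 := (hasDerivAt_inv hμ0).mul (hasDerivAt_mulVec (Qmat J V p) (fun k => hg k p hp) i)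
    refine (h1.congr_of_eventuallyEq (Filter.eventually_of_mem (hW.mem_nhds hμ) fun lam hl => ?_)
      ).congr_deriv ?_
    · exact congrFun ((hlax lam hl).eq_zbar p hp) i
    · rw [← hval p hp]
      simp only [Pi.sub_apply, Pi.smul_apply, smul_eq_mul]
      ring

end

/-! ### The transformed potential -/

section

section dressing

variable {n s : Type*} [Fintype n] [DecidableEq n] [Fintype s] [DecidableEq s]
  {X : Matrix n s ℂ} {Y : Matrix s n ℂ} {Γ A D E : Matrix s s ℂ} {J P Q : Matrix n n ℂ}
  (hA : A * Γ = 1) (hA' : Γ * A = 1) (hD : D * E = 1) (hD' : E * D = 1)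
  (hS : Y * X = D * Γ + Γ * D)

omit [DecidableEq s] in
/-- The `∂_z̄`-derivative of `-X A Y`, for `X_z̄ = Q X E`, `Y_z̄ = E Y Q` and `Γ_z̄ = E Y Q X E`.
-/
theorem dressing_zbar :
    -(Q * X * E * A * Y + X * -(A * (E * (Y * Q * X) * E) * A) * Y + X * A * (E * Y * Q)) + Q =
    (1 - X * A * E * Y) * Q * (1 - X * E * A * Y) := by
  simp only [Matrix.mul_sub, Matrix.sub_mul, Matrix.mul_assoc,
    Matrix.mul_one, Matrix.one_mul, Matrix.neg_mul, Matrix.mul_neg]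
  abel

include hA hA' hS

omit [DecidableEq n] in
theorem sandwich_right : A * (Y * X) * A = A * D + D * A := by
  calc A * (Y * X) * A = A * D * (Γ * A) + (A * Γ) * D * A := by rw [hS]; noncomm_ring
    _ = _ := by rw [hA, hA', Matrix.mul_one, Matrix.one_mul]

include hD hD'

omit [DecidableEq n] in
theorem sandwich_left : A * E * (Y * X) * E * A = A * E + E * A := by
  calc A * E * (Y * X) * E * A = A * ((E * D) * Γ) * E * A + A * E * Γ * (D * E) * A := by
        rw [hS]; noncomm_ring
    _ = A * Γ * E * A + A * E * (Γ * A) := by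
        rw [hD, hD']; noncomm_ring
    _ = _ := by rw [hA, hA', Matrix.one_mul, Matrix.mul_one, add_comm]

/-- The inverse of the value of the Darboux matrix at zero. -/
theorem dressing_mul_inv : (1 - X * A * E * Y) * (1 - X * E * A * Y) = 1 := by
  have h := sandwich_left hA hA' hD hD' hS
  calc (1 - X * A * E * Y) * (1 - X * E * A * Y)
      = 1 - X * A * E * Y - X * E * A * Y + X * (A * E * (Y * X) * E * A) * Y := by
        simp only [Matrix.sub_mul, Matrix.mul_sub, Matrix.mul_assoc, Matrix.one_mul, Matrix.mul_one]
        abel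
    _ = 1 := by
        rw [h]
        simp only [Matrix.add_mul, Matrix.mul_add, Matrix.mul_assoc]
        abel

/-- The `∂_z`-derivative of the value `1 - X A E Y` at zero, for `X_z = J X D + P X`, `Y_z = D Y J
- Y P` and `Γ_z = Y J X`. -/
theorem dressing_z :
    -((J * X * D + P * X) * A * E * Y + X * -(A * (Y * J * X) * A) * E * Y +
      X * A * E * (D * Y * J - Y * P)) + (1 - X * A * E * Y) * P =
    (P + (J * (X * A * Y) - X * A * Y * J)) * (1 - X * A * E * Y) := by
  have h := sandwich_right hA hA' hS
  have key : X * A * Y * (1 - X * A * E * Y) = -(X * D * A * E * Y) := by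
    calc X * A * Y * (1 - X * A * E * Y) = X * A * Y - X * (A * (Y * X) * A) * E * Y := by
          simp only [Matrix.mul_sub, Matrix.mul_assoc, Matrix.mul_one]
      _ = X * A * Y - (X * A * (D * E) * Y + X * D * A * E * Y) := by
          rw [h]; simp only [Matrix.add_mul, Matrix.mul_add, Matrix.mul_assoc]
      _ = _ := by rw [hD, Matrix.mul_one]; abel
  have key2 : X * A * E * (D * Y * J - Y * P) = X * A * Y * J - X * A * E * Y * P := by
    calc X * A * E * (D * Y * J - Y * P) = X * A * (E * D) * Y * J - X * A * E * Y * P := by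
          simp only [Matrix.mul_sub, Matrix.mul_assoc]
      _ = _ := by rw [hD', Matrix.mul_one]
  calc _ = P * (1 - X * A * E * Y) + J * -(X * D * A * E * Y) -
        X * A * Y * J * (1 - X * A * E * Y) := by
        rw [key2]
        simp only [Matrix.add_mul, Matrix.mul_sub, Matrix.sub_mul, Matrix.mul_assoc,
          Matrix.mul_one, Matrix.one_mul, Matrix.neg_mul, Matrix.mul_neg]
        abel
    _ = _ := by
        rw [← key]
        simp only [Matrix.add_mul, Matrix.sub_mul, Matrix.mul_assoc]
        abel

end dressing

end

section

variable {N : ℕ} [NeZero N] {r : ZMod N → ℕ} {m : ℤ}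
variable {J : Matrix (Idx N r) (Idx N r) ℂ} {U : Set (ℝ × ℝ)}
  {V : ℝ × ℝ → Matrix (Idx N r) (Idx N r) ℂ} {μ : ℂ} {H H' : ℝ × ℝ → Idx N r → ℂ}
variable (hr : ∀ j, r j = 1 ∨ (r j = 2 ∧ 2 * j = (m : ZMod N)))

theorem specMat_mul_specInv (hμ0 : μ ≠ 0) : specMat N μ * specInv N μ = 1 := by
  rw [specMat, specInv, diagonal_mul_diagonal, ← diagonal_one]
  congr 1
  ext s
  exact mul_inv_cancel₀ (spec_ne_zero μ hμ0 s)

include hr in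
/-- The Sylvester equation that determines the regular entries of `Γ`. -/
theorem gram_eq (h h' : Idx N r → ℂ) {W : Matrix (Idx N r) (Idx N r) ℂ}
    (hW : IsPotential N r m W) (hμ0 : μ ≠ 0) (hμ1 : ‖μ‖ ≠ 1)
    (hc : Even N → Even m → constraintForm N r m h = 0) :
    (orbitMat m W h)ᵀ * Kmat N r m * orbitMat m W h =
      specMat N μ * gammaMat m μ W h h' + gammaMat m μ W h h' * specMat N μ := by
  ext s t
  have e : ((orbitMat m W h)ᵀ * Kmat N r m * orbitMat m W h) s t =
      orbit N r m W h s ⬝ᵥ (Kmat N r m *ᵥ orbit N r m W h t) := by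
    rw [Matrix.mul_assoc]; rfl
  rw [e, ← spec_add_mul_gammaMat μ h h' hr hW hμ0 hμ1 hc, Matrix.add_apply, specMat, diagonal_mul,
    mul_diagonal]
  ring

/-- A gauge transformation `R₀` of the Lax pair, with `R₁` the next coefficient of the Darboux
matrix at infinity, maps a solution `V` of the Toda system to the solution `R₀ V`. The new
matrices are `P + [R₁, J]` and `(R₁)_z̄ + Q`, so the equation for `R₀ V` is the one for `V`. -/
theorem toda_of_gauge (hU : IsOpen U) (hV : IsTodaSolution N r m J U V)
    (hVdet : ∀ p ∈ U, IsUnit (V p).det) {W R₀ R₁ : ℝ × ℝ → Matrix (Idx N r) (Idx N r) ℂ}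
    (hs0 : MSmooth U R₀) (hs1 : MSmooth U R₁) (heq : ∀ p ∈ U, W p = R₀ p * V p)
    (hu : ∀ p ∈ U, IsUnit (R₀ p).det)
    (hz : ∀ p ∈ U, mcd (-Complex.I) R₀ p + R₀ p * Pmat V p =
      (Pmat V p + (R₁ p * J - J * R₁ p)) * R₀ p)
    (hzb : ∀ p ∈ U, mcd Complex.I R₁ p + Qmat J V p = R₀ p * Qmat J V p * (R₀ p)⁻¹)
    {p : ℝ × ℝ} (hp : p ∈ U) :
    mdzbar (Pmat W) p + (J * Qmat J W p - Qmat J W p * J) = 0 := by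
  have hVs : MSmooth U V := hV.smooth
  -- the two matrices of the new Lax pair
  have hPn : ∀ q ∈ U, Pmat W q = Pmat V q + (R₁ q * J - J * R₁ q) := by
    intro q hq
    have e : mcd (-Complex.I) V q = Pmat V q * V q := by
      rw [Pmat, nonsing_inv_mul_cancel_right _ _ (hVdet q hq), mdz_eq_mcd]
    have e2 : mdz W q =
        (Pmat V q + (R₁ q * J - J * R₁ q)) * W q := by
      rw [mdz_eq_mcd, mcd_congr hU heq _ hq, mcd_mul hU hq hs0 _ hVs, e, heq q hq,
        ← Matrix.mul_assoc, ← Matrix.add_mul, hz q hq, Matrix.mul_assoc]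
    have hW : IsUnit (W q).det := by
      rw [heq q hq, det_mul]
      exact (hu q hq).mul (hVdet q hq)
    rw [Pmat, e2, mul_nonsing_inv_cancel_right _ _ hW]
  have hQn : Qmat J W p = mcd Complex.I R₁ p + Qmat J V p := by
    rw [hzb p hp, Qmat, heq p hp, Matrix.mul_inv_rev, Qmat]
    simp only [Matrix.mul_assoc]
  have hPs : MSmooth U (Pmat V) := by
    have h1 : MSmooth U fun p => mcd (-Complex.I) V p * (V p)⁻¹ :=
      (hVs.mcd hU _).mul (hVs.inv fun q hq => (isUnit_iff_isUnit_det _).2 (hVdet q hq))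
    exact h1.congr fun q _ => by rw [Pmat, mdz_eq_mcd]
  have hR1J : MSmooth U fun q => R₁ q * J := hs1.mul (MSmooth.const _)
  have hJR1 : MSmooth U fun q => J * R₁ q := (MSmooth.const _).mul hs1
  have hT := hV.toda p hp
  rw [mdzbar_eq_mcd] at hT ⊢
  rw [mcd_congr hU hPn _ hp, mcd_add hU hp hPs _ (hR1J.sub hJR1), mcd_sub hU hp hR1J _ hJR1,
    mcd_mul_const hU hp hs1, mcd_const_mul hU hp hs1, hQn, eq_neg_of_add_eq_zero_left hT]
  noncomm_ring

section transformed

variable (hJ : IsTodaMatrix N r m J) (hU : IsOpen U) (hV : IsTodaSolution N r m J U V)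
  (hμ0 : μ ≠ 0) (hμ1 : ‖μ‖ ≠ 1) (hH : IsLaxSolution J U V μ H)
  (hc : Even N → Even m → ∀ p ∈ U, constraintForm N r m (H p) = 0)
  (hH' : Even N → Odd m → IsLaxDerivative J U V μ H H')
  (hΔ : ∀ p ∈ U, ∀ k, Delta N r m μ (V p) (H p) (H' p) k ≠ 0)

include hr hJ hU hV hμ0 hμ1 hH hc hH' hΔ

/-- The value `R₀` at zero of the normalized Darboux matrix is a complex orthogonal matrix, and it
intertwines the old and the new Lax pair: with `R₁` the next coefficient at infinity, `(R₀)_z + R₀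
P = (P + [R₁, J]) R₀` and `(R₁)_z̄ + Q = R₀ Q R₀⁻¹`. -/
theorem darboux₀_lax :
    ∃ R₀ R₁ : ℝ × ℝ → Matrix (Idx N r) (Idx N r) ℂ, MSmooth U R₀ ∧ MSmooth U R₁ ∧ ∀ p ∈ U,
      (R₀ p = blockDiagonal' fun j => fBlock N r m μ (V p) (H p) (H' p) j) ∧
      IsUnit (R₀ p).det ∧
      (R₀ p)ᵀ * Kmat N r m * R₀ p = Kmat N r m ∧
      mcd (-Complex.I) R₀ p + R₀ p * Pmat V p =
        (Pmat V p + (R₁ p * J - J * R₁ p)) * R₀ p ∧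
      mcd Complex.I R₁ p + Qmat J V p = R₀ p * Qmat J V p * (R₀ p)⁻¹ := by
  set X : ℝ × ℝ → Matrix (Idx N r) (Fin N ⊕ Fin N) ℂ := fun p => orbitMat m (V p) (H p) with hX
  set Γ : ℝ × ℝ → Matrix (Fin N ⊕ Fin N) (Fin N ⊕ Fin N) ℂ :=
    fun p => gammaMat m μ (V p) (H p) (H' p) with hΓ
  have hXs : MSmooth U X := smooth_orbitMat hr hJ hU hV hH
  have hYs : MSmooth U fun p => (X p)ᵀ * Kmat N r m := hXs.transpose.mul (MSmooth.const _)
  obtain ⟨hΓs, hΓd⟩ := gammaMat_deriv hr hJ hU hV hμ0 hμ1 hH hc hH'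
  have hdet : ∀ p ∈ U, IsUnit (Γ p).det := fun p hp =>
    (isUnit_iff_isUnit_det _).1 ((isUnit_gammaMat μ (H p) (H' p) hμ0).2 (hΔ p hp))
  have hu : ∀ p ∈ U, IsUnit (Γ p) := fun p hp => (isUnit_iff_isUnit_det _).2 (hdet p hp)
  have hAs : MSmooth U fun p => (Γ p)⁻¹ := hΓs.inv hu
  have hXA : MSmooth U fun p => X p * (Γ p)⁻¹ := hXs.mul hAs
  have hXAE : MSmooth U fun p => X p * (Γ p)⁻¹ * specInv N μ := hXA.mul (MSmooth.const _)
  have hB0 : MSmooth U fun p => X p * (Γ p)⁻¹ * specInv N μ * ((X p)ᵀ * Kmat N r m) := hXAE.mul hYs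
  have hB1 : MSmooth U fun p => X p * (Γ p)⁻¹ * ((X p)ᵀ * Kmat N r m) := hXA.mul hYs
  have hR0 : MSmooth U fun p => 1 - X p * (Γ p)⁻¹ * specInv N μ * ((X p)ᵀ * Kmat N r m) :=
    (MSmooth.const _).sub hB0
  have hR1 : MSmooth U fun p => 0 - X p * (Γ p)⁻¹ * ((X p)ᵀ * Kmat N r m) :=
    (MSmooth.const _).sub hB1
  refine ⟨_, _, hR0, hR1, fun p hp => ?_⟩
  have hP := hV.isPotential hp
  have hDE := specMat_mul_specInv (N := N) hμ0
  have hED := mul_eq_one_comm.1 hDE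
  have hΓA := mul_nonsing_inv _ (hdet p hp)
  have hAΓ := nonsing_inv_mul _ (hdet p hp)
  have hS := gram_eq hr (H p) (H' p) hP hμ0 hμ1 (fun a b => hc a b p hp)
  have hinv := dressing_mul_inv (X := X p) (Y := (X p)ᵀ * Kmat N r m) hAΓ hΓA hDE hED hS
  have hinv' := mul_eq_one_comm.1 hinv
  -- derivatives
  have hXz : mcd (-Complex.I) X p = J * X p * specMat N μ + Pmat V p * X p :=
    mcd_orbitMat_z hr hJ hU hV hH hp
  have hXzb : mcd Complex.I X p = Qmat J V p * X p * specInv N μ :=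
    mcd_orbitMat_zbar hr hJ hU hV hH hp
  have hYz : (mcd (-Complex.I) X p)ᵀ * Kmat N r m =
      specMat N μ * ((X p)ᵀ * Kmat N r m) * J - (X p)ᵀ * Kmat N r m * Pmat V p := by
    have hDt : (specMat N μ)ᵀ = specMat N μ := diagonal_transpose _
    rw [hXz, transpose_add, transpose_mul, transpose_mul, transpose_mul, hDt, Matrix.add_mul]
    simp only [Matrix.mul_assoc]
    rw [hJ.transpose_mul_Kmat hr, Pmat_transpose_mul_Kmat hr hU hV hp, Matrix.mul_neg,
      sub_eq_add_neg]
  have hYzb : (mcd Complex.I X p)ᵀ * Kmat N r m =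
      specInv N μ * ((X p)ᵀ * Kmat N r m) * Qmat J V p := by
    have hDt : (specInv N μ)ᵀ = specInv N μ := diagonal_transpose _
    rw [hXzb, transpose_mul, transpose_mul, hDt]
    simp only [Matrix.mul_assoc]
    rw [Qmat_transpose_mul_Kmat hr hJ hP]
  have hΓz : mcd (-Complex.I) Γ p = (X p)ᵀ * Kmat N r m * J * X p := by
    rw [(hΓd p hp).1]; simp only [hX, Matrix.mul_assoc]
  have hΓzb : mcd Complex.I Γ p =
      specInv N μ * ((X p)ᵀ * Kmat N r m * Qmat J V p * X p) * specInv N μ := by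
    rw [(hΓd p hp).2]; simp only [hX, Matrix.mul_assoc]
  refine ⟨darboux₀_eq μ (H p) (H' p) hr hP hμ0 (hΔ p hp), ?_, ?_, ?_, ?_⟩
  · exact (isUnit_iff_isUnit_det _).1 (IsUnit.of_mul_eq_one _ hinv)
  · have hAt : ((Γ p)⁻¹)ᵀ = (Γ p)⁻¹ := by
      rw [transpose_nonsing_inv]
      congr 1
      ext s t
      exact gammaMat_symm μ (H p) (H' p) hr hμ0 (fun a b => hc a b p hp) t s
    have hDt : (specInv N μ)ᵀ = specInv N μ := diagonal_transpose _
    have e : (1 - X p * (Γ p)⁻¹ * specInv N μ * ((X p)ᵀ * Kmat N r m))ᵀ * Kmat N r m =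
        Kmat N r m * (1 - X p * specInv N μ * (Γ p)⁻¹ * ((X p)ᵀ * Kmat N r m)) := by
      rw [transpose_sub, transpose_mul, transpose_mul, transpose_mul, transpose_mul, hAt, hDt,
        transpose_one, transpose_transpose, Kmat_transpose hr]
      simp only [Matrix.sub_mul, Matrix.mul_sub, Matrix.mul_assoc, Matrix.one_mul, Matrix.mul_one]
    rw [e, Matrix.mul_assoc, hinv', Matrix.mul_one]
  · rw [mcd_sub hU hp (MSmooth.const _) _ hB0, mcd_const, zero_sub,
      mcd_mul hU hp hXAE _ hYs, mcd_mul_const hU hp hXA, mcd_mul hU hp hXs _ hAs,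
      mcd_inv hU hp hΓs hu, mcd_mul_const hU hp hXs.transpose, mcd_transpose, hYz, hXz, hΓz]
    have h := dressing_z (X := X p) (Y := (X p)ᵀ * Kmat N r m) (J := J) (P := Pmat V p)
      hAΓ hΓA hDE hED hS
    simp only [zero_sub, Matrix.neg_mul, Matrix.mul_neg] at h ⊢
    convert h using 2
    · simp only [Matrix.add_mul, Matrix.neg_mul]
      rfl
    · congr 1
      abel
  · have hRinv : (1 - X p * (Γ p)⁻¹ * specInv N μ * ((X p)ᵀ * Kmat N r m))⁻¹ =
        1 - X p * specInv N μ * (Γ p)⁻¹ * ((X p)ᵀ * Kmat N r m) := inv_eq_right_inv hinv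
    rw [hRinv, mcd_sub hU hp (MSmooth.const _) _ hB1, mcd_const, zero_sub,
      mcd_mul hU hp hXA _ hYs, mcd_mul hU hp hXs _ hAs,
      mcd_inv hU hp hΓs hu, mcd_mul_const hU hp hXs.transpose, mcd_transpose, hYzb, hXzb, hΓzb,
      ← dressing_zbar, Matrix.add_mul]

omit hJ hU hμ0 hH hH' hΔ in
/-- The blocks `V_jj` and `f_j` are diagonal, so the entries of the transformed potential are
products. -/
theorem blockDiagonal'_mul_fBlock_apply {p : ℝ × ℝ} (hp : p ∈ U) (i k : Idx N r) :
    (blockDiagonal' fun j => blk (V p) j j * fBlock N r m μ (V p) (H p) (H' p) j) i k =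
      (blockDiagonal' fun j => fBlock N r m μ (V p) (H p) (H' p) j) i k * V p k k := by
  have hP := hV.isPotential hp
  obtain ⟨c, a⟩ := i
  obtain ⟨d, b⟩ := k
  by_cases hcd : c = d
  · subst hcd
    have hf := fBlock_isDiag hr μ (H p) (H' p) hP hμ1 (fun a b => hc a b p hp) c
    rw [blockDiagonal'_apply_eq, blockDiagonal'_apply_eq, mul_apply,
      Finset.sum_eq_single a (fun x _ hx => ?_) (by simp)]
    · by_cases hab : a = b
      · subst hab
        exact mul_comm _ _
      · rw [hf hab, mul_zero, zero_mul]
    · have : blk (V p) c c a x = 0 := hP.diag (fun h => hx (by simpa using h.symm))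
      rw [this, zero_mul]
  · rw [blockDiagonal'_apply_ne _ _ _ hcd, blockDiagonal'_apply_ne _ _ _ hcd, zero_mul]

omit hJ hU hμ0 hH hH' hΔ in
theorem blockDiagonal'_mul_fBlock {p : ℝ × ℝ} (hp : p ∈ U) :
    (blockDiagonal' fun j => blk (V p) j j * fBlock N r m μ (V p) (H p) (H' p) j) =
      (blockDiagonal' fun j => fBlock N r m μ (V p) (H p) (H' p) j) * V p := by
  ext i k
  have hd : ∀ B : Matrix (Idx N r) (Idx N r) ℂ, (B * V p) i k = B i k * V p k k := fun B => by
    conv_lhs => rw [(hV.isPotential hp).eq_diagonal]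
    rw [mul_diagonal]
  rw [blockDiagonal'_mul_fBlock_apply hr hV hμ1 hc hp, hd]

omit hJ hU hμ0 hH hH' hΔ in
theorem isDiag_blockDiagonal'_mul_fBlock {p : ℝ × ℝ} (hp : p ∈ U) :
    (blockDiagonal' fun j => blk (V p) j j * fBlock N r m μ (V p) (H p) (H' p) j).IsDiag := by
  rintro ⟨c, a⟩ ⟨d, b⟩ h
  rw [blockDiagonal'_mul_fBlock_apply hr hV hμ1 hc hp]
  by_cases hcd : c = d
  · subst hcd
    have hf := fBlock_isDiag hr μ (H p) (H' p) (hV.isPotential hp) hμ1 (fun a b => hc a b p hp) c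
    rw [blockDiagonal'_apply_eq, hf (fun hab => h (by rw [hab])), zero_mul]
  · rw [blockDiagonal'_apply_ne _ _ _ hcd, zero_mul]

theorem isTodaSolution_transformed
    (hpos : ∀ p ∈ U, ∀ j, (fBlock N r m μ (V p) (H p) (H' p) j).PosDef) :
    IsTodaSolution N r m J U fun p => blockDiagonal' fun j =>
      blk (V p) j j * fBlock N r m μ (V p) (H p) (H' p) j := by
  obtain ⟨R₀, R₁, hs0, hs1, hR⟩ := darboux₀_lax hr hJ hU hV hμ0 hμ1 hH hc hH' hΔ
  have hVs : MSmooth U V := hV.smooth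
  have heq : ∀ p ∈ U, (blockDiagonal' fun j =>
      blk (V p) j j * fBlock N r m μ (V p) (H p) (H' p) j) = R₀ p * V p := fun p hp => by
    rw [(hR p hp).1]; exact blockDiagonal'_mul_fBlock hr hV hμ1 hc hp
  have hdiag := fun p hp => isDiag_blockDiagonal'_mul_fBlock (H' := H') hr hV hμ1 hc (p := p) hp
  have hsm : MSmooth U fun p => blockDiagonal' fun j =>
      blk (V p) j j * fBlock N r m μ (V p) (H p) (H' p) j := (hs0.mul hVs).congr heq
  have hVdet : ∀ p ∈ U, IsUnit (V p).det := fun p hp =>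
    isUnit_iff_ne_zero.2 (by
      rw [(hV.isPotential hp).eq_diagonal, det_diagonal]
      exact Finset.prod_ne_zero_iff.2 fun i _ => (hV.isPotential hp).apply_ne_zero hr i)
  refine ⟨hsm, hdiag, fun p hp => ?_, fun p hp => ?_, fun p hp j hj => ?_, fun p hp => ?_⟩
  · ext ⟨c, a⟩ ⟨d, b⟩
    by_cases h : (⟨c, a⟩ : Idx N r) = ⟨d, b⟩
    · cases h
      have hf := (hpos p hp c).isHermitian.apply a a
      rw [map_apply, blockDiagonal'_mul_fBlock_apply hr hV hμ1 hc hp, map_mul,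
        (hV.isPotential hp).conj_apply, blockDiagonal'_apply_eq]
      exact congrArg (· * _) hf
    · rw [map_apply, hdiag p hp h, map_zero]
  · rw [heq p hp, transpose_mul]
    obtain ⟨-, -, ho, -⟩ := hR p hp
    calc (V p)ᵀ * (R₀ p)ᵀ * Kmat N r m * (R₀ p * V p)
        = (V p)ᵀ * ((R₀ p)ᵀ * Kmat N r m * R₀ p) * V p := by simp only [Matrix.mul_assoc]
      _ = Kmat N r m := by rw [ho, hV.orth p hp]
  · have e : blk (blockDiagonal' fun j => blk (V p) j j * fBlock N r m μ (V p) (H p) (H' p) j) j j =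
        blk (V p) j j * fBlock N r m μ (V p) (H p) (H' p) j := by
      ext a b
      rw [blk, submatrix_apply, blockDiagonal'_apply_eq]
    rw [e, det_mul, hV.det_blk p hp j hj, det_fBlock hr μ (H p) (H' p) (hV.isPotential hp) hμ1
      (fun a b => hc a b p hp) j (hΔ p hp _) hj, one_mul]
  · exact toda_of_gauge hU hV hVdet hs0 hs1 heq (fun q hq => (hR q hq).2.1)
      (fun q hq => (hR q hq).2.2.2.1) (fun q hq => (hR q hq).2.2.2.2) hp

end transformed

end

end EllipticToda

theorem mainTheorem1
    (N : ℕ) [NeZero N] (hN : 2 ≤ N) (m : ℤ) (r : ZMod N → ℕ)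
    (hr : ∀ j, r j = 1 ∨ (r j = 2 ∧ 2 * j = (m : ZMod N)))
    (J : Matrix (EllipticToda.Idx N r) (EllipticToda.Idx N r) ℂ)
    (hJreal : J.map conj = J)
    (hJK : EllipticToda.Kmat N r m * J * EllipticToda.Kmat N r m = Jᵀ)
    (hJΩ : EllipticToda.Om N r * J * (EllipticToda.Om N r)⁻¹ = EllipticToda.omega N • J)
    (U : Set (ℝ × ℝ)) (hU : IsOpen U)
    (V : ℝ × ℝ → Matrix (EllipticToda.Idx N r) (EllipticToda.Idx N r) ℂ)
    (hV : EllipticToda.IsTodaSolution N r m J U V)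
    (μ : ℂ) (hμ0 : μ ≠ 0) (hμ1 : ‖μ‖ ≠ 1)
    (H H' : ℝ × ℝ → EllipticToda.Idx N r → ℂ)
    (hH : EllipticToda.IsLaxSolution J U V μ H)
    (hHconstr : Even N → Even m → ∀ p ∈ U, EllipticToda.constraintForm N r m (H p) = 0)
    (hH' : Even N → Odd m → ∃ Φ, EllipticToda.IsLaxFamily N r m J U V μ H H' Φ) :
    -- `T_{2N}` is block diagonal with blocks `(μ / conj μ)^N f_j`, where `Γ` is invertible
    (∀ Φ, EllipticToda.IsLaxFamily N r m J U V μ H H' Φ → ∀ p ∈ U,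
      ∃ G, EllipticToda.IsGamma N r m μ (V p) (fun lam => Φ lam p) G ∧
        (IsUnit G ↔ ∀ k, EllipticToda.Delta N r m μ (V p) (H p) (H' p) k ≠ 0) ∧
        (IsUnit G → EllipticToda.T2N N r m μ (V p) (H p) G =
          (μ / conj μ) ^ N • Matrix.blockDiagonal'
            (fun j => EllipticToda.fBlock N r m μ (V p) (H p) (H' p) j))) ∧
    -- the explicit expressions of the blocks
    (∀ p ∈ U, ∀ j : ZMod N,
      EllipticToda.Delta N r m μ (V p) (H p) (H' p) (2 + m - j) ≠ 0 →
      (r j = 1 → EllipticToda.fBlock N r m μ (V p) (H p) (H' p) j =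
        (EllipticToda.Delta N r m μ (V p) (H p) (H' p) (1 + m - j) /
          EllipticToda.Delta N r m μ (V p) (H p) (H' p) (2 + m - j)) • 1) ∧
      (∀ h2 : r j = 2, ∀ (v h₁ h₂ g : ℂ),
        v = V p ⟨j, Fin.cast h2.symm 0⟩ ⟨j, Fin.cast h2.symm 0⟩ →
        h₁ = H p ⟨j, Fin.cast h2.symm 0⟩ → h₂ = H p ⟨j, Fin.cast h2.symm 1⟩ →
        g = EllipticToda.gamma N r μ (V p) (H p) (2 - j) →
        (‖h₂‖ : ℂ) ^ 2 * v - g ≠ 0 ∧ (‖h₁‖ : ℂ) ^ 2 * v⁻¹ - g ≠ 0 ∧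
        (EllipticToda.fBlock N r m μ (V p) (H p) (H' p) j).submatrix
            (Fin.cast h2.symm) (Fin.cast h2.symm) =
          !![((‖h₁‖ : ℂ) ^ 2 * v⁻¹ - g) / ((‖h₂‖ : ℂ) ^ 2 * v - g), 0;
             0, ((‖h₂‖ : ℂ) ^ 2 * v - g) / ((‖h₁‖ : ℂ) ^ 2 * v⁻¹ - g)]) ∧
      (2 * j = (m : ZMod N) →
        (EllipticToda.fBlock N r m μ (V p) (H p) (H' p) j).det = 1)) ∧
    -- the new solution
    ((∀ p ∈ U, ∀ k, EllipticToda.Delta N r m μ (V p) (H p) (H' p) k ≠ 0) →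
      (∀ p ∈ U, ∀ j, (EllipticToda.fBlock N r m μ (V p) (H p) (H' p) j).PosDef) →
      EllipticToda.IsTodaSolution N r m J U
        (fun p => Matrix.blockDiagonal' fun j =>
          EllipticToda.blk (V p) j j * EllipticToda.fBlock N r m μ (V p) (H p) (H' p) j) ∧
      ∀ p ∈ U, EllipticToda.Om N r *
          (Matrix.blockDiagonal' fun j =>
            EllipticToda.blk (V p) j j * EllipticToda.fBlock N r m μ (V p) (H p) (H' p) j) *
          (EllipticToda.Om N r)⁻¹ =
        Matrix.blockDiagonal' fun j =>
          EllipticToda.blk (V p) j j * EllipticToda.fBlock N r m μ (V p) (H p) (H' p) j) := by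
  
  have hJ : EllipticToda.IsTodaMatrix N r m J := ⟨hJreal, hJK, hJΩ⟩
  refine ⟨fun Φ hΦ p hp => ?_, fun p hp j hΔ => ?_, fun hΔ hpos => ?_⟩
  · have hP := hV.isPotential hp
    obtain ⟨W, hW, hμW, -, -, -, hcon, hval, hder⟩ := hΦ
    have hgam := EllipticToda.isGamma_gammaMat μ (H' p) hr hP hμ0 hμ1 (fun lam => Φ lam p)
      (hder p hp) fun hN =>
        Filter.eventually_of_mem (hW.mem_nhds hμW) fun lam hl => hcon hN lam hl p hp
    simp only [hval p hp] at hgam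
    refine ⟨_, hgam, EllipticToda.isUnit_gammaMat μ (H p) (H' p) hμ0, fun hu => ?_⟩
    rw [EllipticToda.T2N_eq, EllipticToda.darboux₀_eq μ (H p) (H' p) hr hP hμ0
      ((EllipticToda.isUnit_gammaMat μ (H p) (H' p) hμ0).1 hu)]
  · have hP := hV.isPotential hp
    have hc : Even N → Even m → EllipticToda.constraintForm N r m (H p) = 0 :=
      fun h1 h2 => hHconstr h1 h2 p hp
    refine ⟨EllipticToda.fBlock_of_one hr μ (H p) (H' p) hP hμ1 hc j hΔ, ?_,
      EllipticToda.det_fBlock hr μ (H p) (H' p) hP hμ1 hc j hΔ⟩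
    rintro h2 v h₁ h₂ g rfl rfl rfl rfl
    have hab : Fin.cast h2.symm 0 ≠ Fin.cast h2.symm 1 := by simp [Fin.ext_iff]
    have hd0 := EllipticToda.fBlock_two_diag hr μ (H p) (H' p) hP hμ1 hc j h2 hΔ _ _ hab
    have hd1 := EllipticToda.fBlock_two_diag hr μ (H p) (H' p) hP hμ1 hc j h2 hΔ _ _ hab.symm
    have ho0 := EllipticToda.fBlock_two_off hr μ (H p) (H' p) hP hμ1 hc j h2 _ _ hab
    have ho1 := EllipticToda.fBlock_two_off hr μ (H p) (H' p) hP hμ1 hc j h2 _ _ hab.symm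
    obtain ⟨hv, -, -, hD⟩ := EllipticToda.block_two_data hr μ (H p) (H' p) hP hμ1 hc j h2 _ _ hab
    have e1 : (‖H p ⟨j, Fin.cast h2.symm 0⟩‖ : ℂ) ^ 2 *
        (V p ⟨j, Fin.cast h2.symm 0⟩ ⟨j, Fin.cast h2.symm 0⟩)⁻¹ =
        conj (H p ⟨j, Fin.cast h2.symm 0⟩) *
          V p ⟨j, Fin.cast h2.symm 1⟩ ⟨j, Fin.cast h2.symm 1⟩ *
          H p ⟨j, Fin.cast h2.symm 0⟩ := by
      rw [EllipticToda.norm_sq_eq, inv_eq_of_mul_eq_one_right hv]; ring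
    have e2 : (‖H p ⟨j, Fin.cast h2.symm 1⟩‖ : ℂ) ^ 2 *
        V p ⟨j, Fin.cast h2.symm 0⟩ ⟨j, Fin.cast h2.symm 0⟩ =
        conj (H p ⟨j, Fin.cast h2.symm 1⟩) *
          V p ⟨j, Fin.cast h2.symm 0⟩ ⟨j, Fin.cast h2.symm 0⟩ *
          H p ⟨j, Fin.cast h2.symm 1⟩ := by
      rw [EllipticToda.norm_sq_eq]; ring
    rw [hD] at hΔ
    rw [e1, e2]
    refine ⟨right_ne_zero_of_mul hΔ, left_ne_zero_of_mul hΔ, ?_⟩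
    ext a b
    fin_cases a <;> fin_cases b
    · exact hd0
    · exact ho0
    · exact ho1
    · exact hd1
  · have hc : Even N → Even m → ∀ p ∈ U, EllipticToda.constraintForm N r m (H p) = 0 := hHconstr
    have hL : Even N → Odd m → EllipticToda.IsLaxDerivative J U V μ H H' := fun h1 h2 => by
      obtain ⟨Φ, hΦ⟩ := hH' h1 h2
      exact hΦ.isLaxDerivative hU hμ0
    refine ⟨EllipticToda.isTodaSolution_transformed hr hJ hU hV hμ0 hμ1 hH hc hL hΔ hpos,
      fun p hp => ?_⟩
    have hdiag := EllipticToda.isDiag_blockDiagonal'_mul_fBlock (H' := H') hr hV hμ1 hc hp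
    rw [EllipticToda.Om_inv, EllipticToda.Om_eq]
    ext i k
    rw [mul_diagonal, diagonal_mul]
    by_cases hik : i = k
    · subst hik
      rw [EllipticToda.ec_neg]
      have := EllipticToda.ec_ne_zero (1 - i.1)
      field_simp
    · rw [hdiag hik, mul_zero, zero_mul]
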